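/- Let $T$ be a tree with vertex set $V$, $|V| = n \ge 1$, in which every vertex $v$ has a weight $w_v > 0$ and every edge $e$ has a length $l(e) > 0$. A point of $T$ is a vertex, or the point of an edge $uv$ at distance $t \in [0, l(uv)]$ from $u$, given as $(u,v,t)$; $d(x,v)$ denotes the distance along $T$ from a point $x$ to a vertex $v$. For $\lambda \in \mathbb{R}$ and a point $x$, let $T_\lambda(x)$ be the largest covered self-inclusive subtree of $x$: a subtree of $T$ (possibly empty) with the maximum number of vertices such that $w_v\, d(x,v) \le \lambda$ for all its vertices $v$, and which, if nonempty, contains $x$ or, when $x$ is interior to an edge, at least one endpoint of that edge. The model of computation is a real RAM: unit-cost field operations and comparisons on real numbers, without rounding, and unit-cost arithmetic on integer words of $O(\log n)$ bits, with indirect addressing. The tree is given by the list of its edges (endpoints and lengths) and the list of its vertex weights. Then there are a fixed preprocessing algorithm and a fixed query algorithm such that, for all $T$, all $\lambda\in\mathbb{R}$ and all integers $1 \le k \le n$: preprocessing on input $(T,\lambda,k)$ takes $O(n\log n)$ time, and afterwards, for any point $x$ of $T$, and after any finite sequence of earlier queries, the query algorithm decides in $O(\log n\,\log k)$ time whether $T_\lambda(x)$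 has at least $k$ vertices. All implied constants are absolute, and $\log m$ in these bounds is read as $\lfloor \log_2 m\rfloor + 1$, so that the bounds do not vanish for $n = 1$ or $k = 1$. -/

import Mathlib

/-! ## A real RAM with logarithmic word size

Programs are finite texts.  A machine state has integer cells and real cells, each organised in
scalar registers and in arrays with indirect addressing. -/

namespace RealRAM

structure State where
  ireg : ℕ → ℕ
  rreg : ℕ → ℝ
  /-- `imem a i` is entry `i` of the integer array named `a`. -/
  imem : ℕ → ℕ → ℕ
  /-- `rmem a i` is entry `i` of the real array named `a`. -/
  rmem : ℕ → ℕ → ℝ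

/-- Integer expressions. -/
inductive IExp where
  | lit (m : ℕ)
  | reg (r : ℕ)
  | mem (a : ℕ) (idx : IExp)
  | add (e f : IExp)
  | sub (e f : IExp)
  | mul (e f : IExp)
  | div (e f : IExp)

/-- Real expressions: field operations and rational constants, no rounding, no conversion between
reals and integers. -/
inductive RExp where
  | lit (q : ℚ)
  | reg (r : ℕ)
  | mem (a : ℕ) (idx : IExp)
  | add (e f : RExp)
  | sub (e f : RExp)
  | mul (e f : RExp)
  | div (e f : RExp)

/-- Tests. -/
inductive BExp where
  | ilt (e f : IExp)
  | ieq (e f : IExp)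
  | rlt (e f : RExp)
  | rle (e f : RExp)
  | not (p : BExp)
  | and (p q : BExp)
  | or (p q : BExp)

/-- Subtraction is truncated at `0` and division rounds down. -/
def IExp.eval (s : State) : IExp → ℕ
  | .lit m => m
  | .reg r => s.ireg r
  | .mem a idx => s.imem a (idx.eval s)
  | .add e f => e.eval s + f.eval s
  | .sub e f => e.eval s - f.eval s
  | .mul e f => e.eval s * f.eval s
  | .div e f => e.eval s / f.eval s

noncomputable def RExp.eval (s : State) : RExp → ℝ
  | .lit q => (q : ℝ)
  | .reg r => s.rreg r
  | .mem a idx => s.rmem a (idx.eval s)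
  | .add e f => e.eval s + f.eval s
  | .sub e f => e.eval s - f.eval s
  | .mul e f => e.eval s * f.eval s
  | .div e f => e.eval s / f.eval s

def BExp.holds (s : State) : BExp → Prop
  | .ilt e f => e.eval s < f.eval s
  | .ieq e f => e.eval s = f.eval s
  | .rlt e f => e.eval s < f.eval s
  | .rle e f => e.eval s ≤ f.eval s
  | .not p => ¬ p.holds s
  | .and p q => p.holds s ∧ q.holds s
  | .or p q => p.holds s ∨ q.holds s

/-- Programs. -/
inductive Prog where
  | skip
  | setIReg (r : ℕ) (e : IExp)
  | setRReg (r : ℕ) (e : RExp)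
  | setIMem (a : ℕ) (idx : IExp) (e : IExp)
  | setRMem (a : ℕ) (idx : IExp) (e : RExp)
  | seq (c d : Prog)
  | ite (p : BExp) (c d : Prog)
  | while (p : BExp) (c : Prog)

def State.writeIReg (s : State) (r v : ℕ) : State :=
  { s with ireg := Function.update s.ireg r v }

noncomputable def State.writeRReg (s : State) (r : ℕ) (v : ℝ) : State :=
  { s with rreg := Function.update s.rreg r v }

def State.writeIMem (s : State) (a i v : ℕ) : State :=
  { s with imem := Function.update s.imem a (Function.update (s.imem a) i v) }

noncomputable def State.writeRMem (s : State) (a i : ℕ) (v : ℝ) : State :=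
  { s with rmem := Function.update s.rmem a (Function.update (s.rmem a) i v) }

/-- `Exec b c s t s'`: on a machine with `b`-bit integer words, program `c` started in state `s`
halts in state `s'` after exactly `t` steps.  Each assignment and each evaluation of a test is one
step; the expressions are part of the fixed program text, so a step is a bounded number of
elementary operations.  An integer may be stored only if it fits into a word; a program that
tries to store a larger one has no execution. -/
inductive Exec (b : ℕ) : Prog → State → ℕ → State → Prop where
  | skip (s : State) : Exec b .skip s 1 s
  | setIReg (s : State) (r : ℕ) (e : IExp) (h : e.eval s < 2 ^ b) :
      Exec b (.setIReg r e) s 1 (s.writeIReg r (e.eval s))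
  | setRReg (s : State) (r : ℕ) (e : RExp) :
      Exec b (.setRReg r e) s 1 (s.writeRReg r (e.eval s))
  | setIMem (s : State) (a : ℕ) (idx e : IExp) (h : e.eval s < 2 ^ b) :
      Exec b (.setIMem a idx e) s 1 (s.writeIMem a (idx.eval s) (e.eval s))
  | setRMem (s : State) (a : ℕ) (idx : IExp) (e : RExp) :
      Exec b (.setRMem a idx e) s 1 (s.writeRMem a (idx.eval s) (e.eval s))
  | seq {c d : Prog} {s s' s'' : State} {t t' : ℕ} (hc : Exec b c s t s')
      (hd : Exec b d s' t' s'') : Exec b (.seq c d) s (t + t') s''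
  | iteTrue {p : BExp} {c d : Prog} {s s' : State} {t : ℕ} (hp : p.holds s)
      (hc : Exec b c s t s') : Exec b (.ite p c d) s (t + 1) s'
  | iteFalse {p : BExp} {c d : Prog} {s s' : State} {t : ℕ} (hp : ¬ p.holds s)
      (hd : Exec b d s t s') : Exec b (.ite p c d) s (t + 1) s'
  | whileFalse {p : BExp} {c : Prog} {s : State} (hp : ¬ p.holds s) :
      Exec b (.while p c) s 1 s
  | whileTrue {p : BExp} {c : Prog} {s s' s'' : State} {t t' : ℕ} (hp : p.holds s)
      (hc : Exec b c s t s') (hw : Exec b (.while p c) s' t' s'') :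
      Exec b (.while p c) s (t + t' + 1) s''

end RealRAM

/-! ## Weighted trees, their points, and covered self-inclusive subtrees -/

/-- A tree on the vertices `0, …, n - 1` with positive vertex weights and edge lengths. -/
structure WeightedTree (n : ℕ) where
  graph : SimpleGraph (Fin n)
  isTree : graph.IsTree
  weight : Fin n → ℝ
  weight_pos : ∀ v, 0 < weight v
  len : Sym2 (Fin n) → ℝ
  len_pos : ∀ e ∈ graph.edgeSet, 0 < len e

namespace WeightedTree

variable {n : ℕ}

/-- A point of the tree: a vertex, or the point on edge `u v` at distance `t` from `u`. -/
inductive Point (T : WeightedTree n) where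
  | vertex (v : Fin n)
  | onEdge (u v : Fin n) (h : T.graph.Adj u v) (t : ℝ) (h0 : 0 ≤ t) (h1 : t ≤ T.len s(u, v))

/-- Distance of two vertices: the length of a shortest walk. -/
noncomputable def vdist (T : WeightedTree n) (u v : Fin n) : ℝ :=
  ⨅ p : T.graph.Walk u v, (p.edges.map T.len).sum

/-- Distance from a point to a vertex. -/
noncomputable def dist (T : WeightedTree n) : T.Point → Fin n → ℝ
  | .vertex v, z => T.vdist v z
  | .onEdge u v _ t _ _, z => min (t + T.vdist u z) (T.len s(u, v) - t + T.vdist v z)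

/-- The vertices at which a subtree can touch the point `x`: the vertex at `x` if there is one,
and both endpoints of the edge if `x` is interior to it. -/
def touch (T : WeightedTree n) : T.Point → Set (Fin n)
  | .vertex v => {v}
  | .onEdge u v _ t _ _ => {a | (a = u ∧ t < T.len s(u, v)) ∨ (a = v ∧ 0 < t)}

/-- `S` is the vertex set of a (possibly empty) subtree that is covered by `x` under `lam` and
contains `x` or has a vertex adjacent to `x` in the tree rooted at `x`. -/
structure IsCoveredSelfInclusive (T : WeightedTree n) (lam : ℝ) (x : T.Point)
    (S : Finset (Fin n)) : Prop where
  connected : (T.graph.induce (S : Set (Fin n))).Preconnected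
  self_inclusive : S.Nonempty → ∃ a ∈ S, a ∈ T.touch x
  covered : ∀ v ∈ S, T.weight v * T.dist x v ≤ lam

/-- The number of vertices of the largest covered self-inclusive subtree of `x`. -/
noncomputable def largestSize (T : WeightedTree n) (lam : ℝ) (x : T.Point) : ℕ :=
  sSup {m | ∃ S : Finset (Fin n), T.IsCoveredSelfInclusive lam x S ∧ S.card = m}

/-- A listing of the `n - 1` edges, in any order and with any order of the two ends. -/
structure EdgeList (T : WeightedTree n) where
  fst : Fin (n - 1) → Fin n
  snd : Fin (n - 1) → Fin n
  adj_iff : ∀ u v, T.graph.Adj u v ↔ ∃ i, s(fst i, snd i) = s(u, v)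

open RealRAM

/-- The initial state.  Integer registers `0, 1` hold `n, k` and real register `0` holds `lam`;
integer arrays `0, 1` and real array `0` hold the ends and the lengths of the edges, and real
array `1` holds the vertex weights.  All other cells hold `0`. -/
noncomputable def initState (T : WeightedTree n) (E : T.EdgeList) (lam : ℝ) (k : ℕ) : State where
  ireg r := if r = 0 then n else if r = 1 then k else 0
  rreg r := if r = 0 then lam else 0
  imem a i :=
    if h : i < n - 1 then
      if a = 0 then (E.fst ⟨i, h⟩ : ℕ) else if a = 1 then (E.snd ⟨i, h⟩ : ℕ) else 0
    else 0
  rmem a i :=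
    if a = 0 then
      if h : i < n - 1 then T.len s(E.fst ⟨i, h⟩, E.snd ⟨i, h⟩) else 0
    else if a = 1 then
      if h : i < n then T.weight ⟨i, h⟩ else 0
    else 0

/-- Pose a query: the point `(u, v, t)` is written into integer registers `2, 3` and real
register `1`, and nothing else is changed.  The vertex `v` is written as `(v, v, 0)`. -/
noncomputable def pose (T : WeightedTree n) (s : State) : T.Point → State
  | .vertex v => ((s.writeIReg 2 v).writeIReg 3 v).writeRReg 1 0
  | .onEdge u v _ t _ _ => ((s.writeIReg 2 u).writeIReg 3 v).writeRReg 1 t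

/-- `T.AfterQueries b query s s'`: starting from state `s`, finitely many queries (possibly none),
each answered by a run of `query`, lead to state `s'`. -/
inductive AfterQueries (T : WeightedTree n) (b : ℕ) (query : Prog) (s : State) : State → Prop where
  | none : AfterQueries T b query s s
  | more {s' s'' : State} {t : ℕ} (x : T.Point) (h : AfterQueries T b query s s')
      (hx : Exec b query (T.pose s' x) t s'') : AfterQueries T b query s s''

end WeightedTree

/-! Root the tree so that parents carry larger numbers than their children, and put `r v = lam / w
v`, so that `v` is covered if its distance is at most `r v`. A point lies on an edge between some
`j` and its parent. For `lam ≥ 0` the largest covered self-inclusive subtree is the set of all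
vertices that can be reached from the point along covered vertices (`Rooted.largestSize_eq`), so a
query has to count a reached set.

Consider a connected piece of the tree that does not contain the point and is entered at a boundary
vertex at distance `d`. If this vertex is reached, then a member is reached exactly if `d` is at
most a threshold, which depends on the member and the boundary vertex but not on the point. If the
thresholds are kept in descending order, the reached members of the piece are counted by one binary
search. The pieces are clusters, which have a top and a bottom boundary vertex and hence two
threshold lists. They arise from single vertices by raking (two clusters with the same top) and by
composition (one cluster on top of another). In a joined cluster, one part is entered directly and
the other one possibly through the first, which changes its thresholds by a monotone map `a ↦ min c
(a - l)`. Hence the sorted lists of the joined cluster are obtained by merging in linear time. That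
the lists count correctly is shown in `Cluster.reached_of_top` and `Cluster.reached_of_bot`.

The hierarchy of clusters is built in rounds. A round scans the present vertices from the leaves
upwards, composes an only child with its parent where possible, rakes leaves into siblings, and uses
no new cluster twice. It leaves at most five sixths of the clusters (`Scan.card_le`), so the depth
is `O(log n)`. The clusters of one level are disjoint, so all lists together have size `O(n log n)`,
which also bounds the time for the merging.

A query starts at the base cluster of `j` and climbs to the root of the hierarchy. It maintains, for
both boundary vertices, the distance and whether the vertex is reached, and also the number of
reached members, which needs to be right only up to truncation at `k`. In each of the `O(log n)`
steps the sibling cluster is entered at a shared boundary vertex, and the search is confined to the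
first `k` entries of its list, so it takes `O(log k)` steps (`climbStep_runs`, `min_add_search`).

On the side of the machine, loop-free code is treated by weakest preconditions, unchanged memory by
a syntactic frame rule, and running time by potentials: peeling is paid for by the remaining edges,
merging by the growth of the list storage. -/

set_option linter.unusedSimpArgs false

/-! ## Reasoning about programs of the real RAM -/

namespace RealRAM

@[simp] theorem State.writeIReg_ireg (s : State) (r v r' : ℕ) :
    (s.writeIReg r v).ireg r' = if r' = r then v else s.ireg r' := by
  simp [State.writeIReg, Function.update_apply]
@[simp] theorem State.writeIReg_rreg (s : State) (r v : ℕ) : (s.writeIReg r v).rreg = s.rreg := rfl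
@[simp] theorem State.writeIReg_imem (s : State) (r v : ℕ) : (s.writeIReg r v).imem = s.imem := rfl
@[simp] theorem State.writeIReg_rmem (s : State) (r v : ℕ) : (s.writeIReg r v).rmem = s.rmem := rfl

@[simp] theorem State.writeRReg_rreg (s : State) (r : ℕ) (v : ℝ) (r' : ℕ) :
    (s.writeRReg r v).rreg r' = if r' = r then v else s.rreg r' := by
  simp [State.writeRReg, Function.update_apply]
@[simp] theorem State.writeRReg_ireg (s : State) (r : ℕ) (v : ℝ) :
    (s.writeRReg r v).ireg = s.ireg := rfl
@[simp] theorem State.writeRReg_imem (s : State) (r : ℕ) (v : ℝ) :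
    (s.writeRReg r v).imem = s.imem := rfl
@[simp] theorem State.writeRReg_rmem (s : State) (r : ℕ) (v : ℝ) :
    (s.writeRReg r v).rmem = s.rmem := rfl

@[simp] theorem State.writeIMem_imem (s : State) (a i v a' : ℕ) :
    (s.writeIMem a i v).imem a' = if a' = a then Function.update (s.imem a) i v else s.imem a' := by
  simp [State.writeIMem, Function.update_apply]
@[simp] theorem State.writeIMem_ireg (s : State) (a i v : ℕ) :
    (s.writeIMem a i v).ireg = s.ireg := rfl
@[simp] theorem State.writeIMem_rreg (s : State) (a i v : ℕ) :
    (s.writeIMem a i v).rreg = s.rreg := rfl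
@[simp] theorem State.writeIMem_rmem (s : State) (a i v : ℕ) :
    (s.writeIMem a i v).rmem = s.rmem := rfl

@[simp] theorem State.writeRMem_rmem (s : State) (a i : ℕ) (v : ℝ) (a' : ℕ) :
    (s.writeRMem a i v).rmem a' = if a' = a then Function.update (s.rmem a) i v else s.rmem a' := by
  simp [State.writeRMem, Function.update_apply]
@[simp] theorem State.writeRMem_ireg (s : State) (a i : ℕ) (v : ℝ) :
    (s.writeRMem a i v).ireg = s.ireg := rfl
@[simp] theorem State.writeRMem_rreg (s : State) (a i : ℕ) (v : ℝ) :
    (s.writeRMem a i v).rreg = s.rreg := rfl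
@[simp] theorem State.writeRMem_imem (s : State) (a i : ℕ) (v : ℝ) :
    (s.writeRMem a i v).imem = s.imem := rfl

/-- Integer registers that a program may write. -/
def Prog.iregs : Prog → List ℕ
  | .setIReg r _ => [r]
  | .seq c d => c.iregs ++ d.iregs
  | .ite _ c d => c.iregs ++ d.iregs
  | .while _ c => c.iregs
  | _ => []

/-- Real registers that a program may write. -/
def Prog.rregs : Prog → List ℕ
  | .setRReg r _ => [r]
  | .seq c d => c.rregs ++ d.rregs
  | .ite _ c d => c.rregs ++ d.rregs
  | .while _ c => c.rregs
  | _ => []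

/-- Integer arrays that a program may write. -/
def Prog.imems : Prog → List ℕ
  | .setIMem a _ _ => [a]
  | .seq c d => c.imems ++ d.imems
  | .ite _ c d => c.imems ++ d.imems
  | .while _ c => c.imems
  | _ => []

/-- Real arrays that a program may write. -/
def Prog.rmems : Prog → List ℕ
  | .setRMem a _ _ => [a]
  | .seq c d => c.rmems ++ d.rmems
  | .ite _ c d => c.rmems ++ d.rmems
  | .while _ c => c.rmems
  | _ => []

/-- The two states agree on everything that `c` does not write. -/
structure Frame (c : Prog) (s s' : State) : Prop where
  ireg : ∀ r, r ∉ c.iregs → s'.ireg r = s.ireg r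
  rreg : ∀ r, r ∉ c.rregs → s'.rreg r = s.rreg r
  imem : ∀ a, a ∉ c.imems → s'.imem a = s.imem a
  rmem : ∀ a, a ∉ c.rmems → s'.rmem a = s.rmem a

/-- The cells that a program may write are read off from its text. Whether a cell is preserved is
then settled by deciding membership in an explicit list, and specifications need to mention only
what changes. -/
theorem Exec.frame {b : ℕ} {c : Prog} {s s' : State} {t : ℕ} (h : Exec b c s t s') :
    Frame c s s' := by
  induction h with
  | skip s => exact ⟨fun _ _ => rfl, fun _ _ => rfl, fun _ _ => rfl, fun _ _ => rfl⟩
  | setIReg s r e h =>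
    exact ⟨fun r' hr => by simp_all [Prog.iregs], fun _ _ => rfl, fun _ _ => rfl, fun _ _ => rfl⟩
  | setRReg s r e =>
    exact ⟨fun _ _ => rfl, fun r' hr => by simp_all [Prog.rregs], fun _ _ => rfl, fun _ _ => rfl⟩
  | setIMem s a i e h =>
    exact ⟨fun _ _ => rfl, fun _ _ => rfl, fun r' hr => by simp_all [Prog.imems], fun _ _ => rfl⟩
  | setRMem s a i e =>
    exact ⟨fun _ _ => rfl, fun _ _ => rfl, fun _ _ => rfl, fun r' hr => by simp_all [Prog.rmems]⟩
  | seq _ _ ih ih' =>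
    constructor <;> intro r hr <;>
      simp only [Prog.iregs, Prog.rregs, Prog.imems, Prog.rmems, List.mem_append, not_or] at hr
    · rw [ih'.ireg r hr.2, ih.ireg r hr.1]
    · rw [ih'.rreg r hr.2, ih.rreg r hr.1]
    · rw [ih'.imem r hr.2, ih.imem r hr.1]
    · rw [ih'.rmem r hr.2, ih.rmem r hr.1]
  | iteTrue _ _ ih =>
    constructor <;> intro r hr <;>
      simp only [Prog.iregs, Prog.rregs, Prog.imems, Prog.rmems, List.mem_append, not_or] at hr
    · exact ih.ireg r hr.1
    · exact ih.rreg r hr.1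
    · exact ih.imem r hr.1
    · exact ih.rmem r hr.1
  | iteFalse _ _ ih =>
    constructor <;> intro r hr <;>
      simp only [Prog.iregs, Prog.rregs, Prog.imems, Prog.rmems, List.mem_append, not_or] at hr
    · exact ih.ireg r hr.2
    · exact ih.rreg r hr.2
    · exact ih.imem r hr.2
    · exact ih.rmem r hr.2
  | whileFalse _ => exact ⟨fun _ _ => rfl, fun _ _ => rfl, fun _ _ => rfl, fun _ _ => rfl⟩
  | whileTrue _ _ _ ih ih' =>
    constructor <;> intro r hr
    · rw [ih'.ireg r hr, ih.ireg r hr]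
    · rw [ih'.rreg r hr, ih.rreg r hr]
    · rw [ih'.imem r hr, ih.imem r hr]
    · rw [ih'.rmem r hr, ih.rmem r hr]

/-- From `s`, program `c` halts, and its time and final state satisfy `Q`. -/
def Runs (b : ℕ) (c : Prog) (s : State) (Q : ℕ → State → Prop) : Prop :=
  ∃ t s', Exec b c s t s' ∧ Q t s'

theorem Runs.mono {b : ℕ} {c : Prog} {s : State} {Q R : ℕ → State → Prop} (h : Runs b c s Q)
    (hQR : ∀ t s', Q t s' → R t s') : Runs b c s R := by
  obtain ⟨t, s', h, hq⟩ := h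
  exact ⟨t, s', h, hQR _ _ hq⟩

theorem Runs.mono_frame {b : ℕ} {c : Prog} {s : State} {Q R : ℕ → State → Prop} (h : Runs b c s Q)
    (hQR : ∀ t s', Q t s' → Frame c s s' → R t s') : Runs b c s R := by
  obtain ⟨t, s', h, hq⟩ := h
  exact ⟨t, s', h, hQR _ _ hq h.frame⟩

/-- The nested postcondition lets a proof follow the program text from the left, with the two
running times added at the end. -/
theorem Runs.seq {b : ℕ} {c d : Prog} {s : State} {Q : ℕ → State → Prop}
    (h : Runs b c s fun t s' => Runs b d s' fun t' s'' => Q (t + t') s'') :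
    Runs b (.seq c d) s Q := by
  obtain ⟨t, s', h, t', s'', h', hq⟩ := h
  exact ⟨_, _, .seq h h', hq⟩

theorem Runs.ite {b : ℕ} {p : BExp} {c d : Prog} {s : State} {Q : ℕ → State → Prop}
    (hc : p.holds s → Runs b c s fun t s' => Q (t + 1) s')
    (hd : ¬ p.holds s → Runs b d s fun t s' => Q (t + 1) s') : Runs b (.ite p c d) s Q := by
  by_cases hp : p.holds s
  · obtain ⟨t, s', h, hq⟩ := hc hp
    exact ⟨_, _, .iteTrue hp h, hq⟩
  · obtain ⟨t, s', h, hq⟩ := hd hp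
    exact ⟨_, _, .iteFalse hp h, hq⟩

/-- A loop with invariant `I` and potential `f`: each round is paid for by a drop of the
potential. -/
theorem Runs.while {b : ℕ} {p : BExp} {c : Prog} (I : ℕ → State → Prop)
    (body : ∀ f s, I f s → p.holds s →
      Runs b c s fun t s' => ∃ f', t + 1 + f' ≤ f ∧ I f' s') {f : ℕ} {s : State} (h : I f s) :
    Runs b (.while p c) s fun t s' => ∃ f', t + f' ≤ f + 1 ∧ I f' s' ∧ ¬ p.holds s' := by
  induction f using Nat.strong_induction_on generalizing s with
  | _ f ih =>
    by_cases hp : p.holds s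
    · obtain ⟨t, s', hx, f', hf, hI⟩ := body f s h hp
      obtain ⟨t', s'', hx', f'', hf', hI', hp'⟩ := ih f' (by omega) hI
      exact ⟨_, _, .whileTrue hp hx hx', f'', by omega, hI', hp'⟩
    · exact ⟨_, _, .whileFalse hp, f, by omega, h, hp⟩

/-- Counting loop: the `i`-th of `N` rounds takes the invariant `I i` to `I (i + 1)`. -/
theorem Runs.for {b : ℕ} {p : BExp} {c : Prog} (I : ℕ → State → Prop) (K N : ℕ)
    (hp : ∀ i s, i ≤ N → I i s → (p.holds s ↔ i < N))
    (body : ∀ i s, i < N → I i s → Runs b c s fun t s' => t ≤ K ∧ I (i + 1) s')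
    {s : State} (h : I 0 s) :
    Runs b (.while p c) s fun t s' => t ≤ (K + 1) * N + 1 ∧ I N s' := by
  -- Each remaining round has potential `K + 1`: `K` for the body and one step for the test.
  refine (Runs.while (fun f s => ∃ i ≤ N, I i s ∧ f = (K + 1) * (N - i)) ?_
    (f := (K + 1) * N) ⟨0, Nat.zero_le _, h, rfl⟩).mono ?_
  · rintro f s ⟨i, hi, hI, rfl⟩ hs
    have hi' := (hp i s hi hI).1 hs
    refine (body i s hi' hI).mono ?_
    rintro t s' ⟨ht, hI'⟩
    refine ⟨_, ?_, i + 1, hi', hI', rfl⟩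
    obtain ⟨m, hm⟩ : ∃ m, N - i = m + 1 := ⟨N - i - 1, by omega⟩
    rw [show N - (i + 1) = m by omega, hm]
    nlinarith
  · rintro t s' ⟨f', hf, ⟨i, hi, hI, rfl⟩, hn⟩
    have : i = N := by
      by_contra hne
      exact hn ((hp i s' hi hI).2 (by omega))
    subst this
    exact ⟨by omega, hI⟩

/-- Weakest precondition of a loop-free program. -/
def wp (b : ℕ) : Prog → (State → Prop) → State → Prop
  | .skip, Q, s => Q s
  | .setIReg r e, Q, s => e.eval s < 2 ^ b ∧ Q (s.writeIReg r (e.eval s))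
  | .setRReg r e, Q, s => Q (s.writeRReg r (e.eval s))
  | .setIMem a i e, Q, s => e.eval s < 2 ^ b ∧ Q (s.writeIMem a (i.eval s) (e.eval s))
  | .setRMem a i e, Q, s => Q (s.writeRMem a (i.eval s) (e.eval s))
  | .seq c d, Q, s => wp b c (wp b d Q) s
  | .ite p c d, Q, s => (p.holds s → wp b c Q s) ∧ (¬ p.holds s → wp b d Q s)
  | .while _ _, _, _ => False

/-- An upper bound for the running time of a loop-free program. -/
def Prog.cost : Prog → ℕ
  | .seq c d => c.cost + d.cost
  | .ite _ c d => c.cost + d.cost + 1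
  | _ => 1

/-- In `cost` both branches of a test are added up, so the time bound does not depend on the state,
and only the final state needs an argument. -/
theorem Runs.of_wp {b : ℕ} {c : Prog} {s : State} {Q : State → Prop} (h : wp b c Q s) :
    Runs b c s fun t s' => t ≤ c.cost ∧ Q s' := by
  induction c generalizing s Q with
  | skip => exact ⟨_, _, .skip s, le_rfl, h⟩
  | setIReg r e => exact ⟨_, _, .setIReg s r e h.1, le_rfl, h.2⟩
  | setRReg r e => exact ⟨_, _, .setRReg s r e, le_rfl, h⟩
  | setIMem a i e => exact ⟨_, _, .setIMem s a i e h.1, le_rfl, h.2⟩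
  | setRMem a i e => exact ⟨_, _, .setRMem s a i e, le_rfl, h⟩
  | seq c d ihc ihd =>
    refine .seq ((ihc h).mono fun t s' h' => (ihd h'.2).mono fun t' s'' h'' => ⟨?_, h''.2⟩)
    exact Nat.add_le_add h'.1 h''.1
  | ite p c d ihc ihd =>
    refine .ite (fun hp => (ihc (h.1 hp)).mono fun t s' h' => ⟨?_, h'.2⟩)
      (fun hp => (ihd (h.2 hp)).mono fun t s' h' => ⟨?_, h'.2⟩) <;>
    · have := h'.1
      simp only [Prog.cost]
      omega
  | _ => exact h.elim

/-- Sequential composition whose first part is loop-free. -/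
theorem Runs.wp_seq {b : ℕ} {c d : Prog} {s : State} {Q : ℕ → State → Prop}
    (h : wp b c (fun s' => Runs b d s' fun t' s'' => ∀ t ≤ c.cost, Q (t + t') s'') s) :
    Runs b (.seq c d) s Q := by
  refine .seq ((Runs.of_wp h).mono fun t s' h' => h'.2.mono fun t' s'' h'' => h'' t h'.1)

theorem Runs.skip {b : ℕ} {s : State} {Q : ℕ → State → Prop} (h : Q 1 s) : Runs b .skip s Q :=
  ⟨_, _, .skip s, h⟩

end RealRAM

/-! ## Rooted trees and clusters

Vertices are `0, …, n - 1`; `par y > y` is the parent of `y`, and the root `n - 1` has the virtual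
parent `n`.  The edge from `y` to `par y` has length `len y`, and `y` is covered if its distance is
at most `r y`. -/

/-- `Anc n par j y`: `y` is `j` or an ancestor of `j`. -/
inductive Anc (n : ℕ) (par : ℕ → ℕ) (j : ℕ) : ℕ → Prop where
  | refl : Anc n par j j
  | step {y : ℕ} (hy : y < n) (h : Anc n par j y) : Anc n par j (par y)

/-- Distances `D` from a point `x` on the edge between `j` and `par j`, and the set `G` of the
vertices that can be reached from `x` along covered vertices. -/
structure Spread (n : ℕ) (par : ℕ → ℕ) (len r : ℕ → ℝ) (j : ℕ) (dn up : ℝ) (D : ℕ → ℝ)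
    (G : ℕ → Prop) : Prop where
  down_dist : ∀ y < n, ¬ Anc n par j y → D y = D (par y) + len y
  down_iff : ∀ y < n, ¬ Anc n par j y → (G y ↔ G (par y) ∧ D y ≤ r y)
  up_dist : ∀ y < n, Anc n par j y → y ≠ j → D (par y) = D y + len y
  up_iff : ∀ y < n, Anc n par j y → y ≠ j → (G (par y) ↔ G y ∧ D (par y) ≤ r (par y))
  base_dist : D j = dn
  base_iff : G j ↔ dn ≤ r j
  base_par_dist : D (par j) = up
  base_par_iff : G (par j) ↔ up ≤ r (par j)
  covered : ∀ y, G y → D y ≤ r y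

/-- Clusters: connected vertex sets that touch the rest of the tree at a top vertex, which is not
a member, and at a bottom vertex, which is a member. -/
inductive Cluster where
  | base (v : ℕ)
  | rake (A B : Cluster)
  | comp (A B : Cluster)

namespace Cluster

variable (par : ℕ → ℕ) (len r : ℕ → ℝ)

def top : Cluster → ℕ
  | base v => par v
  | rake _ B => top B
  | comp _ B => top B

def bot : Cluster → ℕ
  | base v => v
  | rake _ B => bot B
  | comp A _ => bot A

def mem : Cluster → Finset ℕ
  | base v => {v}
  | rake A B => mem A ∪ mem B
  | comp A B => mem A ∪ mem B

def depth : Cluster → ℕ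
  | base _ => 0
  | rake A B => max (depth A) (depth B) + 1
  | comp A B => max (depth A) (depth B) + 1

/-- The total size of all clusters in the hierarchy of a cluster. -/
def total : Cluster → ℕ
  | base _ => 1
  | rake A B => total A + total B + ((mem A).card + (mem B).card)
  | comp A B => total A + total B + ((mem A).card + (mem B).card)

/-- Distance between the bottom and the top vertex. -/
def length : Cluster → ℝ
  | base v => len v
  | rake _ B => length B
  | comp A B => length A + length B

/-- Largest distance at the bottom vertex with which the top vertex can be reached. -/
noncomputable def capUp : Cluster → ℝ
  | base v => min (r v) (r (par v) - len v)
  | rake _ B => capUp B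
  | comp A B => min (capUp A) (capUp B - length len A)

/-- Largest distance at the top vertex with which the bottom vertex can be reached. -/
noncomputable def capDown : Cluster → ℝ
  | base v => min (r (par v)) (r v - len v)
  | rake _ B => capDown B
  | comp A B => min (capDown B) (capDown A - length len B)

/-- For each member, the largest distance at the top vertex with which it can be reached. -/
noncomputable def fromTop : Cluster → List ℝ
  | base v => [min (r (par v)) (r v - len v)]
  | rake A B => fromTop A ++ (fromTop B).map fun a => min (r (top par B)) (a - 0)
  | comp A B => fromTop B ++ (fromTop A).map fun a => min (capDown par len r B) (a - length len B)

/-- For each member, the largest distance at the bottom vertex with which it can be reached. -/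
noncomputable def fromBot : Cluster → List ℝ
  | base v => [r v]
  | rake A B => fromBot B ++
      (fromTop par len r A).map fun a => min (capUp par len r B) (a - length len B)
  | comp A B => fromBot A ++ (fromBot B).map fun a => min (capUp par len r A) (a - length len A)

inductive WF (n : ℕ) : Cluster → Prop where
  | base {v : ℕ} (hv : v < n) : WF n (base v)
  | rake {A B : Cluster} (hA : WF n A) (hB : WF n B) (h : top par A = top par B)
      (hd : Disjoint (mem A) (mem B)) : WF n (rake A B)
  | comp {A B : Cluster} (hA : WF n A) (hB : WF n B) (h : top par A = bot B)
      (hd : Disjoint (mem A) (mem B)) : WF n (comp A B)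

variable {par len r} {n : ℕ}

theorem bot_mem (C : Cluster) : C.bot ∈ C.mem := by
  induction C with
  | base v => simp [bot, mem]
  | rake A B _ ihB => simp [bot, mem, ihB]
  | comp A B ihA _ => simp [bot, mem, ihA]

theorem WF.lt {C : Cluster} (h : WF par n C) {y : ℕ} (hy : y ∈ C.mem) : y < n := by
  induction h with
  | base hv => simp_all [mem]
  | rake _ _ _ _ ihA ihB | comp _ _ _ _ ihA ihB =>
    rcases Finset.mem_union.1 hy with hy | hy
    · exact ihA hy
    · exact ihB hy

theorem WF.lt_top (hpar : ∀ y < n, y < par y) {C : Cluster} (h : WF par n C) {y : ℕ}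
    (hy : y ∈ C.mem) : y < C.top par := by
  induction h generalizing y with
  | base hv => simp_all [mem, top]
  | rake _ _ h _ ihA ihB =>
    rcases Finset.mem_union.1 hy with hy | hy
    · exact h ▸ ihA hy
    · exact ihB hy
  | comp _ _ h _ ihA ihB =>
    rcases Finset.mem_union.1 hy with hy | hy
    · exact (ihA hy).trans (h.trans_lt (ihB (bot_mem _)))
    · exact ihB hy

theorem WF.par_mem {C : Cluster} (h : WF par n C) {y : ℕ} (hy : y ∈ C.mem) :
    par y ∈ C.mem ∨ par y = C.top par := by
  induction h with
  | base hv => simp_all [mem, top]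
  | rake _ _ h _ ihA ihB =>
    rcases Finset.mem_union.1 hy with hy | hy
    · rcases ihA hy with h' | h'
      · exact .inl (Finset.mem_union_left _ h')
      · exact .inr (h'.trans h)
    · rcases ihB hy with h' | h'
      · exact .inl (Finset.mem_union_right _ h')
      · exact .inr h'
  | comp _ _ h _ ihA ihB =>
    rcases Finset.mem_union.1 hy with hy | hy
    · rcases ihA hy with h' | h'
      · exact .inl (Finset.mem_union_left _ h')
      · exact .inl (Finset.mem_union_right _ (by rw [h', h]; exact bot_mem _))
    · rcases ihB hy with h' | h'
      · exact .inl (Finset.mem_union_right _ h')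
      · exact .inr h'

/-- On each of the `depth + 1` levels of the hierarchy every member is counted at most once. -/
theorem total_le {C : Cluster} (h : WF par n C) : C.total ≤ C.mem.card * (C.depth + 1) := by
  induction h with
  | base hv => simp [mem, total]
  | @rake A B _ _ _ hd ihA ihB | @comp A B _ _ _ hd ihA ihB =>
    have h1 : (mem A).card * (A.depth + 1) ≤ (mem A).card * (max A.depth B.depth + 1) :=
      Nat.mul_le_mul_left _ (by omega)
    have h2 : (mem B).card * (B.depth + 1) ≤ (mem B).card * (max A.depth B.depth + 1) :=
      Nat.mul_le_mul_left _ (by omega)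
    simp only [mem, total, depth, Finset.card_union_of_disjoint hd]
    nlinarith

end Cluster

/-! ### Ancestors -/

section Ancestors

variable {n : ℕ} {par : ℕ → ℕ} {j : ℕ}

theorem Anc.trans {y z : ℕ} (h : Anc n par j y) (h' : Anc n par y z) : Anc n par j z := by
  induction h' with
  | refl => exact h
  | step hy _ ih => exact .step hy ih

theorem Anc.total {y z : ℕ} (hy : Anc n par j y) (hz : Anc n par j z) :
    Anc n par y z ∨ Anc n par z y := by
  induction hz with
  | refl => exact .inr hy
  | @step z hz _ ih =>
    rcases ih with ih | ih
    · exact .inl (.step hz ih)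
    · have : ∀ w, Anc n par z w → w = z ∨ Anc n par (par z) w := by
        intro w hw
        induction hw with
        | refl => exact .inl rfl
        | step hw _ ih =>
          rcases ih with rfl | ih
          · exact .inr .refl
          · exact .inr (.step hw ih)
      rcases this y ih with rfl | h
      · exact .inl (.step hz .refl)
      · exact .inr h

/-- Passing to a parent leaves a cluster only at its top vertex, and numbers grow along ancestors.
-/
theorem Anc.mem_or_top_le (hpar : ∀ y < n, y < par y) {C : Cluster} (h : C.WF par n)
    (hj : j ∈ C.mem) {y : ℕ} (hy : Anc n par j y) : y ∈ C.mem ∨ C.top par ≤ y := by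
  induction hy with
  | refl => exact .inl hj
  | @step y hyn _ ih =>
    rcases ih with ih | ih
    · rcases h.par_mem ih with h' | h'
      · exact .inl h'
      · exact .inr h'.ge
    · exact .inr (ih.trans (hpar y hyn).le)

theorem Anc.top_of_mem (hpar : ∀ y < n, y < par y) {C : Cluster} (h : C.WF par n)
    {y : ℕ} (hy : y ∈ C.mem) : Anc n par y (C.top par) := by
  have key : ∀ m y, y ∈ C.mem → n - y = m → Anc n par y (C.top par) := by
    intro m
    induction m using Nat.strong_induction_on with
    | _ m ih =>
      rintro y hy rfl
      have hyn := h.lt hy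
      have := hpar y hyn
      rcases h.par_mem hy with h' | h'
      · exact (Anc.step hyn .refl).trans (ih _ (by omega) _ h' rfl)
      · exact h' ▸ Anc.step hyn .refl
  exact key _ y hy rfl

end Ancestors

/-! ### Counting reached members -/

namespace Cluster

variable {n : ℕ} {par : ℕ → ℕ} {len r : ℕ → ℝ} {j : ℕ} {dn up : ℝ} {D : ℕ → ℝ} {G : ℕ → Prop}

open Classical in
/-- The number of reached members. -/
noncomputable def reached (G : ℕ → Prop) (C : Cluster) : ℕ := (C.mem.filter G).card

theorem reached_union {A B C : Cluster} (h : C.mem = A.mem ∪ B.mem) (hd : Disjoint A.mem B.mem) :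
    C.reached G = A.reached G + B.reached G := by
  classical
  unfold reached
  rw [h, Finset.filter_union, Finset.card_union_of_disjoint]
  exact Finset.disjoint_filter_filter hd

open Classical in
/-- The number of entries that are at least `d`. -/
noncomputable def atLeast (d : ℝ) (L : List ℝ) : ℕ := L.countP fun a => decide (d ≤ a)

theorem atLeast_append (d : ℝ) (L M : List ℝ) : atLeast d (L ++ M) = atLeast d L + atLeast d M := by
  simp [atLeast]

/-- The map describes an entry through another piece: `c` is the largest distance with which that
piece is traversed, and `l` is its length. Counting behind the piece thus means one comparison with
`c` and a shift of `d`. All joins have this shape, with `l = 0` if nothing has to be traversed. -/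
theorem atLeast_map_min (d c l : ℝ) (L : List ℝ) :
    atLeast d (L.map fun a => min c (a - l)) = if d ≤ c then atLeast (d + l) L else 0 := by
  classical
  unfold atLeast
  rw [List.countP_map]
  split_ifs with h
  · refine List.countP_congr fun a _ => ?_
    simp [h, le_sub_iff_add_le]
  · rw [List.countP_eq_zero]
    intro a _
    simp [h]

open Classical in
-- No member is an ancestor of `j`, so each member inherits distance and reachedness from its parent
-- and finally from the top. The three facts are carried through the induction together: in a
-- composition the lower cluster is entered at the bottom of the upper one, and the last two facts
-- express the state there by the state at the top.
theorem reached_of_top (S : Spread n par len r j dn up D G) {C : Cluster} (h : C.WF par n)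
    (hU : ∀ y ∈ C.mem, ¬ Anc n par j y) :
    (C.reached G = if G (C.top par) then atLeast (D (C.top par)) (C.fromTop par len r) else 0) ∧
    (G C.bot ↔ G (C.top par) ∧ D (C.top par) ≤ C.capDown par len r) ∧
    D C.bot = D (C.top par) + C.length len := by
  induction h with
  | @base v hv =>
    have hU' := hU v (by simp [mem])
    have h1 := S.down_dist v hv hU'
    have h2 := S.down_iff v hv hU'
    -- The additional bound by `r (par v)` excludes nothing, because a reached parent is covered.
    have h3 : G v ↔ G (par v) ∧ D (par v) ≤ min (r (par v)) (r v - len v) := by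
      rw [h2, h1, le_min_iff, le_sub_iff_add_le]
      exact ⟨fun h => ⟨h.1, S.covered _ h.1, h.2⟩, fun h => ⟨h.1, h.2.2⟩⟩
    refine ⟨?_, h3, h1⟩
    simp only [reached, mem, top, fromTop, atLeast, Finset.filter_singleton, List.countP_singleton]
    by_cases hp : G (par v) <;> by_cases hd : D (par v) ≤ min (r (par v)) (r v - len v) <;>
      simp [h3, hp, hd]
  | @rake A B hA hB h hd ihA ihB =>
    obtain ⟨a1, -, -⟩ := ihA fun y hy => hU y (Finset.mem_union_left _ hy)
    obtain ⟨b1, b2, b3⟩ := ihB fun y hy => hU y (Finset.mem_union_right _ hy)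
    refine ⟨?_, b2, b3⟩
    rw [reached_union (C := rake A B) rfl hd, a1, b1, h]
    simp only [top, fromTop, atLeast_append, atLeast_map_min, add_zero]
    by_cases hG : G (top par B)
    · simp [hG, S.covered _ hG]
    · simp [hG]
  | @comp A B hA hB h hd ihA ihB =>
    obtain ⟨a1, a2, a3⟩ := ihA fun y hy => hU y (Finset.mem_union_left _ hy)
    obtain ⟨b1, b2, b3⟩ := ihB fun y hy => hU y (Finset.mem_union_right _ hy)
    rw [h, b3] at a1 a2 a3
    rw [b2] at a1 a2
    refine ⟨?_, ?_, ?_⟩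
    · rw [reached_union (C := comp A B) rfl hd, a1, b1]
      simp only [top, fromTop, atLeast_append, atLeast_map_min]
      by_cases hG : G (top par B) <;> simp [hG, add_comm]
    · simp only [bot, top, capDown, le_min_iff, a2, le_sub_iff_add_le, and_assoc]
    · simp only [bot, top, length, a3]
      ring

open Classical in
-- The bottom is an ancestor of `j` and `j` is outside, so the path from the bottom to the top leads
-- away from the point. Clusters that are raked onto this path contain no ancestor of `j` and are
-- entered at their tops, where `reached_of_top` applies.
theorem reached_of_bot (hpar : ∀ y < n, y < par y) (S : Spread n par len r j dn up D G)
    {C : Cluster} (h : C.WF par n) (hj : j ∉ C.mem) (hb : Anc n par j C.bot) :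
    (C.reached G = if G C.bot then atLeast (D C.bot) (C.fromBot par len r) else 0) ∧
    (G (C.top par) ↔ G C.bot ∧ D C.bot ≤ C.capUp par len r) ∧
    D (C.top par) = D C.bot + C.length len := by
  induction h with
  | @base v hv =>
    have hj' : v ≠ j := fun h => hj (by simp [mem, h])
    have h1 := S.up_dist v hv hb hj'
    have h2 := S.up_iff v hv hb hj'
    have h3 : G (par v) ↔ G v ∧ D v ≤ min (r v) (r (par v) - len v) := by
      rw [h2, h1, le_min_iff, le_sub_iff_add_le]
      exact ⟨fun h => ⟨h.1, S.covered _ h.1, h.2⟩, fun h => ⟨h.1, h.2.2⟩⟩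
    refine ⟨?_, h3, h1⟩
    simp only [reached, mem, bot, fromBot, atLeast, Finset.filter_singleton, List.countP_singleton]
    by_cases hG : G v
    · simp [hG, S.covered _ hG]
    · simp [hG]
  | @rake A B hA hB h hd ihA ihB =>
    have hjB : j ∉ B.mem := fun hh => hj (Finset.mem_union_right _ hh)
    -- Two ancestors of `j` are comparable. An ancestor in `A` would be comparable with the bottom
    -- of `B`, although the way up from either cluster leaves it only at the common top.
    have hUA : ∀ y ∈ A.mem, ¬ Anc n par j y := by
      intro y hy hyj
      have hyt := hA.lt_top hpar hy
      rcases Anc.total hyj hb with h' | h'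
      · rcases Anc.mem_or_top_le hpar hA hy h' with h'' | h''
        · exact Finset.disjoint_left.1 hd h'' (bot_mem B)
        · have := hB.lt_top hpar (bot_mem B)
          rw [h] at h''
          exact absurd this (not_lt.2 h'')
      · rcases Anc.mem_or_top_le hpar hB (bot_mem B) h' with h'' | h''
        · exact Finset.disjoint_left.1 hd hy h''
        · omega
    obtain ⟨b1, b2, b3⟩ := ihB hjB hb
    obtain ⟨a1, -, -⟩ := reached_of_top S hA hUA
    refine ⟨?_, b2, b3⟩
    rw [reached_union (C := rake A B) rfl hd, a1, b1, h, b3, b2]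
    simp only [bot, fromBot, atLeast_append, atLeast_map_min]
    by_cases hG : G (bot B) <;> simp [hG, add_comm]
  | @comp A B hA hB h hd ihA ihB =>
    have hjA : j ∉ A.mem := fun hh => hj (Finset.mem_union_left _ hh)
    have hjB : j ∉ B.mem := fun hh => hj (Finset.mem_union_right _ hh)
    obtain ⟨a1, a2, a3⟩ := ihA hjA hb
    have hbB : Anc n par j B.bot := h ▸ Anc.trans hb (Anc.top_of_mem hpar hA (bot_mem A))
    obtain ⟨b1, b2, b3⟩ := ihB hjB hbB
    rw [← h, a3] at b1 b2 b3
    rw [a2] at b1 b2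
    refine ⟨?_, ?_, ?_⟩
    · rw [reached_union (C := comp A B) rfl hd, a1, b1]
      simp only [bot, fromBot, atLeast_append, atLeast_map_min]
      by_cases hG : G (bot A) <;> simp [hG]
    · simp only [bot, top, capUp, le_min_iff, b2, le_sub_iff_add_le, and_assoc]
    · simp only [bot, top, length, b3]
      ring

/-- The siblings of a cluster that contains `j` are entered from the expected side. -/
theorem not_anc_of_rake_left (hpar : ∀ y < n, y < par y) {A B : Cluster} (h : (rake A B).WF par n)
    (hj : j ∈ A.mem) : ∀ y ∈ B.mem, ¬ Anc n par j y := by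
  cases h with
  | rake hA hB h hd =>
    intro y hy hyj
    rcases Anc.mem_or_top_le hpar hA hj hyj with h' | h'
    · exact Finset.disjoint_left.1 hd h' hy
    · have := hB.lt_top hpar hy
      omega

theorem not_anc_of_rake_right (hpar : ∀ y < n, y < par y) {A B : Cluster}
    (h : (rake A B).WF par n) (hj : j ∈ B.mem) : ∀ y ∈ A.mem, ¬ Anc n par j y := by
  cases h with
  | rake hA hB h hd =>
    intro y hy hyj
    rcases Anc.mem_or_top_le hpar hB hj hyj with h' | h'
    · exact Finset.disjoint_left.1 hd hy h'
    · have := hA.lt_top hpar hy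
      omega

theorem not_anc_of_comp_right (hpar : ∀ y < n, y < par y) {A B : Cluster}
    (h : (comp A B).WF par n) (hj : j ∈ B.mem) : ∀ y ∈ A.mem, ¬ Anc n par j y := by
  cases h with
  | comp hA hB h hd =>
    intro y hy hyj
    rcases Anc.mem_or_top_le hpar hB hj hyj with h' | h'
    · exact Finset.disjoint_left.1 hd hy h'
    · have := hA.lt_top hpar hy
      have := hB.lt_top hpar (bot_mem B)
      omega

theorem anc_of_comp_left (hpar : ∀ y < n, y < par y) {A B : Cluster}
    (h : (comp A B).WF par n) (hj : j ∈ A.mem) : Anc n par j B.bot := by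
  cases h with
  | comp hA hB h hd => exact h ▸ Anc.top_of_mem hpar hA hj

end Cluster

/-! ### Existence of distances and reached sets -/

section Spread

variable {n : ℕ} {par : ℕ → ℕ} {len r : ℕ → ℝ} {j : ℕ} {dn up : ℝ}

/-- Distance to the virtual parent of the root. -/
noncomputable def height (n : ℕ) (par : ℕ → ℕ) (len : ℕ → ℝ) (y : ℕ) : ℝ :=
  if _h : y < n ∧ y < par y then height n par len (par y) + len y else 0
termination_by n - y
decreasing_by omega

open Classical in
/-- Distance from the point of the edge between `j` and `par j` that is `dn` away from `j` and `up`
away from `par j`. -/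
noncomputable def spreadDist (n : ℕ) (par : ℕ → ℕ) (len : ℕ → ℝ) (j : ℕ) (dn up : ℝ) (y : ℕ) : ℝ :=
  if y = j then dn
  else if _h : ¬ Anc n par j y ∧ y < n ∧ y < par y then
    spreadDist n par len j dn up (par y) + len y
  else up + height n par len (par j) - height n par len y
termination_by n - y
decreasing_by omega

/-- The vertices reached from the point of `spreadDist` along covered vertices. -/
inductive Reach (n : ℕ) (par : ℕ → ℕ) (len r : ℕ → ℝ) (j : ℕ) (dn up : ℝ) : ℕ → Prop where
  | base (h : dn ≤ r j) : Reach n par len r j dn up j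
  | base_par (h : up ≤ r (par j)) : Reach n par len r j dn up (par j)
  | up {y : ℕ} (hy : y < n) (ha : Anc n par j y) (hne : y ≠ j) (h : Reach n par len r j dn up y)
      (hc : spreadDist n par len j dn up (par y) ≤ r (par y)) : Reach n par len r j dn up (par y)
  | down {y : ℕ} (hy : y < n) (ha : ¬ Anc n par j y) (h : Reach n par len r j dn up (par y))
      (hc : spreadDist n par len j dn up y ≤ r y) : Reach n par len r j dn up y

theorem Anc.le (hpar : ∀ y < n, y < par y) {y z : ℕ} (h : Anc n par y z) : y ≤ z := by
  induction h with
  | refl => exact le_rfl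
  | step hy _ ih => exact ih.trans (hpar _ hy).le

theorem Anc.eq_or_par {y z : ℕ} (h : Anc n par y z) : z = y ∨ Anc n par (par y) z := by
  induction h with
  | refl => exact .inl rfl
  | step hy _ ih =>
    rcases ih with rfl | ih
    · exact .inr .refl
    · exact .inr (.step hy ih)

/-- The ancestors of `j` form a chain. Of two distinct ones the upper is at or above the parent of
the lower, so its own parent has a larger number. -/
theorem Anc.par_inj (hpar : ∀ y < n, y < par y) {y z : ℕ} (hy : Anc n par j y)
    (hz : Anc n par j z) (hyn : y < n) (hzn : z < n) (h : par y = par z) : y = z := by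
  have hy' := hpar y hyn
  have hz' := hpar z hzn
  rcases Anc.total hy hz with h' | h'
  · rcases h'.eq_or_par with h' | h'
    · exact h'.symm
    · have := h'.le hpar
      omega
  · rcases h'.eq_or_par with h' | h'
    · exact h'
    · have := h'.le hpar
      omega

/-- `Reach` is inductive, so the equivalences say that only one constructor can lead to a vertex:
the step from the parent for a vertex that is not an ancestor of `j`, and the step from the
preceding ancestor for the ancestors beyond `par j`. The distances along ancestors are telescoping
differences of heights. -/
theorem spread (hpar : ∀ y < n, y < par y) (hj : j < n) :
    Spread n par len r j dn up (spreadDist n par len j dn up) (Reach n par len r j dn up) := by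
  have hanc : Anc n par j (par j) := .step hj .refl
  have hjp := hpar j hj
  have hheight : ∀ y < n, height n par len y = height n par len (par y) + len y := by
    intro y hy
    rw [height, dif_pos ⟨hy, hpar y hy⟩]
  have hup : ∀ y, Anc n par j y → y ≠ j →
      spreadDist n par len j dn up y = up + height n par len (par j) - height n par len y := by
    intro y hy hne
    rw [spreadDist, if_neg hne, dif_neg (fun h => h.1 hy)]
  have hpd : spreadDist n par len j dn up (par j) = up := by
    rw [hup _ hanc (by omega)]
    ring
  have hbd : spreadDist n par len j dn up j = dn := by rw [spreadDist, if_pos rfl]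
  have hne_of : ∀ y < n, Anc n par j y → par y ≠ j := by
    intro y hy ha h
    have := ha.le hpar
    have := hpar y hy
    omega
  have hcov : ∀ y, Reach n par len r j dn up y → spreadDist n par len j dn up y ≤ r y := by
    intro y hy
    cases hy with
    | base h => rwa [hbd]
    | base_par h => rwa [hpd]
    | up _ _ _ _ hc => exact hc
    | down _ _ _ hc => exact hc
  refine ⟨?_, ?_, ?_, ?_, hbd, ?_, hpd, ?_, hcov⟩
  · intro y hy ha
    have hne : y ≠ j := by
      rintro rfl
      exact ha .refl
    rw [spreadDist, if_neg hne, dif_pos ⟨ha, hy, hpar y hy⟩]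
  · intro y hy ha
    refine ⟨fun h => ⟨?_, hcov y h⟩, fun h => .down hy ha h.1 h.2⟩
    cases h with
    | base => exact (ha .refl).elim
    | base_par => exact (ha hanc).elim
    | up hy' ha' => exact (ha (.step hy' ha')).elim
    | down _ _ h => exact h
  · intro y hy ha hne
    rw [hup y ha hne, hup _ (.step hy ha) (hne_of y hy ha), hheight y hy]
    ring
  · intro y hy ha hne
    refine ⟨fun h => ⟨?_, hcov _ h⟩, fun h => .up hy ha hne h.1 h.2⟩
    generalize hz : par y = z at h
    cases h with
    | base => exact absurd hz (hne_of y hy ha)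
    | base_par => exact absurd (Anc.par_inj hpar ha .refl hy hj hz) hne
    | up hy' ha' _ h => exact Anc.par_inj hpar ha ha' hy hy' hz ▸ h
    | down _ ha' => exact (ha' (hz ▸ .step hy ha)).elim
  · refine ⟨fun h => hbd ▸ hcov _ h, .base⟩
  · refine ⟨fun h => hpd ▸ hcov _ h, .base_par⟩

end Spread

/-! ### Rooted numbering of a tree -/

/-- `pos` numbers the vertices of `T` so that `par`, `len`, `r` describe the tree, rooted at the
vertex number `n - 1`, and the covering radii. -/
structure WeightedTree.Rooted {n : ℕ} (T : WeightedTree n) (lam : ℝ) (pos par : ℕ → ℕ)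
    (len r : ℕ → ℝ) : Prop where
  pos_lt : ∀ v < n, pos v < n
  pos_inj : ∀ u < n, ∀ v < n, pos u = pos v → u = v
  lt_par : ∀ j < n, j < par j
  par_le : ∀ j < n, par j ≤ n
  par_eq : ∀ j < n, par j = n → j = n - 1
  adj_iff : ∀ u v : Fin n, T.graph.Adj u v ↔ par (pos u) = pos v ∨ par (pos v) = pos u
  len_eq : ∀ u v : Fin n, par (pos u) = pos v → len (pos u) = T.len s(u, v)
  r_eq : ∀ v : Fin n, r (pos v) = lam / T.weight v

namespace WeightedTree

variable {n : ℕ} {T : WeightedTree n} {lam : ℝ} {pos par : ℕ → ℕ} {len r : ℕ → ℝ}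

/-- `(j, dn, up)` are the coordinates of the point `x` in the rooted numbering. -/
inductive Rooted.Located (pos par : ℕ → ℕ) (len : ℕ → ℝ) (T : WeightedTree n) :
    T.Point → ℕ → ℝ → ℝ → Prop where
  | vertex (v : Fin n) : Located pos par len T (.vertex v) (pos v) 0 (len (pos v))
  | lower (u v : Fin n) (h : T.graph.Adj u v) (t : ℝ) (h0 : 0 ≤ t) (h1 : t ≤ T.len s(u, v))
      (hp : par (pos u) = pos v) :
      Located pos par len T (.onEdge u v h t h0 h1) (pos u) t (T.len s(u, v) - t)
  | upper (u v : Fin n) (h : T.graph.Adj u v) (t : ℝ) (h0 : 0 ≤ t) (h1 : t ≤ T.len s(u, v))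
      (hp : par (pos v) = pos u) :
      Located pos par len T (.onEdge u v h t h0 h1) (pos v) (T.len s(u, v) - t) t

open Rooted (Located)

theorem Rooted.exists_pos (R : T.Rooted lam pos par len r) {j : ℕ} (hj : j < n) :
    ∃ v : Fin n, pos v = j := by
  have hinj : Function.Injective fun v : Fin n => (⟨pos v, R.pos_lt v v.2⟩ : Fin n) := by
    intro u v h
    exact Fin.ext (R.pos_inj u u.2 v v.2 (by simpa using h))
  obtain ⟨v, hv⟩ := (Finite.injective_iff_surjective.1 hinj) ⟨j, hj⟩
  exact ⟨v, by simpa using hv⟩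

theorem Rooted.Located.lt (R : T.Rooted lam pos par len r) {x : T.Point} {j : ℕ} {dn up : ℝ}
    (h : Located pos par len T x j dn up) : j < n := by
  cases h with
  | vertex v => exact R.pos_lt v v.2
  | lower u v => exact R.pos_lt u u.2
  | upper u v => exact R.pos_lt v v.2

section Dist

variable {j : ℕ} {dn up : ℝ} {D : ℕ → ℝ} {G : ℕ → Prop}

/-- The distances at the ends of an edge differ exactly by its length, except possibly on the edge
that carries the point, where they are `t` and the length minus `t`. Summed along walks, this is the
lower bound for distances in the tree. -/
theorem Rooted.abs_sub_le (R : T.Rooted lam pos par len r) {x : T.Point}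
    (hx : Located pos par len T x j dn up) (S : Spread n par len r j dn up D G) {u v : Fin n}
    (h : T.graph.Adj u v) : D (pos v) - D (pos u) ≤ T.len s(u, v) := by
  have key : ∀ u v : Fin n, T.graph.Adj u v → par (pos u) = pos v →
      D (pos v) - D (pos u) ≤ T.len s(u, v) ∧ D (pos u) - D (pos v) ≤ T.len s(u, v) := by
    intro u v h hp
    have hl := T.len_pos s(u, v) h
    have hle := R.len_eq u v hp
    have hu := R.pos_lt u u.2
    by_cases ha : Anc n par j (pos u)
    · by_cases hj : pos u = j
      · have h1 := S.base_dist
        have h2 := S.base_par_dist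
        rw [← hj] at h1 h2
        rw [hp] at h2
        rw [h1, h2]
        cases hx with
        | vertex w => rw [← hj, hle]; constructor <;> linarith
        | lower a b hab t h0 h1 hp' =>
          obtain rfl : u = a := Fin.ext (R.pos_inj _ u.2 _ a.2 hj)
          obtain rfl : v = b := Fin.ext (R.pos_inj _ v.2 _ b.2 (hp ▸ hp'))
          constructor <;> linarith
        | upper a b hab t h0 h1' hp' =>
          obtain rfl : u = b := Fin.ext (R.pos_inj _ u.2 _ b.2 hj)
          obtain rfl : v = a := Fin.ext (R.pos_inj _ v.2 _ a.2 (hp ▸ hp'))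
          rw [Sym2.eq_swap]
          constructor <;> linarith [Sym2.eq_swap (a := u) (b := v) ▸ h1']
      · have := S.up_dist _ hu ha hj
        rw [hp, hle] at this
        constructor <;> linarith
    · have := S.down_dist _ hu ha
      rw [hp, hle] at this
      constructor <;> linarith
  rcases (R.adj_iff u v).1 h with hp | hp
  · exact (key u v h hp).1
  · rw [Sym2.eq_swap]
    exact (key v u h.symm hp).2

theorem Rooted.sub_le_walk (R : T.Rooted lam pos par len r) {x : T.Point}
    (hx : Located pos par len T x j dn up) (S : Spread n par len r j dn up D G) {u v : Fin n}
    (p : T.graph.Walk u v) : D (pos v) - D (pos u) ≤ (p.edges.map T.len).sum := by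
  induction p with
  | nil => simp
  | cons h p ih =>
    have := R.abs_sub_le hx S h
    simp only [SimpleGraph.Walk.edges_cons, List.map_cons, List.sum_cons]
    linarith

theorem vdist_le {u v : Fin n} (p : T.graph.Walk u v) : T.vdist u v ≤ (p.edges.map T.len).sum := by
  refine ciInf_le ⟨0, ?_⟩ p
  rintro _ ⟨q, rfl⟩
  refine List.sum_nonneg fun a ha => ?_
  obtain ⟨e, he, rfl⟩ := List.mem_map.1 ha
  exact (T.len_pos e (q.edges_subset_edgeSet he)).le

theorem Rooted.sub_le_vdist (R : T.Rooted lam pos par len r) {x : T.Point}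
    (hx : Located pos par len T x j dn up) (S : Spread n par len r j dn up D G) (u v : Fin n) :
    D (pos v) - D (pos u) ≤ T.vdist u v := by
  have : Nonempty (T.graph.Walk u v) := T.isTree.connected.preconnected u v
  exact le_ciInf fun p => R.sub_le_walk hx S p

/-- Every vertex is joined to an end of the edge of the point by a walk on which `D` increases and
which stays in `G` if it ends there. -/
theorem Rooted.exists_walk (R : T.Rooted lam pos par len r) (hj : j < n)
    (S : Spread n par len r j dn up D G) (v : Fin n) :
    ∃ (a : Fin n) (p : T.graph.Walk a v), (pos a = j ∨ pos a = par j) ∧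
      (p.edges.map T.len).sum = D (pos v) - D (pos a) ∧
      (G (pos v) → ∀ w ∈ p.support, G (pos w)) := by
  have step : ∀ {u v : Fin n} (h : T.graph.Adj u v), D (pos v) = D (pos u) + T.len s(u, v) →
      (G (pos v) → G (pos u)) →
      (∃ (a : Fin n) (p : T.graph.Walk a u), (pos a = j ∨ pos a = par j) ∧
        (p.edges.map T.len).sum = D (pos u) - D (pos a) ∧
        (G (pos u) → ∀ w ∈ p.support, G (pos w))) →
      ∃ (a : Fin n) (p : T.graph.Walk a v), (pos a = j ∨ pos a = par j) ∧
        (p.edges.map T.len).sum = D (pos v) - D (pos a) ∧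
        (G (pos v) → ∀ w ∈ p.support, G (pos w)) := by
    rintro u v h hD hG ⟨a, p, ha, hs, hp⟩
    refine ⟨a, p.concat h, ha, ?_, ?_⟩
    · rw [SimpleGraph.Walk.edges_concat, List.concat_eq_append, List.map_append, List.sum_append, hs, hD]
      simp
      ring
    · intro hv w hw
      rw [SimpleGraph.Walk.support_concat, List.mem_append] at hw
      rcases hw with hw | hw
      · exact hp (hG hv) w hw
      · rw [List.mem_singleton] at hw
        exact hw ▸ hv
  have base : ∀ v : Fin n, pos v = j ∨ pos v = par j →
      ∃ (a : Fin n) (p : T.graph.Walk a v), (pos a = j ∨ pos a = par j) ∧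
        (p.edges.map T.len).sum = D (pos v) - D (pos a) ∧
        (G (pos v) → ∀ w ∈ p.support, G (pos w)) :=
    fun v hv => ⟨v, .nil, hv, by simp, by simp⟩
  -- Ancestors of `j` are reached by walking up from the edge of the point, all other vertices by
  -- coming down from their parents.
  have hanc : ∀ y, Anc n par j y → ∀ v : Fin n, pos v = y →
      ∃ (a : Fin n) (p : T.graph.Walk a v), (pos a = j ∨ pos a = par j) ∧
        (p.edges.map T.len).sum = D (pos v) - D (pos a) ∧
        (G (pos v) → ∀ w ∈ p.support, G (pos w)) := by
    intro y hy
    induction hy with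
    | refl => exact fun v hv => base v (.inl hv)
    | @step y hy ha ih =>
      intro v hv
      obtain ⟨u, hu⟩ := R.exists_pos hy
      by_cases hne : y = j
      · exact base v (.inr (hne ▸ hv))
      · have hp : par (pos u) = pos v := by rw [hu, hv]
        have hadj := (R.adj_iff u v).2 (.inl hp)
        have hl := R.len_eq u v hp
        refine step hadj ?_ ?_ (ih u hu)
        · rw [← hl, hv, hu, S.up_dist y hy ha hne]
        · rw [hv, hu]
          exact fun h => ((S.up_iff y hy ha hne).1 h).1
  have key : ∀ m, ∀ v : Fin n, n - pos v = m →
      ∃ (a : Fin n) (p : T.graph.Walk a v), (pos a = j ∨ pos a = par j) ∧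
        (p.edges.map T.len).sum = D (pos v) - D (pos a) ∧
        (G (pos v) → ∀ w ∈ p.support, G (pos w)) := by
    intro m
    induction m using Nat.strong_induction_on with
    | _ m ih =>
      rintro v rfl
      by_cases ha : Anc n par j (pos v)
      · exact hanc _ ha v rfl
      · have hv := R.pos_lt v v.2
        have hlt := R.lt_par _ hv
        have hle := R.par_le _ hv
        -- The root is an ancestor of every vertex. A vertex that is not an ancestor of `j`
        -- therefore has a parent which is a vertex, not the virtual one.
        have hpn : par (pos v) ≠ n := by
          intro hpn
          have h1 := R.par_eq _ hv hpn
          have : ∀ m y, n - y = m → y < n → Anc n par y (n - 1) := by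
            intro m
            induction m using Nat.strong_induction_on with
            | _ m ih =>
              rintro y rfl hy
              by_cases hyn : y = n - 1
              · exact hyn ▸ .refl
              · have h2 := R.lt_par y hy
                have h3 := R.par_le y hy
                have h4 : par y ≠ n := fun h => hyn (R.par_eq y hy h)
                exact (Anc.step hy .refl).trans (ih _ (by omega) _ rfl (by omega))
          exact ha (h1 ▸ this _ j rfl hj)
        obtain ⟨u, hu⟩ := R.exists_pos (show par (pos v) < n by omega)
        have hadj := (R.adj_iff u v).2 (.inr hu.symm)
        have hl := R.len_eq v u hu.symm
        refine step hadj ?_ ?_ (ih _ ?_ u rfl)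
        · rw [Sym2.eq_swap, ← hl, hu, S.down_dist _ hv ha]
        · rw [hu]
          exact fun h => ((S.down_iff _ hv ha).1 h).1
        · rw [hu]
          omega
  exact key _ v rfl

/-- The lower bound is `sub_le_vdist`; the upper bound is the walk from `exists_walk`, which starts
at one of the two ends of the edge of the point. -/
theorem Rooted.dist_eq (R : T.Rooted lam pos par len r) {x : T.Point}
    (hx : Located pos par len T x j dn up) (S : Spread n par len r j dn up D G) (v : Fin n) :
    T.dist x v = D (pos v) := by
  have hj := hx.lt R
  obtain ⟨a, p, ha, hs, -⟩ := R.exists_walk hj S v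
  have hlow := fun u => R.sub_le_vdist hx S u v
  have hb := S.base_dist
  have hbp := S.base_par_dist
  have hp := vdist_le p
  rw [hs] at hp
  cases hx with
  | vertex w =>
    refine le_antisymm ?_ ?_
    · simp only [dist]
      rcases ha with ha | ha
      · obtain rfl : a = w := Fin.ext (R.pos_inj _ a.2 _ w.2 ha)
        rw [hb] at hp
        linarith
      · have hadj := (R.adj_iff w a).2 (.inl ha.symm)
        have hq := vdist_le (SimpleGraph.Walk.cons hadj p)
        rw [SimpleGraph.Walk.edges_cons, List.map_cons, List.sum_cons, hs, ha, hbp,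
          R.len_eq w a ha.symm] at hq
        linarith
    · have := hlow w
      rw [hb] at this
      simp only [dist]
      linarith
  | lower u w h t h0 h1 hpw =>
    have l1 := hlow u
    have l2 := hlow w
    rw [hb] at l1
    rw [← hpw, hbp] at l2
    simp only [dist]
    refine le_antisymm ?_ (le_min (by linarith) (by linarith))
    rcases ha with ha | ha
    · obtain rfl : a = u := Fin.ext (R.pos_inj _ a.2 _ u.2 ha)
      rw [hb] at hp
      exact min_le_of_left_le (by linarith)
    · obtain rfl : a = w := Fin.ext (R.pos_inj _ a.2 _ w.2 (ha.trans hpw))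
      rw [ha, hbp] at hp
      exact min_le_of_right_le (by linarith)
  | upper u w h t h0 h1 hpw =>
    have l1 := hlow u
    have l2 := hlow w
    rw [hb] at l2
    rw [← hpw, hbp] at l1
    simp only [dist]
    refine le_antisymm ?_ (le_min (by linarith) (by linarith))
    rcases ha with ha | ha
    · obtain rfl : a = w := Fin.ext (R.pos_inj _ a.2 _ w.2 ha)
      rw [hb] at hp
      exact min_le_of_right_le (by linarith)
    · obtain rfl : a = u := Fin.ext (R.pos_inj _ a.2 _ u.2 (ha.trans hpw))
      rw [ha, hbp] at hp
      exact min_le_of_left_le (by linarith)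

theorem Rooted.covered_iff (R : T.Rooted lam pos par len r) {x : T.Point}
    (hx : Located pos par len T x j dn up) (S : Spread n par len r j dn up D G) (v : Fin n) :
    T.weight v * T.dist x v ≤ lam ↔ D (pos v) ≤ r (pos v) := by
  rw [R.dist_eq hx S, R.r_eq, le_div_iff₀ (T.weight_pos v), mul_comm]

/-- Each edge is governed by one kind of equivalence in `Spread`: the edge of the point by the two
base ones, any other edge by the upward or the downward one. Hence the reached set can be left only
towards a vertex that is not covered. -/
theorem Rooted.closed (R : T.Rooted lam pos par len r) (S : Spread n par len r j dn up D G)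
    {u v : Fin n} (h : T.graph.Adj u v) (hu : G (pos u)) (hv : D (pos v) ≤ r (pos v)) :
    G (pos v) := by
  rcases (R.adj_iff u v).1 h with hp | hp
  · have hun := R.pos_lt u u.2
    by_cases ha : Anc n par j (pos u)
    · by_cases hj : pos u = j
      · have h1 := S.base_par_iff
        have h2 := S.base_par_dist
        rw [← hj, hp] at h1 h2
        exact h1.2 (h2 ▸ hv)
      · have h1 := S.up_iff _ hun ha hj
        rw [hp] at h1
        exact h1.2 ⟨hu, hv⟩
    · have h1 := S.down_iff _ hun ha
      rw [hp] at h1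
      exact (h1.1 hu).1
  · have hvn := R.pos_lt v v.2
    by_cases ha : Anc n par j (pos v)
    · by_cases hj : pos v = j
      · have h1 := S.base_iff
        have h2 := S.base_dist
        rw [← hj] at h1 h2
        exact h1.2 (h2 ▸ hv)
      · have h1 := S.up_iff _ hvn ha hj
        rw [hp] at h1
        exact (h1.1 hu).1
    · have h1 := S.down_iff _ hvn ha
      rw [hp] at h1
      exact h1.2 ⟨hu, hv⟩

open Classical in
/-- The reached vertices. -/
noncomputable def reachedSet (n : ℕ) (pos : ℕ → ℕ) (G : ℕ → Prop) : Finset (Fin n) :=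
  Finset.univ.filter fun v => G (pos v)

theorem Rooted.end_of_touch {x : T.Point}
    (hx : Located pos par len T x j dn up) {a : Fin n} (ha : a ∈ T.touch x) :
    pos a = j ∨ pos a = par j := by
  cases hx with
  | vertex v => exact .inl (by rw [Set.mem_singleton_iff.1 ha])
  | lower u v h t h0 h1 hp =>
    rcases ha with ⟨rfl, -⟩ | ⟨rfl, -⟩
    · exact .inl rfl
    · exact .inr hp.symm
  | upper u v h t h0 h1 hp =>
    rcases ha with ⟨rfl, -⟩ | ⟨rfl, -⟩
    · exact .inr hp.symm
    · exact .inl rfl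

theorem Rooted.end_reached (S : Spread n par len r j dn up D G)
    {a : ℕ} (ha : a = j ∨ a = par j) (hc : D a ≤ r a) : G a := by
  rcases ha with rfl | rfl
  · exact S.base_iff.2 (S.base_dist ▸ hc)
  · exact S.base_par_iff.2 (S.base_par_dist ▸ hc)

/-- A walk inside the subtree that starts at a touching vertex meets only covered vertices, and
`closed` carries reachedness along it. -/
theorem Rooted.subset_reachedSet (R : T.Rooted lam pos par len r) {x : T.Point}
    (hx : Located pos par len T x j dn up) (S : Spread n par len r j dn up D G)
    {A : Finset (Fin n)} (hA : T.IsCoveredSelfInclusive lam x A) : A ⊆ reachedSet n pos G := by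
  intro z hz
  obtain ⟨a, haA, ha⟩ := hA.self_inclusive ⟨z, hz⟩
  have hcov : ∀ v ∈ A, D (pos v) ≤ r (pos v) :=
    fun v hv => (R.covered_iff hx S v).1 (hA.covered v hv)
  have hGa : G (pos a) := Rooted.end_reached S (Rooted.end_of_touch hx ha) (hcov a haA)
  obtain ⟨p⟩ := hA.connected ⟨a, haA⟩ ⟨z, hz⟩
  have : ∀ (u v : (A : Set (Fin n))), (T.graph.induce (A : Set (Fin n))).Walk u v →
      G (pos u.1) → G (pos v.1) := by
    intro u v p
    induction p with
    | nil => exact id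
    | @cons u v w h p ih =>
      intro hu
      exact ih (R.closed S (by simpa using h) hu (hcov v.1 v.2))
  simpa [reachedSet] using this _ _ p hGa

/-- In the interior of an edge both ends touch the point, so the given end will do. If the point is
a vertex, possibly written as the end of an edge, only this vertex touches it; it has distance `0`
and is covered because `lam` is not negative. -/
theorem Rooted.exists_touch (R : T.Rooted lam pos par len r) {x : T.Point}
    (hx : Located pos par len T x j dn up) (S : Spread n par len r j dn up D G) (hlam : 0 ≤ lam)
    {a : Fin n} (ha : pos a = j ∨ pos a = par j) (hGa : G (pos a)) :
    ∃ b ∈ T.touch x, G (pos b) := by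
  have hr : ∀ v : Fin n, 0 ≤ r (pos v) := fun v => by
    rw [R.r_eq]
    exact div_nonneg hlam (T.weight_pos v).le
  have hb := S.base_iff
  have hbp := S.base_par_iff
  cases hx with
  | vertex w => exact ⟨w, rfl, hb.2 (hr w)⟩
  | lower u w h t h0 h1 hp =>
    have hl := T.len_pos s(u, w) h
    rcases ha with ha | ha
    · rcases h1.lt_or_eq with h1 | h1
      · exact ⟨u, .inl ⟨rfl, h1⟩, ha ▸ hGa⟩
      · refine ⟨w, .inr ⟨rfl, h1 ▸ hl⟩, ?_⟩
        rw [← hp, hbp, hp, h1, sub_self]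
        exact hr w
    · rcases h0.lt_or_eq with h0 | h0
      · exact ⟨w, .inr ⟨rfl, h0⟩, hp ▸ ha ▸ hGa⟩
      · exact ⟨u, .inl ⟨rfl, h0 ▸ hl⟩, hb.2 (h0 ▸ hr u)⟩
  | upper u w h t h0 h1 hp =>
    have hl := T.len_pos s(u, w) h
    rcases ha with ha | ha
    · rcases h0.lt_or_eq with h0 | h0
      · exact ⟨w, .inr ⟨rfl, h0⟩, ha ▸ hGa⟩
      · refine ⟨u, .inl ⟨rfl, h0 ▸ hl⟩, ?_⟩
        rw [← hp, hbp, hp, ← h0]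
        exact hr u
    · rcases h1.lt_or_eq with h1 | h1
      · exact ⟨u, .inl ⟨rfl, h1⟩, hp ▸ ha ▸ hGa⟩
      · refine ⟨w, .inr ⟨rfl, h1 ▸ hl⟩, hb.2 ?_⟩
        rw [h1, sub_self]
        exact hr w

/-- Every reached vertex is joined within the set to an end of the edge of the point. If two such
walks start at different ends, then both ends are reached and adjacent, so the set is connected. -/
theorem Rooted.reachedSet_covered (R : T.Rooted lam pos par len r) {x : T.Point}
    (hx : Located pos par len T x j dn up) (S : Spread n par len r j dn up D G) (hlam : 0 ≤ lam) :
    T.IsCoveredSelfInclusive lam x (reachedSet n pos G) := by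
  have hj := hx.lt R
  have hmem : ∀ v, v ∈ reachedSet n pos G ↔ G (pos v) := by simp [reachedSet]
  refine ⟨?_, ?_, ?_⟩
  · have hwalk : ∀ {u v : Fin n} (p : T.graph.Walk u v) (h : ∀ w ∈ p.support, G (pos w)),
        (T.graph.induce (reachedSet n pos G : Set (Fin n))).Reachable
          ⟨u, (hmem u).2 (h u p.start_mem_support)⟩ ⟨v, (hmem v).2 (h v p.end_mem_support)⟩ := by
      intro u v p h
      induction p with
      | nil => exact .refl _
      | cons hadj p ih =>
        have h' := ih fun w hw => h w (by simp [hw])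
        refine SimpleGraph.Reachable.trans (SimpleGraph.Adj.reachable ?_) h'
        simpa using hadj
    have hends : ∀ a b : Fin n, (pos a = j ∨ pos a = par j) → (pos b = j ∨ pos b = par j) →
        a = b ∨ T.graph.Adj a b := by
      intro a b ha hb
      rcases ha with ha | ha <;> rcases hb with hb | hb
      · exact .inl (Fin.ext (R.pos_inj _ a.2 _ b.2 (ha.trans hb.symm)))
      · exact .inr ((R.adj_iff a b).2 (.inl (by rw [ha, hb])))
      · exact .inr ((R.adj_iff a b).2 (.inr (by rw [ha, hb])))
      · exact .inl (Fin.ext (R.pos_inj _ a.2 _ b.2 (ha.trans hb.symm)))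
    rintro ⟨u, hu⟩ ⟨v, hv⟩
    have hu' := (hmem u).1 hu
    have hv' := (hmem v).1 hv
    obtain ⟨a, p, ha, -, hp⟩ := R.exists_walk hj S u
    obtain ⟨b, q, hb, -, hq⟩ := R.exists_walk hj S v
    have h1 := (hwalk p (hp hu')).symm
    have h2 := hwalk q (hq hv')
    refine h1.trans (SimpleGraph.Reachable.trans ?_ h2)
    rcases hends a b ha hb with rfl | hab
    · exact .refl _
    · refine SimpleGraph.Adj.reachable ?_
      simpa using hab
  · rintro ⟨z, hz⟩
    obtain ⟨a, p, ha, -, hp⟩ := R.exists_walk hj S z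
    obtain ⟨b, hb, hGb⟩ := R.exists_touch hx S hlam ha (hp ((hmem z).1 hz) a p.start_mem_support)
    exact ⟨b, (hmem b).2 hGb, hb⟩
  · intro v hv
    exact (R.covered_iff hx S v).2 (S.covered _ ((hmem v).1 hv))

open Classical in
-- The reached set is itself admissible and contains every admissible set, so the maximum is
-- attained there and only there. The numbering turns its size into a count of numbers.
theorem Rooted.largestSize_eq (R : T.Rooted lam pos par len r) {x : T.Point}
    (hx : Located pos par len T x j dn up) (S : Spread n par len r j dn up D G) (hlam : 0 ≤ lam) :
    T.largestSize lam x = ((Finset.range n).filter G).card := by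
  have h1 : T.largestSize lam x = (reachedSet n pos G).card := by
    refine IsGreatest.csSup_eq ⟨⟨_, R.reachedSet_covered hx S hlam, rfl⟩, ?_⟩
    rintro m ⟨A, hA, rfl⟩
    exact Finset.card_le_card (R.subset_reachedSet hx S hA)
  rw [h1]
  refine Finset.card_bij (fun v _ => pos v) ?_ ?_ ?_
  · intro v hv
    simp only [reachedSet, Finset.mem_filter, Finset.mem_univ, true_and] at hv
    simp [hv, R.pos_lt v v.2]
  · intro u _ v _ h
    exact Fin.ext (R.pos_inj _ u.2 _ v.2 h)
  · intro y hy
    rw [Finset.mem_filter, Finset.mem_range] at hy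
    obtain ⟨v, rfl⟩ := R.exists_pos hy.1
    exact ⟨v, by simp [reachedSet, hy.2], rfl⟩

end Dist

/-- Weighted distances are not negative, so only the empty subtree is covered. This case is separate
because `exists_touch` relies on nonnegative radii. -/
theorem largestSize_of_neg (T : WeightedTree n) {lam : ℝ} (hlam : lam < 0) (x : T.Point) :
    T.largestSize lam x = 0 := by
  have hv : ∀ u v, 0 ≤ T.vdist u v := by
    intro u v
    refine Real.iInf_nonneg fun p => List.sum_nonneg fun a ha => ?_
    obtain ⟨e, he, rfl⟩ := List.mem_map.1 ha
    exact (T.len_pos e (p.edges_subset_edgeSet he)).le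
  have hd : ∀ v, 0 ≤ T.dist x v := by
    intro v
    cases x with
    | vertex w => exact hv _ _
    | onEdge a b h t h0 h1 =>
      exact le_min (add_nonneg h0 (hv _ _)) (add_nonneg (by linarith) (hv _ _))
  have : {m | ∃ S : Finset (Fin n), T.IsCoveredSelfInclusive lam x S ∧ S.card = m} ⊆ {0} := by
    rintro m ⟨A, hA, rfl⟩
    rcases A.eq_empty_or_nonempty with rfl | ⟨v, hvA⟩
    · rfl
    · have := hA.covered v hvA
      have := mul_nonneg (T.weight_pos v).le (hd v)
      linarith
  unfold largestSize
  rcases Set.subset_singleton_iff_eq.1 this with h | h <;> simp [h]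

end WeightedTree

/-! ## Rooting the tree by peeling leaves -/

section Incidence

/-- The number of listed edges in `R` that are incident to `v`. -/
def incCount (a c : ℕ → ℕ) (R : Finset ℕ) (v : ℕ) : ℕ :=
  (R.filter fun e => a e = v ∨ c e = v).card

/-- The sum of the indices of the edges in `R` that are incident to `v`. -/
def incSum (a c : ℕ → ℕ) (R : Finset ℕ) (v : ℕ) : ℕ :=
  ∑ e ∈ R.filter fun e => a e = v ∨ c e = v, e

variable {a c : ℕ → ℕ} {R : Finset ℕ}

theorem incCount_insert {e : ℕ} (he : e ∉ R) (v : ℕ) :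
    incCount a c (insert e R) v = incCount a c R v + if a e = v ∨ c e = v then 1 else 0 := by
  unfold incCount
  rw [Finset.filter_insert]
  split_ifs
  · rw [Finset.card_insert_of_notMem (by simp [he])]
  · rfl

theorem incSum_insert {e : ℕ} (he : e ∉ R) (v : ℕ) :
    incSum a c (insert e R) v = incSum a c R v + if a e = v ∨ c e = v then e else 0 := by
  unfold incSum
  rw [Finset.filter_insert]
  split_ifs
  · rw [Finset.sum_insert (by simp [he]), add_comm]
  · rfl

theorem incCount_erase {e : ℕ} (he : e ∈ R) (v : ℕ) :
    incCount a c (R.erase e) v = incCount a c R v - if a e = v ∨ c e = v then 1 else 0 := by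
  have := incCount_insert (a := a) (c := c) (Finset.notMem_erase e R) v
  rw [Finset.insert_erase he] at this
  omega

theorem incSum_erase {e : ℕ} (he : e ∈ R) (v : ℕ) :
    incSum a c (R.erase e) v = incSum a c R v - if a e = v ∨ c e = v then e else 0 := by
  have := incSum_insert (a := a) (c := c) (Finset.notMem_erase e R) v
  rw [Finset.insert_erase he] at this
  omega

theorem incCount_le {m : ℕ} (hR : R ⊆ Finset.range m) (v : ℕ) : incCount a c R v ≤ m :=
  (Finset.card_filter_le _ _).trans ((Finset.card_le_card hR).trans (by simp))

theorem incSum_le {m : ℕ} (hR : R ⊆ Finset.range m) (v : ℕ) : incSum a c R v ≤ m * m := by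
  unfold incSum
  refine (Finset.sum_le_card_nsmul _ _ m fun e he => ?_).trans ?_
  · have := hR (Finset.mem_of_mem_filter e he)
    exact (Finset.mem_range.1 this).le
  · rw [smul_eq_mul]
    exact Nat.mul_le_mul_right _ (incCount_le hR v)

/-- This is the purpose of the index sums: at a vertex with a single remaining edge the sum is the
index of that edge, so no adjacency lists are needed. -/
theorem eq_of_incCount_eq_one {v : ℕ} (h : incCount a c R v = 1) :
    incSum a c R v ∈ R ∧ (a (incSum a c R v) = v ∨ c (incSum a c R v) = v) := by
  obtain ⟨e, he⟩ := Finset.card_eq_one.1 h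
  have h1 : incSum a c R v = e := by rw [incSum, he, Finset.sum_singleton]
  have h2 : e ∈ R.filter fun e => a e = v ∨ c e = v := he ▸ Finset.mem_singleton_self e
  rw [h1]
  simpa using h2

/-- Double counting: every edge has two distinct ends. -/
theorem sum_incCount {n : ℕ} (h : ∀ e ∈ R, a e < n ∧ c e < n ∧ a e ≠ c e) :
    ∑ v ∈ Finset.range n, incCount a c R v = 2 * R.card := by
  induction R using Finset.induction_on with
  | empty => simp [incCount]
  | insert e R he ih =>
    simp only [incCount_insert he, Finset.sum_add_distrib]
    rw [ih fun e he => h e (Finset.mem_insert_of_mem he), Finset.card_insert_of_notMem he]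
    have h' := h e (Finset.mem_insert_self e R)
    have : ∑ v ∈ Finset.range n, (if a e = v ∨ c e = v then 1 else 0) = 2 := by
      rw [← Finset.card_filter]
      have : (Finset.range n).filter (fun v => a e = v ∨ c e = v) = {a e, c e} := by
        ext v
        simp only [Finset.mem_filter, Finset.mem_range, Finset.mem_insert, Finset.mem_singleton]
        constructor
        · rintro ⟨-, rfl | rfl⟩ <;> simp
        · rintro (rfl | rfl) <;> simp [h']
      rw [this, Finset.card_pair h'.2.2]
    omega

end Incidence

namespace RealRAM

infixr:60 " ;; " => Prog.seq

/-- Integer arrays `2, 3`: number and index sum of the edges at each vertex. -/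
def countEdges : Prog :=
  .while (.ilt (.add (.reg 5) (.lit 1)) (.reg 0))
    (.setIMem 2 (.mem 0 (.reg 5)) (.add (.mem 2 (.mem 0 (.reg 5))) (.lit 1)) ;;
     .setIMem 3 (.mem 0 (.reg 5)) (.add (.mem 3 (.mem 0 (.reg 5))) (.reg 5)) ;;
     .setIMem 2 (.mem 1 (.reg 5)) (.add (.mem 2 (.mem 1 (.reg 5))) (.lit 1)) ;;
     .setIMem 3 (.mem 1 (.reg 5)) (.add (.mem 3 (.mem 1 (.reg 5))) (.reg 5)) ;;
     .setIReg 5 (.add (.reg 5) (.lit 1)))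

/-- The edge list of a tree in integer arrays `0, 1` and the size of the tree in register `0`. -/
structure HasEdges (n : ℕ) (a c : ℕ → ℕ) (s : State) : Prop where
  size : s.ireg 0 = n
  fst : s.imem 0 = a
  snd : s.imem 1 = c

/-- Sums of edge indices can be as large as `n * n` within this bound; they are one reason for
requiring words that hold quadratic values. -/
theorem countEdges_runs {n b : ℕ} {a c : ℕ → ℕ} (hb : 64 * (n + 1) ^ 2 < 2 ^ b)
    (hne : ∀ e < n - 1, a e ≠ c e) {s : State} (hs : HasEdges n a c s) (h5 : s.ireg 5 = 0)
    (h2 : s.imem 2 = fun _ => 0) (h3 : s.imem 3 = fun _ => 0) :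
    Runs b countEdges s fun t s' => t ≤ 6 * (n - 1) + 1 ∧
      s'.imem 2 = incCount a c (Finset.range (n - 1)) ∧
      s'.imem 3 = incSum a c (Finset.range (n - 1)) := by
  refine (Runs.for (fun i s => HasEdges n a c s ∧ s.ireg 5 = i ∧
      s.imem 2 = incCount a c (Finset.range i) ∧ s.imem 3 = incSum a c (Finset.range i))
    5 (n - 1) ?_ ?_ ⟨hs, h5, ?_, ?_⟩).mono ?_
  · rintro i s - ⟨hs, h5, -, -⟩
    simp only [BExp.holds, IExp.eval, hs.size, h5]
    omega
  · rintro i s hi ⟨⟨h0, ha, hc⟩, h5, h2, h3⟩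
    have hcnt : ∀ v, incCount a c (Finset.range i) v ≤ n :=
      fun v => (incCount_le subset_rfl v).trans (by omega)
    have hsum : ∀ v, incSum a c (Finset.range i) v ≤ n * n :=
      fun v => (incSum_le subset_rfl v).trans (Nat.mul_le_mul (by omega) (by omega))
    have hni := hne i hi
    have hbig : n * n + n + 1 < 2 ^ b := by nlinarith
    refine (Runs.of_wp ?_).mono fun t s' h => ⟨h.1, h.2⟩
    have e1 := hcnt (a i)
    have e2 := hsum (a i)
    have e3 := hcnt (c i)
    have e4 := hsum (c i)
    simp only [wp, IExp.eval, h5, h2, h3, ha, hc, State.writeIMem_imem, State.writeIMem_ireg,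
      State.writeIReg_imem, State.writeIReg_ireg, if_true, Nat.reduceEqDiff, if_false, Function.update_apply, hni.symm]
    refine ⟨by omega, by omega, by omega, by omega, by omega, ⟨by simp [h0], by simp [ha], by simp [hc]⟩, trivial, ?_, ?_⟩
    · funext v
      rw [Finset.range_add_one, incCount_insert (by simp)]
      simp only [Function.update_apply]
      by_cases h1 : v = a i
      · subst h1
        simp [hni]
      · by_cases h2 : v = c i
        · subst h2
          simp
        · simp [h1, h2, Ne.symm h1, Ne.symm h2]
    · funext v
      rw [Finset.range_add_one, incSum_insert (by simp)]
      simp only [Function.update_apply]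
      by_cases h1 : v = a i
      · subst h1
        simp [hni]
      · by_cases h2 : v = c i
        · subst h2
          simp
        · simp [h1, h2, Ne.symm h1, Ne.symm h2]
  · rw [h2]
    rfl
  · rw [h3]
    rfl
  · rintro t s' ⟨ht, -, -, h2, h3⟩
    exact ⟨ht, h2, h3⟩

end RealRAM

/-- After `m` rounds of peeling, `o i` is the `i`-th peeled vertex, `p i` its neighbour at that
time, `eo i` the edge between them, and `R` is the set of the remaining edges. -/
structure Peeling (n : ℕ) (a c : ℕ → ℕ) (m : ℕ) (R : Finset ℕ) (o eo p : ℕ → ℕ) : Prop where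
  subset : R ⊆ Finset.range (n - 1)
  card : R.card + m = n - 1
  o_lt : ∀ i < m, o i < n
  p_lt : ∀ i < m, p i < n
  eo_lt : ∀ i < m, eo i < n - 1
  o_inj : ∀ i < m, ∀ i' < m, o i = o i' → i = i'
  edge : ∀ i < m, a (eo i) = o i ∧ c (eo i) = p i ∨ a (eo i) = p i ∧ c (eo i) = o i
  cover : ∀ e < n - 1, e ∈ R ∨ ∃ i < m, eo i = e
  isolated : ∀ i < m, ∀ e ∈ R, a e ≠ o i ∧ c e ≠ o i
  order : ∀ i < m, ∀ i' < m, p i = o i' → i < i'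

/-! ### Combinatorics of leaf peeling -/

namespace Peeling

variable {n m : ℕ} {a c o eo p : ℕ → ℕ} {R : Finset ℕ}

theorem init : Peeling n a c 0 (Finset.range (n - 1)) o eo p where
  subset := subset_rfl
  card := by simp
  o_lt := by simp
  p_lt := by simp
  eo_lt := by simp
  o_inj := by simp
  edge := by simp
  cover e he := .inl (by simpa using he)
  isolated := by simp
  order := by simp

/-- Once its only edge is deleted, `v` is incident to no remaining edge, and this persists. The
neighbour `u` was incident to a remaining edge until now, so it has not been peeled before; hence
parents are peeled later than their children. -/
theorem step (h : Peeling n a c m R o eo p)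
    (hac : ∀ e < n - 1, a e < n ∧ c e < n ∧ a e ≠ c e) {v e u : ℕ}
    (hv : incCount a c R v = 1) (he : e = incSum a c R v) (hu : u = a e + c e - v) :
    Peeling n a c (m + 1) (R.erase e) (Function.update o m v) (Function.update eo m e)
      (Function.update p m u) ∧ e ∈ R ∧ m < n - 1 ∧ u < n ∧ u ≠ v ∧
      (a e = v ∧ c e = u ∨ a e = u ∧ c e = v) ∧
      ∀ i < m + 1, Function.update o m v i ≠ u := by
  obtain ⟨heR, hev⟩ := eq_of_incCount_eq_one hv
  rw [← he] at heR hev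
  have hen : e < n - 1 := Finset.mem_range.1 (h.subset heR)
  obtain ⟨ha, hc, hne⟩ := hac e hen
  -- The truncated subtraction in `u = a e + c e - v` is exact, as `v` is one of the two ends.
  have hends : a e = v ∧ c e = u ∨ a e = u ∧ c e = v := by
    rcases hev with hev | hev
    · left; omega
    · right; omega
  have hcard := Finset.card_erase_of_mem heR
  have hpos := Finset.card_pos.2 ⟨e, heR⟩
  have hcd := h.card
  have huniq : ∀ e' ∈ R, a e' = v ∨ c e' = v → e' = e := by
    intro e' he' hinc
    obtain ⟨e'', h''⟩ := Finset.card_eq_one.1 hv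
    have h1 : e' ∈ R.filter fun e => a e = v ∨ c e = v := by simp [he', hinc]
    have h2 : e ∈ R.filter fun e => a e = v ∨ c e = v := by simp [heR, hev]
    rw [h'', Finset.mem_singleton] at h1 h2
    omega
  have hov : ∀ i < m, o i ≠ v ∧ o i ≠ u := by
    intro i hi
    have := h.isolated i hi e heR
    omega
  have heo : ∀ i < m, o i ≠ v := fun i hi => (hov i hi).1
  have hlt : ∀ i, i < m + 1 → i = m ∨ i < m ∧ i ≠ m := by omega
  refine ⟨⟨(Finset.erase_subset _ _).trans h.subset, by omega, ?_, ?_, ?_, ?_, ?_, ?_, ?_, ?_⟩,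
    heR, by omega, by omega, by omega, hends, ?_⟩
  · intro i hi
    rcases hlt i hi with rfl | ⟨hi, hi'⟩
    · simp only [Function.update_self]; omega
    · rw [Function.update_of_ne hi']; exact h.o_lt i hi
  · intro i hi
    rcases hlt i hi with rfl | ⟨hi, hi'⟩
    · simp only [Function.update_self]; omega
    · rw [Function.update_of_ne hi']; exact h.p_lt i hi
  · intro i hi
    rcases hlt i hi with rfl | ⟨hi, hi'⟩
    · simp only [Function.update_self]; omega
    · rw [Function.update_of_ne hi']; exact h.eo_lt i hi
  · intro i hi i' hi' heq
    rcases hlt i hi with rfl | ⟨hi, hi2⟩ <;> rcases hlt i' hi' with rfl | ⟨hi', hi2'⟩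
    · rfl
    · rw [Function.update_self, Function.update_of_ne hi2'] at heq
      exact absurd heq.symm (heo i' hi')
    · rw [Function.update_self, Function.update_of_ne hi2] at heq
      exact absurd heq (heo i hi)
    · rw [Function.update_of_ne hi2', Function.update_of_ne hi2] at heq
      exact h.o_inj i hi i' hi' heq
  · intro i hi
    rcases hlt i hi with rfl | ⟨hi, hi'⟩
    · simpa only [Function.update_self] using hends
    · simpa only [Function.update_of_ne hi'] using h.edge i hi
  · intro e' he'
    by_cases hee : e' = e
    · exact .inr ⟨m, by omega, by simp [hee]⟩
    · rcases h.cover e' he' with h' | ⟨i, hi, rfl⟩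
      · exact .inl (Finset.mem_erase.2 ⟨hee, h'⟩)
      · exact .inr ⟨i, by omega, by rw [Function.update_of_ne (by omega)]⟩
  · intro i hi e' he'
    obtain ⟨hne', he'⟩ := Finset.mem_erase.1 he'
    rcases hlt i hi with rfl | ⟨hi, hi'⟩
    · rw [Function.update_self]
      constructor
      · exact fun h' => hne' (huniq e' he' (.inl h'))
      · exact fun h' => hne' (huniq e' he' (.inr h'))
    · rw [Function.update_of_ne hi']
      exact h.isolated i hi e' he'
  · intro i hi i' hi' heq
    rcases hlt i hi with rfl | ⟨hi, hi2⟩ <;> rcases hlt i' hi' with rfl | ⟨hi', hi2'⟩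
    · simp only [Function.update_self] at heq
      omega
    · rw [Function.update_self, Function.update_of_ne hi2'] at heq
      have := hov i' hi'
      omega
    · omega
    · rw [Function.update_of_ne hi2', Function.update_of_ne hi2] at heq
      exact h.order i hi i' hi' heq
  · intro i hi
    rcases hlt i hi with rfl | ⟨hi, hi'⟩
    · rw [Function.update_self]; omega
    · rw [Function.update_of_ne hi']; exact (hov i hi).2

/-- The vertices that lead to `z` along peeled edges. -/
inductive Below (o p : ℕ → ℕ) (m z : ℕ) : ℕ → Prop where
  | refl : Below o p m z z
  | step {i : ℕ} (hi : i < m) (h : Below o p m z (p i)) : Below o p m z (o i)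

/-- Acyclicity is not used, only that there are `n - 1` edges and that they connect everything.
There is one remaining edge less than there are unpeeled vertices, so without a vertex of degree one
some unpeeled vertex is isolated. By connectedness all vertices lead to it along peeled edges, and
so it is the only unpeeled one. -/
theorem complete (h : Peeling n a c m R o eo p) (hn : 1 ≤ n)
    (hac : ∀ e < n - 1, a e < n ∧ c e < n ∧ a e ≠ c e)
    (hconn : ∀ Z : ℕ → Prop, (∃ z < n, Z z) → (∀ e < n - 1, Z (a e) ↔ Z (c e)) → ∀ v < n, Z v)
    (hdeg : ∀ v < n, incCount a c R v ≠ 1) {u : ℕ} (hu : u < n) (hou : ∀ i < m, o i ≠ u) :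
    m = n - 1 ∧ ∀ v < n, v = u ∨ ∃ i < m, o i = v := by
  classical
  set Q := (Finset.range n).filter fun v => ∀ i < m, o i ≠ v with hQ
  have hQcard : Q.card + m = n := by
    have h1 : (Finset.range n).filter (fun v => ¬ ∀ i < m, o i ≠ v) =
        (Finset.range m).image o := by
      ext v
      simp only [Finset.mem_filter, Finset.mem_range, Finset.mem_image]
      push Not
      exact ⟨fun h' => h'.2, fun ⟨i, hi, hv⟩ => ⟨hv ▸ h.o_lt i hi, i, hi, hv⟩⟩
    have h2 : ((Finset.range m).image o).card = m := by
      rw [Finset.card_image_of_injOn, Finset.card_range]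
      intro i hi i' hi' heq
      exact h.o_inj i (by simpa using hi) i' (by simpa using hi') heq
    have h3 := Finset.card_filter_add_card_filter_not (s := Finset.range n)
      (fun v => ∀ i < m, o i ≠ v)
    rw [h1, h2, Finset.card_range] at h3
    exact h3
  have hcd := h.card
  -- Degree at least `2` on all of `Q` would need at least `Q.card` remaining edges, but there are
  -- only `Q.card - 1`.
  have hisol : ∃ z ∈ Q, incCount a c R z = 0 := by
    by_contra hcon
    push Not at hcon
    have h1 := sum_incCount (R := R) (n := n) fun e he =>
      hac e (Finset.mem_range.1 (h.subset he))
    have h2 : ∑ v ∈ Q, 2 ≤ ∑ v ∈ Q, incCount a c R v := by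
      refine Finset.sum_le_sum fun v hv => ?_
      have h3 := hcon v hv
      have h4 := hdeg v (by simpa using (Finset.mem_filter.1 hv).1)
      omega
    have h3 : ∑ v ∈ Q, incCount a c R v ≤ ∑ v ∈ Finset.range n, incCount a c R v :=
      Finset.sum_le_sum_of_subset (Finset.filter_subset _ _)
    simp only [Finset.sum_const, smul_eq_mul] at h2
    omega
  obtain ⟨z, hzQ, hz⟩ := hisol
  obtain ⟨hzn, hzo⟩ := Finset.mem_filter.1 hzQ
  have hz' : ∀ e ∈ R, a e ≠ z ∧ c e ≠ z := by
    intro e he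
    rw [incCount, Finset.card_eq_zero, Finset.filter_eq_empty_iff] at hz
    have := hz he
    push Not at this
    exact this
  have hout : ∀ v, (∀ i < m, o i ≠ v) → Below o p m z v → v = z := by
    intro v hv hb
    cases hb with
    | refl => rfl
    | step hi _ => exact (hv _ hi rfl).elim
  have hpar : ∀ i < m, (Below o p m z (o i) ↔ Below o p m z (p i)) := by
    intro i hi
    refine ⟨fun hb => ?_, .step hi⟩
    generalize hy : o i = y at hb
    cases hb with
    | refl => exact (hzo i hi hy).elim
    | step hi' hb => exact h.o_inj _ hi _ hi' hy ▸ hb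
  -- The two ends of a peeled edge lead to `z` or not together. The ends of a remaining edge are
  -- unpeeled and different from `z`, so neither of them leads to `z`.
  have hall := hconn (Below o p m z) ⟨z, by simpa using hzn, .refl⟩ (by
    intro e he
    rcases h.cover e he with hR | ⟨i, hi, rfl⟩
    · have h1 : ¬ Below o p m z (a e) := fun hb =>
        (hz' e hR).1 (hout _ (fun i hi heq => (h.isolated i hi e hR).1 heq.symm) hb)
      have h2 : ¬ Below o p m z (c e) := fun hb =>
        (hz' e hR).2 (hout _ (fun i hi heq => (h.isolated i hi e hR).2 heq.symm) hb)
      exact iff_of_false h1 h2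
    · rcases h.edge i hi with ⟨h1, h2⟩ | ⟨h1, h2⟩
      · rw [h1, h2]; exact hpar i hi
      · rw [h1, h2]; exact (hpar i hi).symm)
  have huz := hout u hou (hall u hu)
  have hQ1 : Q.card ≤ 1 := by
    rw [Finset.card_le_one]
    intro x hx y hy
    obtain ⟨hxn, hxo⟩ := Finset.mem_filter.1 hx
    obtain ⟨hyn, hyo⟩ := Finset.mem_filter.1 hy
    rw [hout x hxo (hall x (by simpa using hxn)), hout y hyo (hall y (by simpa using hyn))]
  refine ⟨by omega, fun v hv => ?_⟩
  by_contra hcon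
  push Not at hcon
  exact hcon.1 ((hout v hcon.2 (hall v hv)).trans huz.symm)

end Peeling

/-! ### The program for peeling leaves -/

namespace RealRAM

/-- Peel the leaf in register `6`. -/
def peelStep : Prog :=
  .setIReg 8 (.mem 3 (.reg 6)) ;;
  .setIReg 9 (.sub (.add (.mem 0 (.reg 8)) (.mem 1 (.reg 8))) (.reg 6)) ;;
  .setIMem 4 (.reg 6) (.reg 7) ;;
  .setIMem 5 (.reg 7) (.reg 9) ;;
  .setRMem 2 (.reg 7) (.mem 0 (.reg 8)) ;;
  .setRMem 3 (.reg 7) (.div (.reg 0) (.mem 1 (.reg 6))) ;;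
  .setIMem 2 (.reg 6) (.sub (.mem 2 (.reg 6)) (.lit 1)) ;;
  .setIMem 2 (.reg 9) (.sub (.mem 2 (.reg 9)) (.lit 1)) ;;
  .setIMem 3 (.reg 6) (.sub (.mem 3 (.reg 6)) (.reg 8)) ;;
  .setIMem 3 (.reg 9) (.sub (.mem 3 (.reg 9)) (.reg 8)) ;;
  .setIReg 7 (.add (.reg 7) (.lit 1)) ;;
  .setIReg 6 (.reg 9)

/-- Peel leaves until none is left; the last remaining vertex is in register `9`. -/
def peelLoop : Prog :=
  .while (.ilt (.reg 5) (.reg 0))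
    (.setIReg 6 (.reg 5) ;; .while (.ieq (.mem 2 (.reg 6)) (.lit 1)) peelStep ;;
      .setIReg 5 (.add (.reg 5) (.lit 1)))

/-- The state while leaves are peeled. -/
structure Peeled (n : ℕ) (a c : ℕ → ℕ) (l w : ℕ → ℝ) (lam : ℝ) (m : ℕ) (R : Finset ℕ)
    (o eo : ℕ → ℕ) (s : State) : Prop where
  edges : HasEdges n a c s
  len : s.rmem 0 = l
  weight : s.rmem 1 = w
  lam_eq : s.rreg 0 = lam
  count : s.ireg 7 = m
  root_lt : s.ireg 9 < n
  root_ne : ∀ i < m, o i ≠ s.ireg 9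
  deg : s.imem 2 = incCount a c R
  sum : s.imem 3 = incSum a c R
  peeling : Peeling n a c m R o eo (s.imem 5)
  pos : ∀ i < m, s.imem 4 (o i) = i
  plen : ∀ i < m, s.rmem 2 i = l (eo i)
  rad : ∀ i < m, s.rmem 3 i = lam / w (o i)

section

variable {n b : ℕ} {a c : ℕ → ℕ} {l w : ℕ → ℝ} {lam : ℝ}

/-- By the last clause a new leaf can appear only at the neighbour, which is the vertex that
register `6` holds afterwards. Thus the outer scan never has to go back. -/
theorem peelStep_runs (hb : 64 * (n + 1) ^ 2 < 2 ^ b)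
    (hac : ∀ e < n - 1, a e < n ∧ c e < n ∧ a e ≠ c e) {m : ℕ} {R : Finset ℕ} {o eo : ℕ → ℕ}
    {s : State} (hs : Peeled n a c l w lam m R o eo s) (hv : s.ireg 6 < n)
    (h1 : s.imem 2 (s.ireg 6) = 1) :
    Runs b peelStep s fun t s' => t ≤ 12 ∧ m < n - 1 ∧ s'.ireg 6 < n ∧ s'.ireg 5 = s.ireg 5 ∧
      (∃ R' o' eo', Peeled n a c l w lam (m + 1) R' o' eo' s') ∧
      (∀ v, v ≠ s'.ireg 6 → s.imem 2 v ≠ 1 ∨ v = s.ireg 6 → s'.imem 2 v ≠ 1) := by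
  obtain ⟨⟨h0, ha, hc⟩, hl, hw, hlam, h7, h9, h9', h2, h3, hP, hpos, hplen, hrad⟩ := hs
  generalize hvv : s.ireg 6 = v at *
  generalize hp5 : s.imem 5 = p at *
  have hcnt : incCount a c R v = 1 := h2 ▸ h1
  obtain ⟨e, he⟩ : ∃ e, e = incSum a c R v := ⟨_, rfl⟩
  obtain ⟨u, hu⟩ : ∃ u, u = a e + c e - v := ⟨_, rfl⟩
  obtain ⟨hP', heR, hmn, hun, huv, hends, hou⟩ := hP.step hac hcnt he hu
  have hcu : ∀ x, incCount a c R x ≤ n := fun x => (incCount_le hP.subset x).trans (by omega)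
  have hsu : ∀ x, incSum a c R x ≤ n * n :=
    fun x => (incSum_le hP.subset x).trans (Nat.mul_le_mul (by omega) (by omega))
  have hbig : n * n + n + 1 < 2 ^ b := by nlinarith
  have hen : e < n - 1 := Finset.mem_range.1 (hP.subset heR)
  have h3v := hsu v
  have h3u := hsu u
  have h2u := hcu u
  have hdeg' : incCount a c (R.erase e) = Function.update (Function.update (incCount a c R) v
      (incCount a c R v - 1)) u (incCount a c R u - 1) := by
    funext x
    rw [incCount_erase heR]
    simp only [Function.update_apply]
    by_cases hxu : x = u
    · subst hxu
      rw [if_pos (by omega), if_pos rfl]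
    · by_cases hxv : x = v
      · subst hxv
        rw [if_pos (by omega), if_neg hxu, if_pos rfl]
      · rw [if_neg (by omega), if_neg hxu, if_neg hxv, Nat.sub_zero]
  have hsum' : incSum a c (R.erase e) = Function.update (Function.update (incSum a c R) v
      (incSum a c R v - e)) u (incSum a c R u - e) := by
    funext x
    rw [incSum_erase heR]
    simp only [Function.update_apply]
    by_cases hxu : x = u
    · subst hxu
      rw [if_pos (by omega), if_pos rfl]
    · by_cases hxv : x = v
      · subst hxv
        rw [if_pos (by omega), if_neg hxu, if_pos rfl]
      · rw [if_neg (by omega), if_neg hxu, if_neg hxv, Nat.sub_zero]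
  have hnotv : ∀ i < m, o i ≠ v := by
    intro i hi
    have := hP.isolated i hi e heR
    omega
  refine (Runs.of_wp (Q := fun s' => s'.ireg 6 = u ∧ s'.ireg 5 = s.ireg 5 ∧ s'.ireg 0 = n ∧
    s'.ireg 7 = m + 1 ∧ s'.ireg 9 = u ∧ s'.rreg 0 = lam ∧
    s'.imem 0 = a ∧ s'.imem 1 = c ∧ s'.rmem 0 = l ∧ s'.rmem 1 = w ∧
    s'.imem 2 = incCount a c (R.erase e) ∧ s'.imem 3 = incSum a c (R.erase e) ∧
    s'.imem 4 = Function.update (s.imem 4) v m ∧ s'.imem 5 = Function.update p m u ∧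
    s'.rmem 2 = Function.update (s.rmem 2) m (l e) ∧
    s'.rmem 3 = Function.update (s.rmem 3) m (lam / w v)) ?_).mono ?_
  · simp only [peelStep, wp, IExp.eval, RExp.eval, State.writeIReg_ireg, State.writeIReg_imem,
      State.writeIReg_rreg, State.writeIReg_rmem, State.writeIMem_imem, State.writeIMem_ireg,
      State.writeIMem_rreg, State.writeIMem_rmem, State.writeRMem_rmem, State.writeRMem_imem,
      State.writeRMem_ireg, State.writeRMem_rreg, if_true, if_false, Nat.reduceEqDiff,
      hvv, h3, h2, ha, hc, h7, h0, hl, hw, hlam, hp5, ← he, ← hu, Function.update_self,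
      Function.update_of_ne huv, hdeg', hsum', OfNat.ofNat_ne_zero, OfNat.ofNat_ne_one,
      OfNat.zero_ne_ofNat, OfNat.one_ne_ofNat, true_and, and_true, and_self]
    refine ⟨by omega, by omega, by omega, by omega, by omega, by omega, by omega, by omega,
      by omega, by omega⟩
  · rintro t s' ⟨ht, g6, g5, g0, g7, g9, gl, ga, gc, gr0, gr1, g2, g3, g4, g5', gr2, gr3⟩
    refine ⟨ht, hmn, by omega, g5, ⟨_, _, _, ⟨g0, ga, gc⟩, gr0, gr1, gl, g7, by omega, ?_, g2, g3,
      g5' ▸ hP', ?_, ?_, ?_⟩, ?_⟩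
    · rw [g9]; exact hou
    · intro i hi
      rw [g4]
      by_cases him : i = m
      · subst him; simp
      · rw [Function.update_of_ne him, Function.update_of_ne (hnotv i (by omega)),
          hpos i (by omega)]
    · intro i hi
      rw [gr2]
      by_cases him : i = m
      · subst him; simp
      · rw [Function.update_of_ne him, Function.update_of_ne him, hplen i (by omega)]
    · intro i hi
      rw [gr3]
      by_cases him : i = m
      · subst him; simp
      · rw [Function.update_of_ne him, Function.update_of_ne him, hrad i (by omega)]
    · intro x hx hor
      rw [g6] at hx
      rw [g2, hdeg', Function.update_of_ne hx]
      by_cases hxv : x = v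
      · subst hxv
        rw [Function.update_self]
        omega
      · rw [Function.update_of_ne hxv, ← h2]
        exact hor.resolve_right hxv

/-- The inner loop follows a chain of new leaves at once, wherever it leads, so behind the scanning
position no leaf remains. The potential is `4` for each vertex still to be scanned and `13` for each
remaining edge. -/
theorem peelLoop_runs (hb : 64 * (n + 1) ^ 2 < 2 ^ b)
    (hac : ∀ e < n - 1, a e < n ∧ c e < n ∧ a e ≠ c e) {o eo : ℕ → ℕ}
    {s : State} (hs : Peeled n a c l w lam 0 (Finset.range (n - 1)) o eo s) (h5 : s.ireg 5 = 0) :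
    Runs b peelLoop s fun t s' => t ≤ 17 * n + 1 ∧
      (∃ m R o eo, Peeled n a c l w lam m R o eo s') ∧ ∀ v < n, s'.imem 2 v ≠ 1 := by
  refine (Runs.while (fun f s => ∃ i m R o eo, s.ireg 5 = i ∧ i ≤ n ∧
    Peeled n a c l w lam m R o eo s ∧ (∀ v < i, s.imem 2 v ≠ 1) ∧
    f = 4 * (n - i) + 13 * (n - 1 - m)) ?_ (f := 4 * n + 13 * (n - 1))
    ⟨0, 0, _, o, eo, h5, Nat.zero_le _, hs, by simp, ?_⟩).mono ?_
  · rintro f s ⟨i, m, R, o, eo, h5, hin, hs, hdeg, rfl⟩ hcond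
    simp only [BExp.holds, IExp.eval, h5, hs.edges.size] at hcond
    have hbig : n + 1 < 2 ^ b := by nlinarith
    refine Runs.wp_seq ?_
    simp only [wp, IExp.eval, h5]
    refine ⟨by omega, ?_⟩
    refine Runs.seq ((Runs.while (fun f s => ∃ m R o eo, s.ireg 5 = i ∧ s.ireg 6 < n ∧
      Peeled n a c l w lam m R o eo s ∧ (∀ v < i + 1, v ≠ s.ireg 6 → s.imem 2 v ≠ 1) ∧
      f = 13 * (n - 1 - m)) ?_ (f := 13 * (n - 1 - m)) ⟨m, R, o, eo, ?_⟩).mono ?_)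
    · rintro f s ⟨m, R, o, eo, h5, h6, hs, hdeg, rfl⟩ hcond
      refine (peelStep_runs hb hac hs h6 (by simpa [BExp.holds, IExp.eval] using hcond)).mono ?_
      rintro t s' ⟨ht, hm, h6', h5', ⟨R', o', eo', hs'⟩, hdeg'⟩
      refine ⟨13 * (n - 1 - (m + 1)), by omega, m + 1, R', o', eo', by omega, h6', hs', ?_, rfl⟩
      intro v hv hne
      refine hdeg' v hne ?_
      by_cases hv6 : v = s.ireg 6
      · exact .inr hv6
      · exact .inl (hdeg v hv hv6)
    · obtain ⟨⟨h0, ha, hc⟩, hl, hw, hlam, h7, h9, h9', h2, h3, hP, hpos, hplen, hrad⟩ := hs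
      refine ⟨by simpa using h5, by simpa using hcond,
        ⟨⟨by simpa using h0, ha, hc⟩, hl, hw, hlam, by simpa using h7, by simpa using h9,
          by simpa using h9', h2, h3, hP, hpos, hplen, hrad⟩, ?_, rfl⟩
      intro v hv hne
      simp only [State.writeIReg_ireg, if_true] at hne
      exact hdeg v (by omega)
    · rintro t s' ⟨f', hf, ⟨m', R', o', eo', h5', h6', hs', hdeg', rfl⟩, hn⟩
      refine (Runs.of_wp (Q := fun s'' => s'' = s'.writeIReg 5 (i + 1)) ?_).mono ?_
      · simp only [wp, IExp.eval, h5']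
        exact ⟨by omega, trivial⟩
      · rintro t' s'' ⟨ht', rfl⟩ t0 ht0
        simp only [Prog.cost] at ht' ht0
        refine ⟨4 * (n - (i + 1)) + 13 * (n - 1 - m'), by omega, i + 1, m', R', o', eo', by simp,
          by omega, ?_, ?_, rfl⟩
        · obtain ⟨⟨h0, ha, hc⟩, hl, hw, hlam, h7, h9, h9', h2, h3, hP, hpos, hplen, hrad⟩ := hs'
          exact ⟨⟨by simpa using h0, ha, hc⟩, hl, hw, hlam, by simpa using h7, by simpa using h9,
            by simpa using h9', h2, h3, hP, hpos, hplen, hrad⟩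
        · intro v hv
          by_cases hv6 : v = s'.ireg 6
          · rw [hv6]
            simpa [BExp.holds, IExp.eval] using hn
          · exact hdeg' v hv hv6
  · omega
  · rintro t s' ⟨f', hf, ⟨i, m, R, o, eo, h5, hin, hs', hdeg, rfl⟩, hn⟩
    simp only [BExp.holds, IExp.eval, h5, hs'.edges.size] at hn
    exact ⟨by omega, ⟨m, R, o, eo, hs'⟩, fun v hv => hdeg v (by omega)⟩

end

end RealRAM

/-! ### From peeled neighbours to parent numbers -/

namespace RealRAM

/-- Number the last vertex and turn the parents into numbers. -/
def numberParents : Prog :=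
  .setIMem 4 (.reg 9) (.sub (.reg 0) (.lit 1)) ;;
  .setRMem 3 (.sub (.reg 0) (.lit 1)) (.div (.reg 0) (.mem 1 (.reg 9))) ;;
  .setIMem 5 (.sub (.reg 0) (.lit 1)) (.reg 0) ;;
  .setIReg 5 (.lit 0) ;;
  .while (.ilt (.add (.reg 5) (.lit 1)) (.reg 0))
    (.setIMem 5 (.reg 5) (.mem 4 (.mem 5 (.reg 5))) ;; .setIReg 5 (.add (.reg 5) (.lit 1)))

/-- Number the vertices of a tree such that parents have larger numbers. -/
def rootTree : Prog :=
  countEdges ;; .setIReg 5 (.lit 0) ;; peelLoop ;; numberParents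

section

variable {n b : ℕ} {a c : ℕ → ℕ} {l w : ℕ → ℝ} {lam : ℝ}

theorem numberParents_runs (hb : 64 * (n + 1) ^ 2 < 2 ^ b) (hn : 1 ≤ n) {R : Finset ℕ}
    {o eo : ℕ → ℕ} {s : State} (hs : Peeled n a c l w lam (n - 1) R o eo s) :
    Runs b numberParents s fun t s' => t ≤ 3 * n + 5 ∧
      s'.imem 4 = Function.update (s.imem 4) (s.ireg 9) (n - 1) ∧
      s'.rmem 3 = Function.update (s.rmem 3) (n - 1) (lam / w (s.ireg 9)) ∧
      s'.imem 5 (n - 1) = n ∧ ∀ i < n - 1, s'.imem 5 i = s'.imem 4 (s.imem 5 i) := by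
  obtain ⟨⟨h0, ha, hc⟩, hl, hw, hlam, h7, h9, h9', h2, h3, hP, hpos, hplen, hrad⟩ := hs
  generalize hu : s.ireg 9 = u at *
  generalize hp5 : s.imem 5 = p at *
  obtain ⟨q, hq⟩ : ∃ q, q = Function.update (s.imem 4) u (n - 1) := ⟨_, rfl⟩
  have hbig : n + 1 < 2 ^ b := by nlinarith
  -- By counting, every vertex other than `u` has been peeled and has a number below `n - 1`. The
  -- bound is needed for storing the parent numbers in words.
  have hqlt : ∀ i < n - 1, q (p i) < n := by
    intro i hi
    rw [hq]
    by_cases hpu : p i = u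
    · rw [hpu, Function.update_self]
      omega
    · rw [Function.update_of_ne hpu]
      by_contra hcon
      have : ∀ v < n, v ≠ u → s.imem 4 v < n := by
        intro v hv hvu
        have h1 : ((Finset.range (n - 1)).image o) = (Finset.range n).erase u := by
          apply Finset.eq_of_subset_of_card_le
          · intro x hx
            obtain ⟨i, hi, rfl⟩ := Finset.mem_image.1 hx
            rw [Finset.mem_range] at hi
            exact Finset.mem_erase.2 ⟨h9' i hi, Finset.mem_range.2 (hP.o_lt i hi)⟩
          · rw [Finset.card_erase_of_mem (Finset.mem_range.2 h9), Finset.card_range,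
              Finset.card_image_of_injOn, Finset.card_range]
            intro i hi i' hi' heq
            exact hP.o_inj i (by simpa using hi) i' (by simpa using hi') heq
        have h2 : v ∈ (Finset.range n).erase u := Finset.mem_erase.2 ⟨hvu, Finset.mem_range.2 hv⟩
        rw [← h1] at h2
        obtain ⟨i, hi, rfl⟩ := Finset.mem_image.1 h2
        rw [Finset.mem_range] at hi
        rw [hpos i hi]
        omega
      exact hcon (this _ (hP.p_lt i hi) hpu)
  unfold numberParents
  refine Runs.wp_seq ?_
  simp only [wp, IExp.eval, h0, hu]
  refine ⟨by omega, Runs.wp_seq ?_⟩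
  simp only [wp, IExp.eval, RExp.eval, h0, hu, State.writeIMem_ireg, State.writeIMem_rreg,
    State.writeIMem_rmem, hlam, hw]
  refine Runs.wp_seq ?_
  simp only [wp, IExp.eval, h0, hu, State.writeIMem_ireg, State.writeRMem_ireg]
  refine ⟨by omega, Runs.wp_seq ?_⟩
  simp only [wp, IExp.eval]
  -- The parents are converted in place: entries before `i` are numbers already, entries from `i` on
  -- are still vertices.
  refine ⟨by omega, (Runs.for (fun i s' => s'.ireg 5 = i ∧ s'.ireg 0 = n ∧ s'.imem 4 = q ∧
    s'.imem 5 (n - 1) = n ∧ (∀ i' < i, s'.imem 5 i' = q (p i')) ∧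
    (∀ i' < n - 1, i ≤ i' → s'.imem 5 i' = p i') ∧
    s'.rmem 3 = Function.update (s.rmem 3) (n - 1) (lam / w u)) 2 (n - 1) ?_ ?_ ?_).mono ?_⟩
  · rintro i s' - ⟨g5, g0, -⟩
    simp only [BExp.holds, IExp.eval, g0, g5]
    omega
  · rintro i s' hi ⟨g5, g0, g4, gn, gl, gr, g3⟩
    refine (Runs.of_wp ?_).mono fun t s' h => h
    have := gr i hi le_rfl
    have hqi := hqlt i hi
    simp only [wp, IExp.eval, g5, g4, this, State.writeIReg_ireg, State.writeIReg_imem,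
      State.writeIMem_imem, State.writeIMem_ireg, State.writeIReg_rmem, State.writeIMem_rmem,
      if_true, if_false, Nat.reduceEqDiff]
    refine ⟨by omega, by omega, trivial, by simpa using g0, trivial, ?_, ?_, ?_, g3⟩
    · rw [Function.update_of_ne (by omega), gn]
    · intro i' hi'
      by_cases h : i' = i
      · subst h; simp
      · rw [Function.update_of_ne h, gl i' (by omega)]
    · intro i' hi' hle
      rw [Function.update_of_ne (by omega), gr i' hi' (by omega)]
  · refine ⟨by simp, by simpa using h0, by simp [hq], by simp, by simp, ?_, by simp⟩
    intro i' hi' _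
    simp only [State.writeIReg_imem, State.writeIMem_imem, if_true, State.writeRMem_imem,
      Nat.reduceEqDiff, if_false, hp5]
    rw [Function.update_of_ne (by omega)]
  · rintro t s' ⟨ht, -, -, g4, gn, gl, -, g3⟩ t1 h1 t2 h2 t3 h3 t4 h4
    simp only [Prog.cost] at h1 h2 h3 h4
    refine ⟨by omega, by rw [g4, hq], g3, gn, ?_⟩
    intro i hi
    rw [gl i hi, g4]

end

end RealRAM

/-! ### Correctness of the rooted numbering -/

namespace WeightedTree

open RealRAM

variable {n : ℕ}

/-- Connectedness of the tree in the form that `Peeling.complete` asks for, by following a walk. -/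
theorem closed_of_edges (T : WeightedTree n) (E : T.EdgeList) {a c : ℕ → ℕ}
    (ha : ∀ i : Fin (n - 1), a i = E.fst i) (hc : ∀ i : Fin (n - 1), c i = E.snd i)
    (Z : ℕ → Prop) (hz : ∃ z < n, Z z) (h : ∀ e < n - 1, Z (a e) ↔ Z (c e)) :
    ∀ v < n, Z v := by
  obtain ⟨z, hzn, hz⟩ := hz
  intro v hv
  obtain ⟨p⟩ := T.isTree.connected.preconnected ⟨z, hzn⟩ ⟨v, hv⟩
  have : ∀ u v : Fin n, T.graph.Walk u v → Z u → Z v := by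
    intro u v p
    induction p with
    | nil => exact id
    | @cons u v w hadj p ih =>
      intro hu
      refine ih ?_
      obtain ⟨i, hi⟩ := (E.adj_iff u v).1 hadj
      have := h i i.2
      rw [ha, hc] at this
      rcases Sym2.eq_iff.1 hi with ⟨h1, h2⟩ | ⟨h1, h2⟩
      · rw [h1, h2] at this
        exact this.1 hu
      · rw [h1, h2] at this
        exact this.2 hu
  exact this _ _ p hz

/-- After `n - 1` rounds no edge remains, so every edge joins some peeled vertex to its neighbour at
that time. The position in the peeling order is the number of a vertex, and neighbours come later,
which makes them parents with larger numbers. -/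
theorem Peeled.rooted {T : WeightedTree n} {E : T.EdgeList} {lam : ℝ} {a c : ℕ → ℕ}
    {l w : ℕ → ℝ} {o eo : ℕ → ℕ} {R : Finset ℕ} {s : State} (hn : 1 ≤ n)
    (ha : ∀ i : Fin (n - 1), a i = E.fst i) (hc : ∀ i : Fin (n - 1), c i = E.snd i)
    (hl : ∀ i : Fin (n - 1), l i = T.len s(E.fst i, E.snd i)) (hw : ∀ v : Fin n, w v = T.weight v)
    (hs : Peeled n a c l w lam (n - 1) R o eo s)
    (hall : ∀ v < n, v = s.ireg 9 ∨ ∃ i < n - 1, o i = v) {par : ℕ → ℕ}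
    (hroot : par (n - 1) = n)
    (hpar : ∀ i < n - 1, par i = Function.update (s.imem 4) (s.ireg 9) (n - 1) (s.imem 5 i)) :
    T.Rooted lam (Function.update (s.imem 4) (s.ireg 9) (n - 1)) par (s.rmem 2)
      (Function.update (s.rmem 3) (n - 1) (lam / w (s.ireg 9))) := by
  obtain ⟨-, -, -, -, h7, h9, h9', -, -, hP, hpos, hplen, hrad⟩ := hs
  generalize hu : s.ireg 9 = u at *
  generalize hp5 : s.imem 5 = p at *
  set q := Function.update (s.imem 4) u (n - 1) with hq
  have hqo : ∀ i < n - 1, q (o i) = i := by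
    intro i hi
    rw [hq, Function.update_of_ne (h9' i hi), hpos i hi]
  have hqu : q u = n - 1 := by rw [hq, Function.update_self]
  have hcase : ∀ v < n, v = u ∧ q v = n - 1 ∨ q v < n - 1 ∧ o (q v) = v := by
    intro v hv
    rcases hall v hv with rfl | ⟨i, hi, rfl⟩
    · exact .inl ⟨rfl, hqu⟩
    · exact .inr ⟨by rw [hqo i hi]; exact hi, by rw [hqo i hi]⟩
  have hinj : ∀ x < n, ∀ y < n, q x = q y → x = y := by
    intro x hx y hy h
    rcases hcase x hx with ⟨rfl, h1⟩ | ⟨h1, h1'⟩ <;> rcases hcase y hy with ⟨rfl, h2⟩ | ⟨h2, h2'⟩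
    · rfl
    · omega
    · omega
    · rw [← h1', ← h2', h]
  have hparc : ∀ i < n - 1, i < par i ∧ par i < n := by
    intro i hi
    rw [hpar i hi]
    rcases hcase _ (hP.p_lt i hi) with ⟨-, h2⟩ | ⟨h1, h2⟩
    · omega
    · exact ⟨hP.order i hi _ h1 h2.symm, by omega⟩
  refine ⟨?_, hinj, ?_, ?_, ?_, ?_, ?_, ?_⟩
  · intro v hv
    rcases hcase v hv with ⟨-, h⟩ | ⟨h, -⟩ <;> omega
  · intro j hj
    by_cases h : j = n - 1
    · rw [h, hroot]; omega
    · exact (hparc j (by omega)).1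
  · intro j hj
    by_cases h : j = n - 1
    · rw [h, hroot]
    · exact (hparc j (by omega)).2.le
  · intro j hj hjn
    by_contra h
    have := hparc j (by omega)
    omega
  · intro x y
    have hedge : ∀ x y : Fin n, par (q x) = q y ↔ ∃ i < n - 1, o i = x ∧ p i = y := by
      intro x y
      constructor
      · intro h
        rcases hcase x x.2 with ⟨-, h2⟩ | ⟨h1, h2⟩
        · rw [h2, hroot] at h
          rcases hcase y y.2 with ⟨-, h'⟩ | ⟨h', -⟩ <;> omega
        · rw [hpar _ h1] at h
          exact ⟨_, h1, h2, hinj _ (hP.p_lt _ h1) _ y.2 h⟩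
      · rintro ⟨i, hi, h1, h2⟩
        rw [← h1, ← h2, hqo i hi, hpar i hi]
    rw [hedge, hedge, E.adj_iff]
    constructor
    · rintro ⟨e, he⟩
      rcases hP.cover e e.2 with h | ⟨i, hi, hie⟩
      · have := hP.card
        have := Finset.card_pos.2 ⟨_, h⟩
        omega
      · have := hP.edge i hi
        rw [hie, ha, hc] at this
        rcases Sym2.eq_iff.1 he with ⟨h1, h2⟩ | ⟨h1, h2⟩ <;> rw [h1, h2] at this <;>
          rcases this with ⟨h3, h4⟩ | ⟨h3, h4⟩
        · exact .inl ⟨i, hi, h3.symm, h4.symm⟩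
        · exact .inr ⟨i, hi, h4.symm, h3.symm⟩
        · exact .inr ⟨i, hi, h3.symm, h4.symm⟩
        · exact .inl ⟨i, hi, h4.symm, h3.symm⟩
    · have key : ∀ x y : Fin n, (∃ i < n - 1, o i = x ∧ p i = y) →
          ∃ i, s(E.fst i, E.snd i) = s(x, y) := by
        rintro x y ⟨i, hi, h1, h2⟩
        have h3 := hP.edge i hi
        have h4 := hP.eo_lt i hi
        have h5 := ha ⟨_, h4⟩
        have h6 := hc ⟨_, h4⟩
        simp only at h5 h6
        rw [h5, h6, h1, h2] at h3
        refine ⟨⟨_, h4⟩, Sym2.eq_iff.2 ?_⟩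
        simpa only [Fin.ext_iff] using h3
      rintro (h | h)
      · exact key x y h
      · rw [Sym2.eq_swap]
        exact key y x h
  · intro x y h
    rcases hcase x x.2 with ⟨-, h2⟩ | ⟨h1, h2⟩
    · rw [h2, hroot] at h
      rcases hcase y y.2 with ⟨-, h'⟩ | ⟨h', -⟩ <;> omega
    · rw [hpar _ h1] at h
      have h7 := hinj _ (hP.p_lt _ h1) _ y.2 h
      have h3 := hP.edge _ h1
      have h4 := hP.eo_lt _ h1
      have h5 := ha ⟨_, h4⟩
      have h6 := hc ⟨_, h4⟩
      simp only at h5 h6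
      rw [h5, h6, h2, h7] at h3
      rw [hplen _ h1, hl ⟨_, h4⟩]
      congr 1
      exact Sym2.eq_iff.2 (by simpa only [Fin.ext_iff] using h3)
  · intro v
    rcases hcase v v.2 with ⟨h1, h2⟩ | ⟨h1, h2⟩
    · rw [h2, Function.update_self, ← h1, hw]
    · rw [Function.update_of_ne (by omega), hrad _ h1, h2, hw]

theorem rootTree_runs (T : WeightedTree n) (E : T.EdgeList) (lam : ℝ) (k : ℕ) {b : ℕ}
    (hb : 64 * (n + 1) ^ 2 < 2 ^ b) (hn : 1 ≤ n) :
    Runs b rootTree (T.initState E lam k) fun t s => t ≤ 32 * n ∧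
      T.Rooted lam (s.imem 4) (s.imem 5) (s.rmem 2) (s.rmem 3) ∧
      ∀ j < n, s.imem 5 j ≤ n := by
  set s0 := T.initState E lam k with hs0
  obtain ⟨a, haa⟩ : ∃ a, s0.imem 0 = a := ⟨_, rfl⟩
  obtain ⟨c, hcc⟩ : ∃ c, s0.imem 1 = c := ⟨_, rfl⟩
  obtain ⟨l, hll⟩ : ∃ l, s0.rmem 0 = l := ⟨_, rfl⟩
  obtain ⟨w, hww⟩ : ∃ w, s0.rmem 1 = w := ⟨_, rfl⟩
  have ha : ∀ i : Fin (n - 1), a i = E.fst i := by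
    intro i
    rw [← haa]
    simp [hs0, initState, i.2]
  have hc : ∀ i : Fin (n - 1), c i = E.snd i := by
    intro i
    rw [← hcc]
    simp [hs0, initState, i.2]
  have hl : ∀ i : Fin (n - 1), l i = T.len s(E.fst i, E.snd i) := by
    intro i
    rw [← hll]
    simp [hs0, initState, i.2]
  have hw : ∀ v : Fin n, w v = T.weight v := by
    intro v
    rw [← hww]
    simp [hs0, initState, v.2]
  have hac : ∀ e < n - 1, a e < n ∧ c e < n ∧ a e ≠ c e := by
    intro e he
    have h1 := ha ⟨e, he⟩
    have h2 := hc ⟨e, he⟩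
    simp only at h1 h2
    have h3 := (E.adj_iff (E.fst ⟨e, he⟩) (E.snd ⟨e, he⟩)).2 ⟨_, rfl⟩
    refine ⟨by omega, by omega, ?_⟩
    rw [h1, h2]
    exact fun h => h3.ne (Fin.ext h)
  have hz : s0.imem 2 = fun _ => 0 := by
    funext i
    simp [hs0, initState]
  have hz3 : s0.imem 3 = fun _ => 0 := by
    funext i
    simp [hs0, initState]
  have hbig : n + 1 < 2 ^ b := by nlinarith
  refine Runs.seq ((countEdges_runs hb (fun e he => (hac e he).2.2)
    ⟨by simp [hs0, initState], haa, hcc⟩ (by simp [hs0, initState]) hz hz3).mono_frame ?_)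
  rintro t1 s1 ⟨ht1, h2, h3⟩ F1
  refine Runs.wp_seq ?_
  simp only [wp, IExp.eval]
  -- Nothing has been peeled yet, so the functions `o` and `eo` are arbitrary.
  refine ⟨by omega, Runs.seq ((peelLoop_runs (l := l) (w := w) (lam := lam) (o := id) (eo := id)
    hb hac ?_ (by simp)).mono_frame ?_)⟩
  · have r0 := F1.ireg 0 (by decide)
    have r7 := F1.ireg 7 (by decide)
    have r9 := F1.ireg 9 (by decide)
    refine ⟨⟨?_, ?_, ?_⟩, ?_, ?_, ?_, ?_, ?_, by simp, h2, h3, .init, by simp, by simp, by simp⟩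
    · simp [r0, hs0, initState]
    · exact (F1.imem 0 (by decide)).trans haa
    · exact (F1.imem 1 (by decide)).trans hcc
    · exact (F1.rmem 0 (by decide)).trans hll
    · exact (F1.rmem 1 (by decide)).trans hww
    · exact (F1.rreg 0 (by decide)).trans (by simp [hs0, initState])
    · simp [r7, hs0, initState]
    -- Register `9` starts as `0`, which is a vertex since `n` is positive; for `n = 1` it is
    -- already the root.
    · simp only [State.writeIReg_ireg, r9]
      simp [hs0, initState]
      omega
  · rintro t2 s2 ⟨ht2, ⟨m, R, o, eo, hP⟩, hdeg⟩ F2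
    obtain ⟨rfl, hall⟩ := hP.peeling.complete hn hac (closed_of_edges T E ha hc)
      (fun v hv => hP.deg ▸ hdeg v hv) hP.root_lt hP.root_ne
    refine (numberParents_runs hb hn hP).mono_frame ?_
    rintro t3 s3 ⟨ht3, g4, g3, gn, gp⟩ F3 t0 ht0
    have hR := Peeled.rooted (par := s3.imem 5) hn ha hc hl hw hP hall gn fun i hi => by
      rw [gp i hi, g4]
    simp only [Prog.cost] at ht0
    rw [← g4, ← g3, ← F3.rmem 2 (by decide)] at hR
    exact ⟨by omega, hR, hR.par_le⟩

end WeightedTree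

/-! ## Merging sorted lists -/

/-- The list of `m` consecutive entries of an array, from entry `o` on. -/
def slice (f : ℕ → ℝ) (o m : ℕ) : List ℝ := (List.range m).map fun i => f (o + i)

@[simp] theorem slice_length (f : ℕ → ℝ) (o m : ℕ) : (slice f o m).length = m := by
  simp [slice]

theorem slice_getElem (f : ℕ → ℝ) (o m i : ℕ) (h : i < (slice f o m).length) :
    (slice f o m)[i] = f (o + i) := by
  simp [slice]

theorem slice_succ (f : ℕ → ℝ) (o m : ℕ) :
    slice f o (m + 1) = slice f o m ++ [f (o + m)] := by
  simp [slice, List.range_succ]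

theorem slice_congr {f g : ℕ → ℝ} {o m : ℕ} (h : ∀ i < m, f (o + i) = g (o + i)) :
    slice f o m = slice g o m := by
  unfold slice
  exact List.map_congr_left fun i hi => h i (List.mem_range.1 hi)

open Classical in
/-- Merge two descending lists. -/
noncomputable def mergeDesc (X Y : List ℝ) : List ℝ := X.merge Y fun a b => decide (b ≤ a)

theorem mergeDesc_perm (X Y : List ℝ) : (mergeDesc X Y).Perm (X ++ Y) := List.merge_perm_append _

theorem mergeDesc_sorted {X Y : List ℝ} (hX : X.Pairwise (· ≥ ·)) (hY : Y.Pairwise (· ≥ ·)) :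
    (mergeDesc X Y).Pairwise (· ≥ ·) := by
  classical
  have := List.pairwise_merge (le := fun a b : ℝ => decide (b ≤ a)) (l₁ := X) (l₂ := Y)
    (fun a b c h1 h2 => by simp only [decide_eq_true_eq] at *; exact h2.trans h1)
    (fun a b => by simp [le_total]) (by simpa using hX) (by simpa using hY)
  simpa [mergeDesc] using this

/-! ### Merging in memory -/

namespace RealRAM

/-- One step of `mergeLists`. -/
def mergeStep : Prog :=
  .setRReg 12 (.sub (.mem 4 (.add (.reg 22) (.reg 26))) (.reg 11)) ;;
  .ite (.rlt (.reg 10) (.reg 12)) (.setRReg 12 (.reg 10)) .skip ;;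
  .ite (.and (.ilt (.reg 25) (.reg 21)) (.or (.not (.ilt (.reg 26) (.reg 23)))
      (.rle (.reg 12) (.mem 4 (.add (.reg 20) (.reg 25))))))
    (.setRMem 4 (.add (.reg 24) (.add (.reg 25) (.reg 26))) (.mem 4 (.add (.reg 20) (.reg 25))) ;;
      .setIReg 25 (.add (.reg 25) (.lit 1)))
    (.setRMem 4 (.add (.reg 24) (.add (.reg 25) (.reg 26))) (.reg 12) ;;
      .setIReg 26 (.add (.reg 26) (.lit 1)))

/-- Merge the list at register `20` of size in register `21` with the image of the list at
register `22` of size in register `23` under `y ↦ min c (y - l)`, where `c`, `l` are in the real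
registers `10, 11`; the result is written at register `24`. -/
def mergeLists : Prog :=
  .setIReg 25 (.lit 0) ;; .setIReg 26 (.lit 0) ;;
  .while (.ilt (.add (.reg 25) (.reg 26)) (.add (.reg 21) (.reg 23))) mergeStep

/-- The parameters of `mergeLists`. -/
structure MergeArgs (xo xs yo ys zo : ℕ) (c l : ℝ) (s : State) : Prop where
  xo_eq : s.ireg 20 = xo
  xs_eq : s.ireg 21 = xs
  yo_eq : s.ireg 22 = yo
  ys_eq : s.ireg 23 = ys
  zo_eq : s.ireg 24 = zo
  cap_eq : s.rreg 10 = c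
  len_eq : s.rreg 11 = l

/-- The result is written behind both inputs, so these stay intact while they are read. Sortedness
plays no role here: the loop imitates `mergeDesc` on any two lists and applies the map on the fly.
-/
theorem mergeLists_runs {b xo xs yo ys zo : ℕ} {c l : ℝ} {s : State}
    (hs : MergeArgs xo xs yo ys zo c l s) (hx : xo + xs ≤ zo) (hy : yo + ys ≤ zo)
    (hb : zo + xs + ys < 2 ^ b) :
    Runs b mergeLists s fun t s' => t ≤ 10 * (xs + ys) + 3 ∧
      slice (s'.rmem 4) zo (xs + ys) = mergeDesc (slice (s.rmem 4) xo xs)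
        ((slice (s.rmem 4) yo ys).map fun a => min c (a - l)) ∧
      ∀ i < zo, s'.rmem 4 i = s.rmem 4 i := by
  classical
  obtain ⟨f, hf⟩ : ∃ f, s.rmem 4 = f := ⟨_, rfl⟩
  rw [hf]
  obtain ⟨X, hX⟩ : ∃ X, X = slice f xo xs := ⟨_, rfl⟩
  obtain ⟨Y, hY⟩ : ∃ Y, Y = (slice f yo ys).map fun a => min c (a - l) := ⟨_, rfl⟩
  rw [← hX, ← hY]
  have hXl : X.length = xs := by simp [hX]
  have hYl : Y.length = ys := by simp [hY]
  have hXi : ∀ i (h : i < X.length), X[i] = f (xo + i) := by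
    subst hX
    intro i h
    rw [slice_getElem]
  have hYi : ∀ i (h : i < Y.length), Y[i] = min c (f (yo + i) - l) := by
    subst hY
    intro i h
    rw [List.getElem_map, slice_getElem]
  unfold mergeLists
  refine Runs.wp_seq ?_
  simp only [wp, IExp.eval]
  refine ⟨by omega, Runs.wp_seq ?_⟩
  simp only [wp, IExp.eval]
  refine ⟨by omega, (Runs.for (fun m s' => MergeArgs xo xs yo ys zo c l s' ∧
    (∀ i < zo, s'.rmem 4 i = f i) ∧
    ∃ i j, s'.ireg 25 = i ∧ s'.ireg 26 = j ∧ i + j = m ∧ i ≤ xs ∧ j ≤ ys ∧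
      slice (s'.rmem 4) zo m ++ mergeDesc (X.drop i) (Y.drop j) = mergeDesc X Y)
    9 (xs + ys) ?_ ?_ ?_).mono ?_⟩
  · rintro m s' - ⟨hs', -, i, j, hi, hj, hm, -⟩
    simp only [BExp.holds, IExp.eval, hi, hj, hs'.xs_eq, hs'.ys_eq]
    omega
  · rintro m s' hm ⟨⟨h20, h21, h22, h23, h24, h10, h11⟩, hfr, i, j, hi, hj, hij, hix, hjy, hseg⟩
    have hval : (i < xs ∧ (¬ j < ys ∨ min c (f (yo + j) - l) ≤ f (xo + i)) →
        mergeDesc (X.drop i) (Y.drop j) = f (xo + i) :: mergeDesc (X.drop (i + 1)) (Y.drop j)) := by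
      rintro ⟨hlt, hor⟩
      rw [List.drop_eq_getElem_cons (h := by omega), hXi]
      by_cases hjl : j < ys
      · rw [List.drop_eq_getElem_cons (l := Y) (h := by omega), hYi]
        simp only [mergeDesc, List.cons_merge_cons]
        rw [if_pos]
        simpa using hor.resolve_left (not_not.2 hjl)
      · rw [List.drop_eq_nil_of_le (as := Y) (by omega)]
        simp [mergeDesc]
    have hval' : ¬ (i < xs ∧ (¬ j < ys ∨ min c (f (yo + j) - l) ≤ f (xo + i))) →
        j < ys ∧ mergeDesc (X.drop i) (Y.drop j) =
          min c (f (yo + j) - l) :: mergeDesc (X.drop i) (Y.drop (j + 1)) := by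
      intro hn
      have hjl : j < ys := by
        by_contra hcon
        exact hn ⟨by omega, .inl hcon⟩
      refine ⟨hjl, ?_⟩
      rw [List.drop_eq_getElem_cons (l := Y) (h := by omega), hYi]
      by_cases hil : i < xs
      · rw [List.drop_eq_getElem_cons (l := X) (h := by omega), hXi]
        simp only [mergeDesc, List.cons_merge_cons]
        rw [if_neg]
        intro hle
        exact hn ⟨hil, .inr (by simpa using hle)⟩
      · rw [List.drop_eq_nil_of_le (as := X) (by omega)]
        simp [mergeDesc]
    have hstep : ∀ v i' j' g, mergeDesc (X.drop i) (Y.drop j) =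
        v :: mergeDesc (X.drop i') (Y.drop j') →
        g = Function.update (s'.rmem 4) (zo + (i + j)) v →
        (∀ i < zo, g i = f i) ∧
        slice g zo (m + 1) ++ mergeDesc (X.drop i') (Y.drop j') = mergeDesc X Y := by
      rintro v i' j' g h rfl
      refine ⟨fun i' hi' => by rw [Function.update_of_ne (by omega), hfr i' hi'], ?_⟩
      rw [← hseg, h, slice_succ, hij, Function.update_self, List.append_assoc,
        List.singleton_append]
      congr 1
      exact slice_congr fun i' hi' => by rw [Function.update_of_ne (by omega)]
    -- Past the end of a list the program reads an unrelated cell. The value does not matter,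
    -- because the test then decides by the positions alone.
    have e1 : s'.rmem 4 (yo + j) - l = f (yo + j) - l ∨ ¬ j < ys := by
      by_cases hjl : j < ys
      · exact .inl (by rw [hfr _ (by omega)])
      · exact .inr hjl
    have e2 : s'.rmem 4 (xo + i) = f (xo + i) ∨ ¬ i < xs := by
      by_cases hil : i < xs
      · exact .inl (by rw [hfr _ (by omega)])
      · exact .inr hil
    refine (Runs.of_wp (Q := fun s'' => MergeArgs xo xs yo ys zo c l s'' ∧
      (∀ i < zo, s''.rmem 4 i = f i) ∧
      ∃ i j, s''.ireg 25 = i ∧ s''.ireg 26 = j ∧ i + j = m + 1 ∧ i ≤ xs ∧ j ≤ ys ∧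
        slice (s''.rmem 4) zo (m + 1) ++ mergeDesc (X.drop i) (Y.drop j) = mergeDesc X Y)
        ?_).mono fun t s'' h => ⟨h.1, h.2⟩
    -- Both branches of the first test leave `min c (y - l)` in register `12`, so the rest of the
    -- step is treated once.
    have hmain : ∀ s1 : State, s1.ireg = s'.ireg → s1.rmem = s'.rmem → s1.rreg 10 = c →
        s1.rreg 11 = l → s1.rreg 12 = min c (s'.rmem 4 (yo + j) - l) →
        wp b (.ite (.and (.ilt (.reg 25) (.reg 21)) (.or (.not (.ilt (.reg 26) (.reg 23)))
          (.rle (.reg 12) (.mem 4 (.add (.reg 20) (.reg 25))))))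
          (.setRMem 4 (.add (.reg 24) (.add (.reg 25) (.reg 26)))
            (.mem 4 (.add (.reg 20) (.reg 25))) ;; .setIReg 25 (.add (.reg 25) (.lit 1)))
          (.setRMem 4 (.add (.reg 24) (.add (.reg 25) (.reg 26))) (.reg 12) ;;
            .setIReg 26 (.add (.reg 26) (.lit 1)))) (fun s'' => MergeArgs xo xs yo ys zo c l s'' ∧
      (∀ i < zo, s''.rmem 4 i = f i) ∧
      ∃ i j, s''.ireg 25 = i ∧ s''.ireg 26 = j ∧ i + j = m + 1 ∧ i ≤ xs ∧ j ≤ ys ∧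
        slice (s''.rmem 4) zo (m + 1) ++ mergeDesc (X.drop i) (Y.drop j) = mergeDesc X Y) s1 := by
      intro s1 hI hM hc hl' h12
      have hcond : (i < xs ∧ (¬ j < ys ∨ s1.rreg 12 ≤ s1.rmem 4 (xo + i))) ↔
          (i < xs ∧ (¬ j < ys ∨ min c (f (yo + j) - l) ≤ f (xo + i))) := by
        rw [h12, hM]
        rcases e1 with e1 | e1 <;> rcases e2 with e2 | e2 <;> simp [e1, e2]
      simp only [wp, BExp.holds, IExp.eval, RExp.eval, State.writeRMem_ireg, hI, h20, h21, h22,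
        h23, h24, hi, hj]
      rw [hcond]
      constructor
      · intro h
        have hv := hval h
        rw [← e2.resolve_right (not_not.2 h.1)] at hv
        obtain ⟨g1, g2⟩ := hstep _ _ _ _ hv rfl
        refine ⟨by omega, ⟨by simp [hI, h20], by simp [hI, h21], by simp [hI, h22],
          by simp [hI, h23], by simp [hI, h24], by simp [hc], by simp [hl']⟩, by simpa [hM] using g1,
          i + 1, j, by simp, by simp [hI, hj], by omega, by omega, by omega,
          by simpa [hM] using g2⟩
      · intro h
        obtain ⟨hjl, hv⟩ := hval' h
        rw [← e1.resolve_right (not_not.2 hjl), ← h12] at hv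
        obtain ⟨g1, g2⟩ := hstep _ _ _ _ hv rfl
        refine ⟨by omega, ⟨by simp [hI, h20], by simp [hI, h21], by simp [hI, h22],
          by simp [hI, h23], by simp [hI, h24], by simp [hc], by simp [hl']⟩, by simpa [hM] using g1,
          i, j + 1, by simp [hI, hi], by simp, by omega, by omega, by omega,
          by simpa [hM] using g2⟩
    unfold mergeStep
    rw [wp, wp, wp, wp]
    simp only [BExp.holds, RExp.eval, IExp.eval, State.writeRReg_rreg, if_true, Nat.reduceEqDiff,
      if_false, h10, h11, h22, hj]
    constructor
    · intro h
      rw [wp]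
      refine hmain _ rfl rfl (by simp [h10]) (by simp [h11]) ?_
      simp only [State.writeRReg_rreg, if_true, RExp.eval, Nat.reduceEqDiff, if_false, h10]
      rw [min_eq_left h.le]
    · intro h
      rw [wp]
      refine hmain _ rfl rfl (by simp [h10]) (by simp [h11]) ?_
      simp only [State.writeRReg_rreg, if_true]
      rw [min_eq_right (not_lt.1 h)]
  · obtain ⟨h20, h21, h22, h23, h24, h10, h11⟩ := hs
    refine ⟨⟨by simpa using h20, by simpa using h21, by simpa using h22, by simpa using h23,
      by simpa using h24, h10, h11⟩, by simp [hf], 0, 0, by simp, by simp, rfl, by omega, by omega,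
      by simp [slice]⟩
  · rintro t s' ⟨ht, hs', hfr, i, j, hi, hj, hij, hix, hjy, hseg⟩ t1 h1 t2 h2
    simp only [Prog.cost] at h1 h2
    refine ⟨by omega, ?_, hfr⟩
    rw [List.drop_eq_nil_of_le (as := X) (by omega), List.drop_eq_nil_of_le (as := Y) (by omega)]
      at hseg
    simpa [mergeDesc] using hseg

end RealRAM

/-! ## The forest of clusters in memory -/

namespace RealRAM

open Cluster

/-- The lists of node `i` are stored below `P` and describe the cluster `C`. -/
structure StoresNode (par : ℕ → ℕ) (len r : ℕ → ℝ) (P : ℕ) (s : State) (C : Cluster) (i : ℕ) :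
    Prop where
  size : s.imem 11 i = C.mem.card
  top_le : s.imem 12 i + C.mem.card ≤ P
  bot_le : s.imem 13 i + C.mem.card ≤ P
  top_sorted : (slice (s.rmem 4) (s.imem 12 i) C.mem.card).Pairwise (· ≥ ·)
  top_perm : (slice (s.rmem 4) (s.imem 12 i) C.mem.card).Perm (C.fromTop par len r)
  bot_sorted : (slice (s.rmem 4) (s.imem 13 i) C.mem.card).Pairwise (· ≥ ·)
  bot_perm : (slice (s.rmem 4) (s.imem 13 i) C.mem.card).Perm (C.fromBot par len r)
  length : s.rmem 5 i = C.length len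
  capUp : s.rmem 6 i = C.capUp par len r
  capDown : s.rmem 7 i = C.capDown par len r

/-- New lists are written only from `P` on, so the nodes that exist already survive every join. -/
theorem StoresNode.congr {par : ℕ → ℕ} {len r : ℕ → ℝ} {P P' : ℕ} {s s' : State} {C : Cluster}
    {i : ℕ} (h : StoresNode par len r P s C i) (hP : P ≤ P') (h11 : s'.imem 11 i = s.imem 11 i)
    (h12 : s'.imem 12 i = s.imem 12 i) (h13 : s'.imem 13 i = s.imem 13 i)
    (h4 : ∀ j < P, s'.rmem 4 j = s.rmem 4 j) (h5 : s'.rmem 5 i = s.rmem 5 i)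
    (h6 : s'.rmem 6 i = s.rmem 6 i) (h7 : s'.rmem 7 i = s.rmem 7 i) :
    StoresNode par len r P' s' C i := by
  have e0 : slice (s'.rmem 4) (s.imem 12 i) C.mem.card =
      slice (s.rmem 4) (s.imem 12 i) C.mem.card :=
    slice_congr fun j hj => h4 _ (by have := h.top_le; omega)
  have e1 : slice (s'.rmem 4) (s.imem 13 i) C.mem.card =
      slice (s.rmem 4) (s.imem 13 i) C.mem.card :=
    slice_congr fun j hj => h4 _ (by have := h.bot_le; omega)
  refine ⟨h11.trans h.size, ?_, ?_, ?_, ?_, ?_, ?_, h5.trans h.length, h6.trans h.capUp,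
    h7.trans h.capDown⟩
  · rw [h12]; exact h.top_le.trans hP
  · rw [h13]; exact h.bot_le.trans hP
  · rw [h12, e0]; exact h.top_sorted
  · rw [h12, e0]; exact h.top_perm
  · rw [h13, e1]; exact h.bot_sorted
  · rw [h13, e1]; exact h.bot_perm

/-- Node `i` is a root, or its parent, its sibling and its kind are stored. -/
def Linked (N : ℕ) (s : State) (e : ℕ → Cluster) (i : ℕ) : Prop :=
  s.imem 15 i = 0 ∨ (s.imem 14 i < N ∧ s.imem 16 i < N ∧
    (s.imem 15 i = 1 ∧ e (s.imem 14 i) = .rake (e i) (e (s.imem 16 i)) ∨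
     s.imem 15 i = 2 ∧ e (s.imem 14 i) = .rake (e (s.imem 16 i)) (e i) ∨
     s.imem 15 i = 3 ∧ e (s.imem 14 i) = .comp (e i) (e (s.imem 16 i)) ∨
     s.imem 15 i = 4 ∧ e (s.imem 14 i) = .comp (e (s.imem 16 i)) (e i)))

/-- `A` is the set of the present bottom vertices; the one cluster with bottom `v` is `E v`, and
its top is `up v`. -/
structure IsForest (n : ℕ) (par : ℕ → ℕ) (len r : ℕ → ℝ) (s : State) (e : ℕ → Cluster)
    (A : Finset ℕ) (up : ℕ → ℕ) (E : ℕ → Cluster) : Prop where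
  subset : A ⊆ Finset.range n
  count : s.ireg 11 + A.card = 2 * n
  storage : s.ireg 12 = 2 * ∑ v ∈ A, (E v).total
  node : ∀ i < s.ireg 11, StoresNode par len r (s.ireg 12) s (e i) i
  wf : ∀ i < s.ireg 11, (e i).WF par n
  linked : ∀ i < s.ireg 11, Linked (s.ireg 11) s e i
  kind_zero : ∀ i, s.ireg 11 ≤ i → s.imem 15 i = 0
  root : ∀ i < s.ireg 11, s.imem 15 i = 0 → ∃ v ∈ A, s.imem 6 v = i
  id_lt : ∀ v ∈ A, s.imem 6 v < s.ireg 11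
  cluster : ∀ v ∈ A, e (s.imem 6 v) = E v
  bot_eq : ∀ v ∈ A, (E v).bot = v
  top_eq : ∀ v ∈ A, (E v).top par = up v
  disjoint : ∀ v ∈ A, ∀ w ∈ A, v ≠ w → Disjoint (E v).mem (E w).mem
  cover : ∀ z < n, ∃ v ∈ A, z ∈ (E v).mem
  base : ∀ j < n, e j = .base j

/-- The parameters of `joinCore`: the lists, in two halves each, and the other data of the new
cluster `F`. -/
structure JoinArgs (par : ℕ → ℕ) (len r : ℕ → ℝ) (F : Cluster) (ca cb y ka kb : ℕ)
    (s : State) : Prop where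
  fst : s.ireg 30 = ca
  snd : s.ireg 31 = cb
  bottom : s.ireg 32 = y
  kind_fst : s.ireg 44 = ka
  kind_snd : s.ireg 45 = kb
  le1 : s.ireg 20 + s.ireg 21 ≤ s.ireg 12
  le2 : s.ireg 22 + s.ireg 23 ≤ s.ireg 12
  le3 : s.ireg 40 + s.ireg 41 ≤ s.ireg 12
  le4 : s.ireg 42 + s.ireg 43 ≤ s.ireg 12
  card : s.ireg 21 + s.ireg 23 = F.mem.card
  card' : s.ireg 41 + s.ireg 43 = F.mem.card
  sorted1 : (slice (s.rmem 4) (s.ireg 20) (s.ireg 21)).Pairwise (· ≥ ·)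
  sorted2 : (slice (s.rmem 4) (s.ireg 22) (s.ireg 23)).Pairwise (· ≥ ·)
  sorted3 : (slice (s.rmem 4) (s.ireg 40) (s.ireg 41)).Pairwise (· ≥ ·)
  sorted4 : (slice (s.rmem 4) (s.ireg 42) (s.ireg 43)).Pairwise (· ≥ ·)
  top_perm : (slice (s.rmem 4) (s.ireg 20) (s.ireg 21) ++
    (slice (s.rmem 4) (s.ireg 22) (s.ireg 23)).map fun a => min (s.rreg 10) (a - s.rreg 11)).Perm
      (F.fromTop par len r)
  bot_perm : (slice (s.rmem 4) (s.ireg 40) (s.ireg 41) ++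
    (slice (s.rmem 4) (s.ireg 42) (s.ireg 43)).map fun a => min (s.rreg 13) (a - s.rreg 14)).Perm
      (F.fromBot par len r)
  length : s.rreg 15 = F.length len
  capUp : s.rreg 16 = F.capUp par len r
  capDown : s.rreg 17 = F.capDown par len r

/-- `mergeLists` has fixed parameter registers; the second pair of lists is moved there, and its
result is placed directly behind the first one. -/
def joinCopy : Prog :=
  .setIReg 20 (.reg 40) ;; .setIReg 21 (.reg 41) ;; .setIReg 22 (.reg 42) ;;
  .setIReg 23 (.reg 43) ;; .setIReg 24 (.add (.reg 12) (.add (.reg 21) (.reg 23))) ;;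
  .setRReg 10 (.reg 13) ;; .setRReg 11 (.reg 14)

def joinNode : Prog :=
  .setIReg 46 (.add (.reg 21) (.reg 23)) ;;
  .setIMem 11 (.reg 11) (.reg 46) ;; .setIMem 12 (.reg 11) (.reg 12) ;;
  .setIMem 13 (.reg 11) (.add (.reg 12) (.reg 46)) ;;
  .setRMem 5 (.reg 11) (.reg 15) ;; .setRMem 6 (.reg 11) (.reg 16) ;;
  .setRMem 7 (.reg 11) (.reg 17) ;;
  .setIMem 14 (.reg 30) (.reg 11) ;; .setIMem 14 (.reg 31) (.reg 11) ;;
  .setIMem 16 (.reg 30) (.reg 31) ;; .setIMem 16 (.reg 31) (.reg 30) ;;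
  .setIMem 15 (.reg 30) (.reg 44) ;; .setIMem 15 (.reg 31) (.reg 45) ;;
  .setIMem 6 (.reg 32) (.reg 11) ;; .setIReg 11 (.add (.reg 11) (.lit 1)) ;;
  .setIReg 12 (.add (.reg 12) (.add (.reg 46) (.reg 46)))

/-- Make a new node from the clusters in registers `30, 31`. -/
def joinCore : Prog :=
  .setIReg 24 (.reg 12) ;; mergeLists ;; joinCopy ;; mergeLists ;; joinNode

/-- The effect of `joinCore`. -/
structure Joined (par : ℕ → ℕ) (len r : ℕ → ℝ) (F : Cluster) (ca cb y ka kb : ℕ)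
    (s s' : State) : Prop where
  count : s'.ireg 11 = s.ireg 11 + 1
  storage : s'.ireg 12 = s.ireg 12 + 2 * F.mem.card
  id : s'.imem 6 = Function.update (s.imem 6) y (s.ireg 11)
  size : s'.imem 11 = Function.update (s.imem 11) (s.ireg 11) F.mem.card
  top_off : s'.imem 12 = Function.update (s.imem 12) (s.ireg 11) (s.ireg 12)
  bot_off : s'.imem 13 = Function.update (s.imem 13) (s.ireg 11) (s.ireg 12 + F.mem.card)
  parent : s'.imem 14 =
    Function.update (Function.update (s.imem 14) ca (s.ireg 11)) cb (s.ireg 11)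
  kind : s'.imem 15 = Function.update (Function.update (s.imem 15) ca ka) cb kb
  sibling : s'.imem 16 = Function.update (Function.update (s.imem 16) ca cb) cb ca
  length : s'.rmem 5 = Function.update (s.rmem 5) (s.ireg 11) (F.length len)
  capUp : s'.rmem 6 = Function.update (s.rmem 6) (s.ireg 11) (F.capUp par len r)
  capDown : s'.rmem 7 = Function.update (s.rmem 7) (s.ireg 11) (F.capDown par len r)
  lists : ∀ i < s.ireg 12, s'.rmem 4 i = s.rmem 4 i
  top_sorted : (slice (s'.rmem 4) (s.ireg 12) F.mem.card).Pairwise (· ≥ ·)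
  top_perm : (slice (s'.rmem 4) (s.ireg 12) F.mem.card).Perm (F.fromTop par len r)
  bot_sorted : (slice (s'.rmem 4) (s.ireg 12 + F.mem.card) F.mem.card).Pairwise (· ≥ ·)
  bot_perm : (slice (s'.rmem 4) (s.ireg 12 + F.mem.card) F.mem.card).Perm (F.fromBot par len r)

/-- The map is monotone, so thresholds seen through another cluster need not be sorted again. -/
theorem pairwise_map_min {L : List ℝ} (h : L.Pairwise (· ≥ ·)) (c l : ℝ) :
    (L.map fun a => min c (a - l)).Pairwise (· ≥ ·) :=
  h.map _ fun _ _ hab => min_le_min_left c (sub_le_sub_right hab l)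

/-- Each of the two merges takes at most ten steps per member, up to a constant. As the cluster is
not empty, all constants are absorbed into the factor `60`. -/
theorem joinCore_runs {b : ℕ} {par : ℕ → ℕ} {len r : ℕ → ℝ} {F : Cluster} {ca cb y ka kb : ℕ}
    {s : State} (hs : JoinArgs par len r F ca cb y ka kb s) (hF : 1 ≤ F.mem.card)
    (hb : s.ireg 12 + 2 * F.mem.card < 2 ^ b) (hb' : s.ireg 11 + ca + cb + ka + kb + 1 < 2 ^ b) :
    Runs b joinCore s fun t s' => t ≤ 60 * F.mem.card ∧
      Joined par len r F ca cb y ka kb s s' := by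
  obtain ⟨h30, h31, h32, h44, h45, l1, l2, l3, l4, hc, hc', s1, s2, s3, s4, tp, bp, hL, hU, hD⟩ := hs
  generalize hP : s.ireg 12 = P at *
  generalize hN : s.ireg 11 = N at *
  generalize hm : F.mem.card = m at *
  unfold joinCore
  refine Runs.wp_seq ?_
  simp only [wp, IExp.eval, hP]
  refine ⟨by omega, Runs.seq ((mergeLists_runs (b := b) (s := s.writeIReg 24 P)
    ⟨by simp, by simp, by simp, by simp, by simp, rfl, rfl⟩ l1 l2
    (by omega)).mono_frame ?_)⟩
  rintro t1 u1 ⟨ht1, hslice1, hfr1⟩ F1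
  have i1 : ∀ x, x ∉ mergeLists.iregs → x ≠ 24 → u1.ireg x = s.ireg x := by
    intro x hx hne
    rw [F1.ireg x hx, State.writeIReg_ireg, if_neg hne]
  have q1 : ∀ x, x ∉ mergeLists.rregs → u1.rreg x = s.rreg x := fun x hx => F1.rreg x hx
  have e40 := i1 40 (by decide) (by decide)
  have e41 := i1 41 (by decide) (by decide)
  have e42 := i1 42 (by decide) (by decide)
  have e43 := i1 43 (by decide) (by decide)
  have e12 := (i1 12 (by decide) (by decide)).trans hP
  have e11 := (i1 11 (by decide) (by decide)).trans hN
  have e30 := (i1 30 (by decide) (by decide)).trans h30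
  have e31 := (i1 31 (by decide) (by decide)).trans h31
  have e32 := (i1 32 (by decide) (by decide)).trans h32
  have e44 := (i1 44 (by decide) (by decide)).trans h44
  have e45 := (i1 45 (by decide) (by decide)).trans h45
  have f13 := q1 13 (by decide)
  have f14 := q1 14 (by decide)
  have f15 := (q1 15 (by decide)).trans hL
  have f16 := (q1 16 (by decide)).trans hU
  have f17 := (q1 17 (by decide)).trans hD
  have k : ∀ a, u1.imem a = s.imem a := fun a => F1.imem a (by simp [mergeLists, mergeStep, Prog.imems])
  have k5 : u1.rmem 5 = s.rmem 5 := F1.rmem 5 (by decide)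
  have k6 : u1.rmem 6 = s.rmem 6 := F1.rmem 6 (by decide)
  have k7 : u1.rmem 7 = s.rmem 7 := F1.rmem 7 (by decide)
  refine Runs.wp_seq ?_
  simp only [joinCopy, wp, IExp.eval, RExp.eval, State.writeIReg_ireg, if_true, if_false,
    Nat.reduceEqDiff, e40, e41, e42, e43, e12]
  refine ⟨by omega, by omega, by omega, by omega, by omega, ?_⟩
  obtain ⟨u2, hu2⟩ : ∃ u2, u2 = ((((((u1.writeIReg 20 (s.ireg 40)).writeIReg 21
    (s.ireg 41)).writeIReg 22 (s.ireg 42)).writeIReg 23 (s.ireg 43)).writeIReg 24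
    (P + (s.ireg 41 + s.ireg 43))).writeRReg 10 (s.rreg 13)).writeRReg 11 (s.rreg 14) := ⟨_, rfl⟩
  simp only [State.writeIReg_rreg, State.writeRReg_rreg, f13, f14, Nat.reduceEqDiff, if_false]
  rw [← hu2]
  have hA2 : MergeArgs (s.ireg 40) (s.ireg 41) (s.ireg 42) (s.ireg 43) (P + m) (s.rreg 13)
      (s.rreg 14) u2 := by
    subst hu2
    constructor <;> simp [hc']
  refine Runs.seq ((mergeLists_runs hA2 (by omega) (by omega) (by omega)).mono_frame ?_)
  rintro t2 u3 ⟨ht2, hslice2, hfr2⟩ F2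
  have j1 : ∀ x, x ∉ mergeLists.iregs → x ≠ 24 → x ≠ 23 → x ≠ 22 → x ≠ 21 → x ≠ 20 →
      u3.ireg x = u1.ireg x := by
    intro x hx h4 h3 h2 h1 h0
    rw [F2.ireg x hx, hu2]
    simp [h4, h3, h2, h1, h0]
  have jr : ∀ x, x ∉ mergeLists.rregs → x ≠ 10 → x ≠ 11 → u3.rreg x = u1.rreg x := by
    intro x hx h0 h1
    rw [F2.rreg x hx, hu2]
    simp [h0, h1]
  have g12 := (j1 12 (by decide) (by decide) (by decide) (by decide) (by decide) (by decide)).trans e12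
  have g11 := (j1 11 (by decide) (by decide) (by decide) (by decide) (by decide) (by decide)).trans e11
  have g30 := (j1 30 (by decide) (by decide) (by decide) (by decide) (by decide) (by decide)).trans e30
  have g31 := (j1 31 (by decide) (by decide) (by decide) (by decide) (by decide) (by decide)).trans e31
  have g32 := (j1 32 (by decide) (by decide) (by decide) (by decide) (by decide) (by decide)).trans e32
  have g44 := (j1 44 (by decide) (by decide) (by decide) (by decide) (by decide) (by decide)).trans e44
  have g45 := (j1 45 (by decide) (by decide) (by decide) (by decide) (by decide) (by decide)).trans e45
  have g21 : u3.ireg 21 = s.ireg 41 := (F2.ireg 21 (by decide)).trans (by simp [hu2])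
  have g23 : u3.ireg 23 = s.ireg 43 := (F2.ireg 23 (by decide)).trans (by simp [hu2])
  have g15 := (jr 15 (by decide) (by decide) (by decide)).trans f15
  have g16 := (jr 16 (by decide) (by decide) (by decide)).trans f16
  have g17 := (jr 17 (by decide) (by decide) (by decide)).trans f17
  have k' : ∀ a, u3.imem a = s.imem a := fun a =>
    (F2.imem a (by simp [mergeLists, mergeStep, Prog.imems])).trans (by simp [hu2, k])
  have k5' : u3.rmem 5 = s.rmem 5 := (F2.rmem 5 (by decide)).trans (by simp [hu2, k5])
  have k6' : u3.rmem 6 = s.rmem 6 := (F2.rmem 6 (by decide)).trans (by simp [hu2, k6])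
  have k7' : u3.rmem 7 = s.rmem 7 := (F2.rmem 7 (by decide)).trans (by simp [hu2, k7])
  have hu24 : u2.rmem 4 = u1.rmem 4 := by simp [hu2]
  rw [hu24] at hslice2 hfr2
  have hm4 : ∀ i < P, u3.rmem 4 i = s.rmem 4 i := fun i hi =>
    (hfr2 i (by omega)).trans (hfr1 i hi)
  simp only [State.writeIReg_ireg, Nat.reduceEqDiff, if_false, State.writeIReg_rmem,
    State.writeIReg_rreg, hc] at hslice1
  rw [hc', slice_congr (o := s.ireg 40) (g := s.rmem 4) (fun i hi => hfr1 _ (by omega)),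
    slice_congr (o := s.ireg 42) (g := s.rmem 4) (fun i hi => hfr1 _ (by omega))] at hslice2
  have hsl1 : slice (u3.rmem 4) P m = slice (u1.rmem 4) P m :=
    slice_congr fun i hi => hfr2 _ (by omega)
  rw [← hsl1] at hslice1
  refine (Runs.of_wp (Q := fun s' => s'.rmem 4 = u3.rmem 4 ∧
      s'.ireg 11 = N + 1 ∧ s'.ireg 12 = P + 2 * m ∧
      s'.imem 6 = Function.update (s.imem 6) y N ∧
      s'.imem 11 = Function.update (s.imem 11) N m ∧
      s'.imem 12 = Function.update (s.imem 12) N P ∧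
      s'.imem 13 = Function.update (s.imem 13) N (P + m) ∧
      s'.imem 14 = Function.update (Function.update (s.imem 14) ca N) cb N ∧
      s'.imem 15 = Function.update (Function.update (s.imem 15) ca ka) cb kb ∧
      s'.imem 16 = Function.update (Function.update (s.imem 16) ca cb) cb ca ∧
      s'.rmem 5 = Function.update (s.rmem 5) N (F.length len) ∧
      s'.rmem 6 = Function.update (s.rmem 6) N (F.capUp par len r) ∧
      s'.rmem 7 = Function.update (s.rmem 7) N (F.capDown par len r)) ?_).mono ?_
  · simp only [joinNode, wp, IExp.eval, RExp.eval, State.writeIReg_ireg, State.writeIMem_ireg,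
      State.writeRMem_ireg, State.writeIReg_rreg, State.writeIMem_rreg, State.writeRMem_rreg,
      State.writeIMem_imem, State.writeRMem_imem, State.writeIReg_imem, State.writeRMem_rmem,
      State.writeIMem_rmem, State.writeIReg_rmem, if_true, if_false, Nat.reduceEqDiff, g12, g11,
      g30, g31, g32, g44, g45, g21, g23, g15, g16, g17, k', k5', k6', k7', hc', true_and, and_true]
    refine ⟨by omega, by omega, by omega, by omega, by omega, by omega, by omega, by omega,
      by omega, by omega, by omega, by omega, by omega, by omega⟩
  · rintro t3 s' ⟨ht3, w4, w11, w12, v6, v11, v12, v13, v14, v15, v16, v5, v6', v7⟩ t4 ht4 t5 ht5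
    have c3 : joinNode.cost = 16 := rfl
    have c4 : joinCopy.cost = 7 := rfl
    simp only [Prog.cost, c3, c4] at ht3 ht4 ht5
    simp only [State.writeIReg_ireg, Nat.reduceEqDiff, if_false, hc] at ht1
    subst hN hP hm
    refine ⟨by omega, w11, w12, v6, v11, v12, v13, v14, v15, v16, v5, v6', v7, ?_, ?_, ?_, ?_, ?_⟩
    · rw [w4]; exact hm4
    · rw [w4, hslice1]; exact mergeDesc_sorted s1 (pairwise_map_min s2 _ _)
    · rw [w4, hslice1]; exact (mergeDesc_perm _ _).trans tp
    · rw [w4, hslice2]; exact mergeDesc_sorted s3 (pairwise_map_min s4 _ _)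
    · rw [w4, hslice2]; exact (mergeDesc_perm _ _).trans bp

end RealRAM

/-! ### Joining two clusters of the forest -/

namespace RealRAM

open Cluster

section

variable {n b : ℕ} {par : ℕ → ℕ} {len r : ℕ → ℝ} {s s' : State} {e : ℕ → Cluster} {A : Finset ℕ}
  {up : ℕ → ℕ} {E : ℕ → Cluster}

/-- The new cluster has bottom `y`, which stays present, while `x` disappears. Its node gets the
first free number, so what refers to older nodes remains valid, and only `ca` and `cb` receive new
links. -/
theorem IsForest.join (h : IsForest n par len r s e A up E) {x y : ℕ} (hx : x ∈ A) (hy : y ∈ A)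
    (hxy : x ≠ y) {F : Cluster} {ca cb ka kb : ℕ}
    (hc : ca = s.imem 6 x ∧ cb = s.imem 6 y ∨ ca = s.imem 6 y ∧ cb = s.imem 6 x)
    (hF : F = .rake (e ca) (e cb) ∧ ka = 1 ∧ kb = 2 ∨ F = .comp (e ca) (e cb) ∧ ka = 3 ∧ kb = 4)
    (hwf : F.WF par n) (hbot : F.bot = y) (hj : Joined par len r F ca cb y ka kb s s') :
    IsForest n par len r s' (Function.update e (s.ireg 11) F) (A.erase x)
      (Function.update up y (F.top par)) (Function.update E y F) := by
  have hEx := h.cluster x hx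
  have hEy := h.cluster y hy
  have hix := h.id_lt x hx
  have hiy := h.id_lt y hy
  have hmem : F.mem = (E x).mem ∪ (E y).mem := by
    rcases hF with ⟨rfl, -⟩ | ⟨rfl, -⟩ <;> rcases hc with ⟨rfl, rfl⟩ | ⟨rfl, rfl⟩ <;>
      simp only [mem, hEx, hEy]
    all_goals exact Finset.union_comm _ _
  have hdisj := h.disjoint x hx y hy hxy
  have hcard : F.mem.card = (E x).mem.card + (E y).mem.card := by
    rw [hmem, Finset.card_union_of_disjoint hdisj]
  have htot : F.total = (E x).total + (E y).total + F.mem.card := by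
    rw [hcard]
    rcases hF with ⟨rfl, -⟩ | ⟨rfl, -⟩ <;> rcases hc with ⟨rfl, rfl⟩ | ⟨rfl, rfl⟩ <;>
      simp only [total, hEx, hEy] <;> omega
  have hcab : ca < s.ireg 11 ∧ cb < s.ireg 11 := by
    rcases hc with ⟨rfl, rfl⟩ | ⟨rfl, rfl⟩ <;> exact ⟨by assumption, by assumption⟩
  -- Equal identifiers would mean equal clusters, but their bottoms `x` and `y` differ.
  have hidne : s.imem 6 x ≠ s.imem 6 y := by
    intro heq
    rw [heq, hEy] at hEx
    exact hxy (by rw [← h.bot_eq x hx, ← hEx, h.bot_eq y hy])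
  have hne : ca ≠ cb := by
    rcases hc with ⟨rfl, rfl⟩ | ⟨rfl, rfl⟩
    · exact hidne
    · exact hidne.symm
  have hk : ka ≠ 0 ∧ kb ≠ 0 := by omega
  have hyA : y ∈ A.erase x := Finset.mem_erase.2 ⟨hxy.symm, hy⟩
  have hkind : ∀ i, i ≠ ca → i ≠ cb → s'.imem 15 i = s.imem 15 i := by
    intro i h1 h2
    rw [hj.kind, Function.update_of_ne h2, Function.update_of_ne h1]
  have hold : ∀ v ∈ A.erase x, v ≠ y → v ∈ A ∧ s'.imem 6 v = s.imem 6 v := by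
    intro v hv hvy
    exact ⟨Finset.mem_of_mem_erase hv, by rw [hj.id, Function.update_of_ne hvy]⟩
  have hA := h.subset
  have hAcard : A.card ≤ n := (Finset.card_le_card h.subset).trans (by simp)
  have hApos := Finset.card_pos.2 ⟨x, hx⟩
  have hcnt := h.count
  have hNn : n ≤ s.ireg 11 := by omega
  refine ⟨(Finset.erase_subset _ _).trans hA, ?_, ?_, ?_, ?_, ?_, ?_, ?_, ?_, ?_, ?_, ?_, ?_, ?_, ?_⟩
  · rw [hj.count, Finset.card_erase_of_mem hx]
    omega
  -- The totals of `x` and `y` are replaced by that of `F`, which is larger than their sum by the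
  -- size of `F`; the storage grows by two lists of this size.
  · have h1 := Finset.add_sum_erase A (fun v => (E v).total) hx
    have h2 := Finset.add_sum_erase (A.erase x) (fun v => (E v).total) hyA
    have h3 := Finset.add_sum_erase (A.erase x) (fun v => (Function.update E y F v).total) hyA
    have h4 : ∑ v ∈ (A.erase x).erase y, (Function.update E y F v).total =
        ∑ v ∈ (A.erase x).erase y, (E v).total :=
      Finset.sum_congr rfl fun v hv => by rw [Function.update_of_ne (Finset.ne_of_mem_erase hv)]
    have h5 := h.storage
    simp only [Function.update_self] at h3
    rw [hj.storage]
    omega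
  · intro i hi
    rw [hj.count] at hi
    by_cases hiN : i = s.ireg 11
    · subst hiN
      rw [Function.update_self]
      have e12 : s'.imem 12 (s.ireg 11) = s.ireg 12 := by rw [hj.top_off, Function.update_self]
      have e13 : s'.imem 13 (s.ireg 11) = s.ireg 12 + F.mem.card := by
        rw [hj.bot_off, Function.update_self]
      refine ⟨by rw [hj.size, Function.update_self], ?_, ?_, ?_, ?_, ?_, ?_, ?_, ?_, ?_⟩
      · rw [e12, hj.storage]; omega
      · rw [e13, hj.storage]; omega
      · rw [e12]; exact hj.top_sorted
      · rw [e12]; exact hj.top_perm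
      · rw [e13]; exact hj.bot_sorted
      · rw [e13]; exact hj.bot_perm
      · rw [hj.length, Function.update_self]
      · rw [hj.capUp, Function.update_self]
      · rw [hj.capDown, Function.update_self]
    · rw [Function.update_of_ne hiN]
      refine (h.node i (by omega)).congr (by rw [hj.storage]; omega) ?_ ?_ ?_ hj.lists ?_ ?_ ?_
      · rw [hj.size, Function.update_of_ne hiN]
      · rw [hj.top_off, Function.update_of_ne hiN]
      · rw [hj.bot_off, Function.update_of_ne hiN]
      · rw [hj.length, Function.update_of_ne hiN]
      · rw [hj.capUp, Function.update_of_ne hiN]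
      · rw [hj.capDown, Function.update_of_ne hiN]
  · intro i hi
    rw [hj.count] at hi
    by_cases hiN : i = s.ireg 11
    · rw [hiN, Function.update_self]; exact hwf
    · rw [Function.update_of_ne hiN]; exact h.wf i (by omega)
  · intro i hi
    rw [hj.count] at hi ⊢
    have eca : Function.update e (s.ireg 11) F ca = e ca := Function.update_of_ne hcab.1.ne _ _
    have ecb : Function.update e (s.ireg 11) F cb = e cb := Function.update_of_ne hcab.2.ne _ _
    by_cases hia : i = ca
    · subst hia
      right
      have e14 : s'.imem 14 i = s.ireg 11 := by
        rw [hj.parent, Function.update_of_ne hne, Function.update_self]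
      have e16 : s'.imem 16 i = cb := by
        rw [hj.sibling, Function.update_of_ne hne, Function.update_self]
      have e15 : s'.imem 15 i = ka := by
        rw [hj.kind, Function.update_of_ne hne, Function.update_self]
      rw [e14, e16, e15, Function.update_self, eca, ecb]
      refine ⟨by omega, by omega, ?_⟩
      rcases hF with ⟨rfl, rfl, -⟩ | ⟨rfl, rfl, -⟩
      · exact .inl ⟨rfl, rfl⟩
      · exact .inr (.inr (.inl ⟨rfl, rfl⟩))
    · by_cases hib : i = cb
      · subst hib
        right
        have e14 : s'.imem 14 i = s.ireg 11 := by rw [hj.parent, Function.update_self]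
        have e16 : s'.imem 16 i = ca := by rw [hj.sibling, Function.update_self]
        have e15 : s'.imem 15 i = kb := by rw [hj.kind, Function.update_self]
        rw [e14, e16, e15, Function.update_self, eca, ecb]
        refine ⟨by omega, by omega, ?_⟩
        rcases hF with ⟨rfl, -, rfl⟩ | ⟨rfl, -, rfl⟩
        · exact .inr (.inl ⟨rfl, rfl⟩)
        · exact .inr (.inr (.inr ⟨rfl, rfl⟩))
      · have e14 : s'.imem 14 i = s.imem 14 i := by
          rw [hj.parent, Function.update_of_ne hib, Function.update_of_ne hia]
        have e16 : s'.imem 16 i = s.imem 16 i := by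
          rw [hj.sibling, Function.update_of_ne hib, Function.update_of_ne hia]
        unfold Linked
        rw [e14, e16, hkind i hia hib]
        by_cases hiN : i = s.ireg 11
        · exact .inl (h.kind_zero i hiN.ge)
        · rcases h.linked i (by omega) with h0 | ⟨h1, h2, h3⟩
          · exact .inl h0
          · right
            rw [Function.update_of_ne h1.ne, Function.update_of_ne h2.ne,
              Function.update_of_ne hiN]
            exact ⟨by omega, by omega, h3⟩
  · intro i hi
    rw [hj.count] at hi
    rw [hkind i (by omega) (by omega)]
    exact h.kind_zero i (by omega)
  · intro i hi h0
    rw [hj.count] at hi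
    have hia : i ≠ ca := by
      rintro rfl
      rw [hj.kind, Function.update_of_ne hne, Function.update_self] at h0
      exact hk.1 h0
    have hib : i ≠ cb := by
      rintro rfl
      rw [hj.kind, Function.update_self] at h0
      exact hk.2 h0
    by_cases hiN : i = s.ireg 11
    · exact ⟨y, hyA, by rw [hj.id, Function.update_self, hiN]⟩
    · rw [hkind i hia hib] at h0
      obtain ⟨v, hv, hvi⟩ := h.root i (by omega) h0
      have hvx : v ≠ x := by
        rintro rfl
        rcases hc with ⟨rfl, rfl⟩ | ⟨rfl, rfl⟩
        · exact hia hvi.symm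
        · exact hib hvi.symm
      have hvy : v ≠ y := by
        rintro rfl
        rcases hc with ⟨rfl, rfl⟩ | ⟨rfl, rfl⟩
        · exact hib hvi.symm
        · exact hia hvi.symm
      have hv' := Finset.mem_erase.2 ⟨hvx, hv⟩
      exact ⟨v, hv', by rw [(hold v hv' hvy).2, hvi]⟩
  · intro v hv
    rw [hj.count]
    by_cases hvy : v = y
    · subst hvy
      rw [hj.id, Function.update_self]
      omega
    · obtain ⟨h1, h2⟩ := hold v hv hvy
      rw [h2]
      have := h.id_lt v h1
      omega
  · intro v hv
    by_cases hvy : v = y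
    · subst hvy
      rw [hj.id, Function.update_self, Function.update_self, Function.update_self]
    · obtain ⟨h1, h2⟩ := hold v hv hvy
      rw [h2, Function.update_of_ne hvy, Function.update_of_ne (h.id_lt v h1).ne]
      exact h.cluster v h1
  · intro v hv
    by_cases hvy : v = y
    · subst hvy
      rw [Function.update_self, hbot]
    · rw [Function.update_of_ne hvy]
      exact h.bot_eq v (hold v hv hvy).1
  · intro v hv
    by_cases hvy : v = y
    · subst hvy
      rw [Function.update_self, Function.update_self]
    · rw [Function.update_of_ne hvy, Function.update_of_ne hvy]
      exact h.top_eq v (hold v hv hvy).1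
  · have key : ∀ v ∈ A.erase x, v ≠ y → Disjoint F.mem (E v).mem := by
      intro v hv hvy
      have h1 := (hold v hv hvy).1
      rw [hmem, Finset.disjoint_union_left]
      exact ⟨h.disjoint x hx v h1 (Finset.ne_of_mem_erase hv).symm, h.disjoint y hy v h1 (Ne.symm hvy)⟩
    intro v hv w hw hvw
    by_cases hvy : v = y
    · subst hvy
      rw [Function.update_self, Function.update_of_ne hvw.symm]
      exact key w hw hvw.symm
    · by_cases hwy : w = y
      · subst hwy
        rw [Function.update_self, Function.update_of_ne hvy]
        exact (key v hv hvy).symm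
      · rw [Function.update_of_ne hvy, Function.update_of_ne hwy]
        exact h.disjoint v (hold v hv hvy).1 w (hold w hw hwy).1 hvw
  · intro z hz
    obtain ⟨v, hv, hzv⟩ := h.cover z hz
    by_cases hvxy : v = x ∨ v = y
    · refine ⟨y, hyA, ?_⟩
      rw [Function.update_self, hmem, Finset.mem_union]
      rcases hvxy with rfl | rfl
      · exact .inl hzv
      · exact .inr hzv
    · push Not at hvxy
      exact ⟨v, Finset.mem_erase.2 ⟨hvxy.1, hv⟩, by rwa [Function.update_of_ne hvxy.2]⟩
  · intro j hjn
    rw [Function.update_of_ne (by omega)]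
    exact h.base j hjn

end

/-- Prepare `joinCore` for raking the cluster in register `30` into the cluster in register `31`,
whose common top is in register `34`. -/
def rakeArgs : Prog :=
  .setIReg 20 (.mem 12 (.reg 30)) ;; .setIReg 21 (.mem 11 (.reg 30)) ;;
  .setIReg 22 (.mem 12 (.reg 31)) ;; .setIReg 23 (.mem 11 (.reg 31)) ;;
  .setRReg 10 (.mem 3 (.reg 34)) ;; .setRReg 11 (.lit 0) ;;
  .setIReg 40 (.mem 13 (.reg 31)) ;; .setIReg 41 (.mem 11 (.reg 31)) ;;
  .setIReg 42 (.mem 12 (.reg 30)) ;; .setIReg 43 (.mem 11 (.reg 30)) ;;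
  .setRReg 13 (.mem 6 (.reg 31)) ;; .setRReg 14 (.mem 5 (.reg 31)) ;;
  .setRReg 15 (.mem 5 (.reg 31)) ;; .setRReg 16 (.mem 6 (.reg 31)) ;;
  .setRReg 17 (.mem 7 (.reg 31)) ;; .setIReg 44 (.lit 1) ;; .setIReg 45 (.lit 2)

/-- Prepare `joinCore` for joining the cluster in register `30` to the one above it in register
`31`. -/
def compArgs : Prog :=
  .setIReg 20 (.mem 12 (.reg 31)) ;; .setIReg 21 (.mem 11 (.reg 31)) ;;
  .setIReg 22 (.mem 12 (.reg 30)) ;; .setIReg 23 (.mem 11 (.reg 30)) ;;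
  .setRReg 10 (.mem 7 (.reg 31)) ;; .setRReg 11 (.mem 5 (.reg 31)) ;;
  .setIReg 40 (.mem 13 (.reg 30)) ;; .setIReg 41 (.mem 11 (.reg 30)) ;;
  .setIReg 42 (.mem 13 (.reg 31)) ;; .setIReg 43 (.mem 11 (.reg 31)) ;;
  .setRReg 13 (.mem 6 (.reg 30)) ;; .setRReg 14 (.mem 5 (.reg 30)) ;;
  .setRReg 15 (.add (.mem 5 (.reg 30)) (.mem 5 (.reg 31))) ;;
  .setRReg 16 (.sub (.mem 6 (.reg 31)) (.mem 5 (.reg 30))) ;;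
  .ite (.rlt (.mem 6 (.reg 30)) (.reg 16)) (.setRReg 16 (.mem 6 (.reg 30))) .skip ;;
  .setRReg 17 (.sub (.mem 7 (.reg 30)) (.mem 5 (.reg 31))) ;;
  .ite (.rlt (.mem 7 (.reg 31)) (.reg 17)) (.setRReg 17 (.mem 7 (.reg 31))) .skip ;;
  .setIReg 44 (.lit 3) ;; .setIReg 45 (.lit 4)

/-- The storage bound `50 * (n + 1) ^ 2` leaves room below `64 * (n + 1) ^ 2` for node numbers and
kinds, so every value stored by a join fits into a word. -/
theorem bounds_of_le {n b N P m : ℕ} (hb : 64 * (n + 1) ^ 2 < 2 ^ b) (hN : N ≤ 2 * n)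
    (hP : P + 2 * m ≤ 50 * (n + 1) ^ 2) {ca cb ka kb : ℕ} (hca : ca < N) (hcb : cb < N)
    (hka : ka ≤ 4) (hkb : kb ≤ 4) : P + 2 * m < 2 ^ b ∧ N + ca + cb + ka + kb + 1 < 2 ^ b := by
  constructor
  · nlinarith
  · nlinarith

section

variable {n b : ℕ} {par : ℕ → ℕ} {len r : ℕ → ℝ} {s : State} {e : ℕ → Cluster} {ca cb y p : ℕ}

/-- At the common top both clusters are entered directly, so the shift is `0` and the cap is the
radius of the top. From the bottom, the raked cluster is seen through the other one. -/
theorem rakeArgs_runs (hb : 64 * (n + 1) ^ 2 < 2 ^ b) (hP : s.ireg 12 ≤ 50 * (n + 1) ^ 2)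
    (hA : StoresNode par len r (s.ireg 12) s (e ca) ca)
    (hB : StoresNode par len r (s.ireg 12) s (e cb) cb) (h3 : s.rmem 3 = r)
    (h30 : s.ireg 30 = ca) (h31 : s.ireg 31 = cb) (h32 : s.ireg 32 = y) (h34 : s.ireg 34 = p)
    (hp : (e cb).top par = p) (hwf : (Cluster.rake (e ca) (e cb)).WF par n) :
    Runs b rakeArgs s fun t s' => t ≤ 17 ∧
      JoinArgs par len r (.rake (e ca) (e cb)) ca cb y 1 2 s' := by
  have h1n : 1 ≤ (n + 1) ^ 2 := Nat.one_le_pow _ _ n.succ_pos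
  have hpb : 4 < 2 ^ b ∧ s.ireg 12 < 2 ^ b := by omega
  have a1 := hA.top_le
  have b1 := hB.top_le
  have b2 := hB.bot_le
  have hcard : (Cluster.rake (e ca) (e cb)).mem.card = (e ca).mem.card + (e cb).mem.card := by
    cases hwf with
    | rake _ _ _ hd => rw [mem, Finset.card_union_of_disjoint hd]
  refine (Runs.of_wp (Q := fun s' => JoinArgs par len r (.rake (e ca) (e cb)) ca cb y 1 2 s')
    ?_).mono fun t s' h => ⟨h.1, h.2⟩
  simp only [rakeArgs, wp, IExp.eval, RExp.eval, State.writeIReg_ireg, State.writeRReg_ireg,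
    State.writeIReg_imem, State.writeRReg_imem, State.writeIReg_rmem, State.writeRReg_rmem,
    if_true, if_false, Nat.reduceEqDiff, h30, h31, h34, hA.size, hB.size, h3, hB.length, hB.capUp,
    hB.capDown]
  refine ⟨by omega, by omega, by omega, by omega, by omega, by omega, by omega, by omega,
    by omega, by omega, ?_⟩
  constructor <;> simp only [State.writeIReg_ireg, State.writeRReg_ireg,
    State.writeIReg_imem, State.writeRReg_imem, State.writeIReg_rmem, State.writeRReg_rmem,
    State.writeIReg_rreg, State.writeRReg_rreg,
    if_true, if_false, Nat.reduceEqDiff, h30, h31, h32, hcard]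
  any_goals omega
  · exact hA.top_sorted
  · exact hB.top_sorted
  · exact hB.bot_sorted
  · exact hA.top_sorted
  · rw [fromTop, hp]
    simpa using hA.top_perm.append (hB.top_perm.map _)
  · exact hB.bot_perm.append (hA.top_perm.map _)
  · rfl
  · rfl
  · rfl

/-- Entered at the top, the lower cluster is seen through the upper one, and conversely from the
bottom. The two tests compute the minima in `capUp` and `capDown`. -/
theorem compArgs_runs (hb : 64 * (n + 1) ^ 2 < 2 ^ b) (hP : s.ireg 12 ≤ 50 * (n + 1) ^ 2)
    (hA : StoresNode par len r (s.ireg 12) s (e ca) ca)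
    (hB : StoresNode par len r (s.ireg 12) s (e cb) cb)
    (h30 : s.ireg 30 = ca) (h31 : s.ireg 31 = cb) (h32 : s.ireg 32 = y)
    (hwf : (Cluster.comp (e ca) (e cb)).WF par n) :
    Runs b compArgs s fun t s' => t ≤ 23 ∧
      JoinArgs par len r (.comp (e ca) (e cb)) ca cb y 3 4 s' := by
  have h1n : 1 ≤ (n + 1) ^ 2 := Nat.one_le_pow _ _ n.succ_pos
  have hpb : 4 < 2 ^ b ∧ s.ireg 12 < 2 ^ b := by omega
  have a1 := hA.top_le
  have a2 := hA.bot_le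
  have b1 := hB.top_le
  have b2 := hB.bot_le
  have hcard : (Cluster.comp (e ca) (e cb)).mem.card = (e ca).mem.card + (e cb).mem.card := by
    cases hwf with
    | comp _ _ _ hd => rw [mem, Finset.card_union_of_disjoint hd]
  refine (Runs.of_wp (Q := fun s' => JoinArgs par len r (.comp (e ca) (e cb)) ca cb y 3 4 s')
    ?_).mono fun t s' h => ⟨h.1, h.2⟩
  simp only [compArgs, wp, IExp.eval, RExp.eval, BExp.holds, State.writeIReg_ireg,
    State.writeRReg_ireg, State.writeRReg_rreg,
    State.writeIReg_imem, State.writeRReg_imem, State.writeIReg_rmem, State.writeRReg_rmem,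
    if_true, if_false, Nat.reduceEqDiff, h30, h31, hA.size, hB.size, hB.length, hB.capUp,
    hB.capDown, hA.length, hA.capUp, hA.capDown]
  refine ⟨by omega, by omega, by omega, by omega, by omega, by omega, by omega, by omega,
    fun h1 => ⟨fun h2 => ⟨by omega, by omega, ?_⟩, fun h2 => ⟨by omega, by omega, ?_⟩⟩,
    fun h1 => ⟨fun h2 => ⟨by omega, by omega, ?_⟩, fun h2 => ⟨by omega, by omega, ?_⟩⟩⟩
  all_goals
    constructor <;> simp only [State.writeIReg_ireg, State.writeRReg_ireg,
      State.writeIReg_imem, State.writeRReg_imem, State.writeIReg_rmem, State.writeRReg_rmem,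
      State.writeIReg_rreg, State.writeRReg_rreg,
      if_true, if_false, Nat.reduceEqDiff, h30, h31, h32, hcard]
    any_goals omega
    · exact hB.top_sorted
    · exact hA.top_sorted
    · exact hA.bot_sorted
    · exact hB.bot_sorted
    · exact hB.top_perm.append (hA.top_perm.map _)
    · exact hA.bot_perm.append (hB.bot_perm.map _)
    · rfl
    · rw [capUp]
      first
        | exact (min_eq_left h1.le).symm
        | exact (min_eq_right (not_lt.1 h1)).symm
    · rw [capDown]
      first
        | exact (min_eq_left h2.le).symm
        | exact (min_eq_right (not_lt.1 h2)).symm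

end

end RealRAM

/-! ## One round of contractions -/

/-- The number of children of `p` among the vertices in `A`. -/
def childCount (A : Finset ℕ) (up : ℕ → ℕ) (p : ℕ) : ℕ := (A.filter fun v => up v = p).card

/-- The state of a round after the vertices below `i` have been scanned.  `A` is the set of the
present vertices, `M ⊆ A` the set of those whose cluster was made in this round, and `pend p` is `0`
or one more than a child of `p` that waits for a partner. -/
structure Scan (n i ρ m : ℕ) (A M : Finset ℕ) (up nch pend : ℕ → ℕ) (E : ℕ → Cluster) :
    Prop where
  subset : A ⊆ Finset.range n
  lt_up : ∀ v ∈ A, v < up v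
  up_mem : ∀ v ∈ A, up v ∈ A ∨ up v = n
  root_unique : ∀ v ∈ A, ∀ w ∈ A, up v = n → up w = n → v = w
  nch_eq : ∀ p, p ∈ A ∨ p = n → nch p = childCount A up p
  pend_mem : ∀ p, p ∈ A ∨ p = n → pend p ≠ 0 →
    pend p - 1 ∈ A ∧ pend p - 1 ∉ M ∧ up (pend p - 1) = p ∧ pend p - 1 < i
  made_subset : M ⊆ A
  made_lt : ∀ v ∈ M, v < i
  leaf : ∀ v ∈ A, v ∉ M → v < i → nch v = 0 → pend (up v) = v + 1
  other : ∀ v ∈ A, v ∉ M → v < i → pend (up v) ≠ v + 1 →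
    (pend (up v) ≠ 0 ∧ nch (pend (up v) - 1) ≠ 0) ∨ ∃ y ∈ M, up y = up v
  unary : ∀ p ∈ A, p < i → nch p = 1 → pend p = 0
  depth_le : ∀ v ∈ A, (E v).depth ≤ ρ + 1
  depth_fresh : ∀ v ∈ A, v ∉ M → (E v).depth ≤ ρ
  card : A.card + M.card = m

namespace Scan

variable {n i ρ m : ℕ} {A M : Finset ℕ} {up nch pend : ℕ → ℕ} {E : ℕ → Cluster}

theorem skip (h : Scan n i ρ m A M up nch pend E) (hi : i ∉ A) :
    Scan n (i + 1) ρ m A M up nch pend E := by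
  have hlt : ∀ v ∈ A, v < i + 1 → v < i := by
    intro v hv hvi
    have : v ≠ i := fun h => hi (h ▸ hv)
    omega
  refine ⟨h.subset, h.lt_up, h.up_mem, h.root_unique, h.nch_eq, ?_, h.made_subset, ?_, ?_, ?_, ?_,
    h.depth_le, h.depth_fresh, h.card⟩
  · intro p hp h0
    obtain ⟨a, b, c, d⟩ := h.pend_mem p hp h0
    exact ⟨a, b, c, by omega⟩
  · intro v hv
    have := h.made_lt v hv
    omega
  · exact fun v hv hm hvi => h.leaf v hv hm (hlt v hv hvi)
  · exact fun v hv hm hvi => h.other v hv hm (hlt v hv hvi)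
  · exact fun v hv hvi => h.unary v hv (hlt v hv hvi)

theorem notMem_made (h : Scan n i ρ m A M up nch pend E) : i ∉ M := fun hi =>
  lt_irrefl _ (h.made_lt i hi)

/-- The scanned vertex `i` disappears and its only child `u` inherits the parent of `i`, so the
child counts of the remaining vertices do not change. Both clusters are from before this round,
hence the depth grows by at most one. -/
theorem compress (h : Scan n i ρ m A M up nch pend E) (hi : i ∈ A) (hn : nch i = 1)
    (hp : pend i ≠ 0) {F : Cluster} (hF : F.depth ≤ max (E (pend i - 1)).depth (E i).depth + 1) :
    Scan n (i + 1) ρ m (A.erase i) (insert (pend i - 1) M) (Function.update up (pend i - 1) (up i))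
      nch pend (Function.update E (pend i - 1) F) := by
  obtain ⟨huA, huM, hup, hui⟩ := h.pend_mem i (.inl hi) hp
  generalize hu : pend i - 1 = u at *
  have hiM := h.notMem_made
  have hin := h.subset hi
  rw [Finset.mem_range] at hin
  have hilt := h.lt_up i hi
  have huniq : ∀ v ∈ A, up v = i → v = u := by
    intro v hv hvi
    have h1 := h.nch_eq i (.inl hi)
    rw [hn] at h1
    obtain ⟨z, hz⟩ := Finset.card_eq_one.1 h1.symm
    have h2 : v ∈ A.filter fun v => up v = i := Finset.mem_filter.2 ⟨hv, hvi⟩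
    have h3 : u ∈ A.filter fun v => up v = i := Finset.mem_filter.2 ⟨huA, hup⟩
    rw [hz, Finset.mem_singleton] at h2 h3
    omega
  have hold : ∀ v, v ≠ u → Function.update up u (up i) v = up v :=
    fun v hv => Function.update_of_ne hv _ _
  have hupM : ∀ v ∈ A, v ≠ u → v ≠ i → up v ≠ i := fun v hv hvu _ h => hvu (huniq v hv h)
  refine ⟨(Finset.erase_subset _ _).trans h.subset, ?_, ?_, ?_, ?_, ?_, ?_, ?_, ?_, ?_, ?_, ?_, ?_,
    ?_⟩
  · intro v hv
    obtain ⟨hvi, hvA⟩ := Finset.mem_erase.1 hv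
    by_cases hvu : v = u
    · subst hvu
      rw [Function.update_self]
      omega
    · rw [hold v hvu]
      exact h.lt_up v hvA
  · intro v hv
    obtain ⟨hvi, hvA⟩ := Finset.mem_erase.1 hv
    by_cases hvu : v = u
    · subst hvu
      rw [Function.update_self]
      exact (h.up_mem i hi).imp_left fun h' => Finset.mem_erase.2 ⟨by omega, h'⟩
    · rw [hold v hvu]
      exact (h.up_mem v hvA).imp_left fun h' => Finset.mem_erase.2 ⟨hupM v hvA hvu hvi, h'⟩
  · intro v hv w hw h1 h2
    obtain ⟨hvi, hvA⟩ := Finset.mem_erase.1 hv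
    obtain ⟨hwi, hwA⟩ := Finset.mem_erase.1 hw
    by_cases hvu : v = u <;> by_cases hwu : w = u
    · omega
    · subst hvu
      rw [Function.update_self] at h1
      rw [hold w hwu] at h2
      exact absurd (h.root_unique i hi w hwA h1 h2).symm hwi
    · subst hwu
      rw [Function.update_self] at h2
      rw [hold v hvu] at h1
      exact absurd (h.root_unique i hi v hvA h2 h1).symm hvi
    · rw [hold w hwu] at h2
      rw [hold v hvu] at h1
      exact h.root_unique v hvA w hwA h1 h2
  · intro p hp'
    have hpi : p ≠ i := by
      rcases hp' with hp' | rfl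
      · exact Finset.ne_of_mem_erase hp'
      · omega
    rw [h.nch_eq p (hp'.imp_left Finset.mem_of_mem_erase)]
    unfold childCount
    by_cases hpu : p = up i
    · have h1 : i ∈ A.filter fun v => up v = p := Finset.mem_filter.2 ⟨hi, hpu.symm⟩
      have h2 : u ∉ (A.filter fun v => up v = p).erase i := by
        simp only [Finset.mem_erase, Finset.mem_filter, not_and]
        intro _ _
        omega
      have h3 : (A.erase i).filter (fun v => Function.update up u (up i) v = p) =
          insert u ((A.filter fun v => up v = p).erase i) := by
        ext v
        simp only [Finset.mem_filter, Finset.mem_erase, Finset.mem_insert]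
        by_cases hvu : v = u
        · subst hvu
          simp [Function.update_self, hpu, huA]
          omega
        · rw [hold v hvu]
          tauto
      rw [h3, Finset.card_insert_of_notMem h2, Finset.card_erase_of_mem h1]
      have := Finset.card_pos.2 ⟨i, h1⟩
      omega
    · congr 1
      ext v
      simp only [Finset.mem_filter, Finset.mem_erase]
      by_cases hvu : v = u
      · subst hvu
        rw [Function.update_self, hup]
        simp only [Ne.symm hpu, hpi.symm, and_false]
      · rw [hold v hvu]
        refine ⟨fun ⟨h1, h2⟩ => ⟨⟨?_, h1⟩, h2⟩, fun h => ⟨h.1.2, h.2⟩⟩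
        rintro rfl
        exact hpu h2.symm
  · intro p hp' h0
    have hpi : p ≠ i := by
      rcases hp' with hp' | rfl
      · exact Finset.ne_of_mem_erase hp'
      · omega
    obtain ⟨a, b, c, d⟩ := h.pend_mem p (hp'.imp_left Finset.mem_of_mem_erase) h0
    have hwu : pend p - 1 ≠ u := by
      intro hwu
      rw [hwu] at c
      omega
    refine ⟨Finset.mem_erase.2 ⟨by omega, a⟩, ?_, ?_, by omega⟩
    · rw [Finset.mem_insert]
      tauto
    · rw [hold _ hwu, c]
  · intro v hv
    rw [Finset.mem_insert] at hv
    rcases hv with rfl | hv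
    · exact Finset.mem_erase.2 ⟨by omega, huA⟩
    · exact Finset.mem_erase.2 ⟨fun h' => hiM (h' ▸ hv), h.made_subset hv⟩
  · intro v hv
    rw [Finset.mem_insert] at hv
    rcases hv with rfl | hv
    · omega
    · have := h.made_lt v hv
      omega
  · intro v hv hvM hvi h0
    obtain ⟨hvi', hvA⟩ := Finset.mem_erase.1 hv
    rw [Finset.mem_insert] at hvM
    push Not at hvM
    rw [hold v hvM.1]
    exact h.leaf v hvA hvM.2 (by omega) h0
  · intro v hv hvM hvi h0
    obtain ⟨hvi', hvA⟩ := Finset.mem_erase.1 hv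
    rw [Finset.mem_insert] at hvM
    push Not at hvM
    rw [hold v hvM.1] at h0 ⊢
    refine (h.other v hvA hvM.2 (by omega) h0).imp_right ?_
    rintro ⟨y, hy, hyv⟩
    refine ⟨y, Finset.mem_insert_of_mem hy, ?_⟩
    rw [hold y (fun h' => huM (h' ▸ hy)), hyv]
  · intro p hp' hpi h1
    obtain ⟨hpi', hpA⟩ := Finset.mem_erase.1 hp'
    exact h.unary p hpA (by omega) h1
  · intro v hv
    obtain ⟨hvi', hvA⟩ := Finset.mem_erase.1 hv
    by_cases hvu : v = u
    · subst hvu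
      rw [Function.update_self]
      have := h.depth_fresh v huA huM
      have := h.depth_fresh i hi hiM
      omega
    · rw [Function.update_of_ne hvu]
      exact h.depth_le v hvA
  · intro v hv hvM
    rw [Finset.mem_insert] at hvM
    push Not at hvM
    rw [Function.update_of_ne hvM.1]
    exact h.depth_fresh v (Finset.mem_of_mem_erase hv) hvM.2
  · rw [Finset.card_erase_of_mem hi, Finset.card_insert_of_notMem huM]
    have := Finset.card_pos.2 ⟨i, hi⟩
    have := h.card
    omega

/-- Two siblings meet at their parent, where one of them was waiting. The leaf among them is
absorbed, the parent loses one child, and its waiting place becomes free. The result counts as made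
and joins nothing else in this round, which keeps the depth bound. -/
theorem rake (h : Scan n i ρ m A M up nch pend E) (hi : i ∈ A) (hn : ¬ (nch i = 1 ∧ pend i ≠ 0))
    (hp : pend (up i) ≠ 0) {x y : ℕ}
    (hxy : x = i ∧ y = pend (up i) - 1 ∨ x = pend (up i) - 1 ∧ y = i) (hx : nch x = 0)
    {F : Cluster} (hF : F.depth ≤ max (E x).depth (E y).depth + 1) :
    Scan n (i + 1) ρ m (A.erase x) (insert y M) up
      (Function.update nch (up i) (nch (up i) - 1)) (Function.update pend (up i) 0)
      (Function.update E y F) := by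
  obtain ⟨hwA, hwM, hwp, hwi⟩ := h.pend_mem (up i) (h.up_mem i hi) hp
  generalize hw : pend (up i) - 1 = w at *
  generalize hpp : up i = p at *
  have hiM := h.notMem_made
  have hip := h.lt_up i hi
  rw [hpp] at hip
  have hxA : x ∈ A ∧ x ∉ M ∧ up x = p ∧ x < i + 1 := by
    rcases hxy with ⟨rfl, rfl⟩ | ⟨rfl, rfl⟩
    · exact ⟨hi, hiM, hpp, by omega⟩
    · exact ⟨hwA, hwM, hwp, by omega⟩
  have hyA : y ∈ A ∧ y ∉ M ∧ up y = p ∧ y < i + 1 := by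
    rcases hxy with ⟨rfl, rfl⟩ | ⟨rfl, rfl⟩
    · exact ⟨hwA, hwM, hwp, by omega⟩
    · exact ⟨hi, hiM, hpp, by omega⟩
  have hne : x ≠ y := by omega
  have hfresh : ∀ v, v ∉ insert y M → v ≠ y ∧ v ∉ M := by
    intro v hv
    rw [Finset.mem_insert] at hv
    push Not at hv
    exact hv
  -- `x` has no children, so after its removal the parents of present vertices are still present.
  have hnox : ∀ v ∈ A, up v ≠ x := by
    intro v hv hvx
    have h1 := h.nch_eq x (.inl hxA.1)
    rw [hx, childCount, eq_comm, Finset.card_eq_zero, Finset.filter_eq_empty_iff] at h1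
    exact h1 hv hvx
  refine ⟨(Finset.erase_subset _ _).trans h.subset, ?_, ?_, ?_, ?_, ?_, ?_, ?_, ?_, ?_, ?_, ?_, ?_,
    ?_⟩
  · exact fun v hv => h.lt_up v (Finset.mem_of_mem_erase hv)
  · intro v hv
    have hvA := Finset.mem_of_mem_erase hv
    exact (h.up_mem v hvA).imp_left fun h' => Finset.mem_erase.2 ⟨hnox v hvA, h'⟩
  · exact fun v hv w hw =>
      h.root_unique v (Finset.mem_of_mem_erase hv) w (Finset.mem_of_mem_erase hw)
  · intro q hq
    have h1 := h.nch_eq q (hq.imp_left Finset.mem_of_mem_erase)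
    unfold childCount at h1 ⊢
    rw [Finset.filter_erase]
    by_cases hqp : q = p
    · subst hqp
      rw [Function.update_self, h1,
        Finset.card_erase_of_mem (Finset.mem_filter.2 ⟨hxA.1, hxA.2.2.1⟩)]
    · rw [Function.update_of_ne hqp, h1, Finset.erase_eq_of_notMem]
      rw [Finset.mem_filter, hxA.2.2.1]
      exact fun h' => hqp h'.2.symm
  · intro q hq h0
    by_cases hqp : q = p
    · subst hqp
      rw [Function.update_self] at h0
      exact absurd rfl h0
    · rw [Function.update_of_ne hqp] at h0 ⊢
      obtain ⟨a, b, c, d⟩ := h.pend_mem q (hq.imp_left Finset.mem_of_mem_erase) h0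
      have h1 : pend q - 1 ≠ x := fun h' => hqp (by rw [← c, h', hxA.2.2.1])
      have h2 : pend q - 1 ≠ y := fun h' => hqp (by rw [← c, h', hyA.2.2.1])
      refine ⟨Finset.mem_erase.2 ⟨h1, a⟩, ?_, c, by omega⟩
      rw [Finset.mem_insert]
      tauto
  · intro v hv
    rw [Finset.mem_insert] at hv
    rcases hv with rfl | hv
    · exact Finset.mem_erase.2 ⟨hne.symm, hyA.1⟩
    · exact Finset.mem_erase.2 ⟨fun h' => hxA.2.1 (h' ▸ hv), h.made_subset hv⟩
  · intro v hv
    rw [Finset.mem_insert] at hv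
    rcases hv with rfl | hv
    · exact hyA.2.2.2
    · have := h.made_lt v hv
      omega
  · intro v hv hvM hvi h0
    obtain ⟨hvx, hvA⟩ := Finset.mem_erase.1 hv
    obtain ⟨hvy, hvM⟩ := hfresh v hvM
    have hvi' : v < i := by omega
    rw [Function.update_of_ne (by omega)] at h0
    have h1 := h.leaf v hvA hvM hvi' h0
    by_cases hvp : up v = p
    · rw [hvp] at h1
      omega
    · rw [Function.update_of_ne hvp]
      exact h1
  · intro v hv hvM hvi h0
    obtain ⟨hvx, hvA⟩ := Finset.mem_erase.1 hv
    obtain ⟨hvy, hvM⟩ := hfresh v hvM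
    have hvi' : v < i := by omega
    by_cases hvp : up v = p
    · exact .inr ⟨y, Finset.mem_insert_self _ _, by rw [hyA.2.2.1, hvp]⟩
    · rw [Function.update_of_ne hvp] at h0 ⊢
      rcases h.other v hvA hvM hvi' h0 with ⟨h1, h2⟩ | ⟨z, hz, hzv⟩
      · left
        have h3 := h.pend_mem (up v) (h.up_mem v hvA) h1
        rw [Function.update_of_ne (by omega)]
        exact ⟨h1, h2⟩
      · exact .inr ⟨z, Finset.mem_insert_of_mem hz, hzv⟩
  · intro q hq hqi h1
    obtain ⟨hqx, hqA⟩ := Finset.mem_erase.1 hq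
    rw [Function.update_of_ne (by omega)] at h1 ⊢
    by_cases hqi' : q = i
    · subst hqi'
      by_contra hcon
      exact hn ⟨h1, hcon⟩
    · exact h.unary q hqA (by omega) h1
  · intro v hv
    by_cases hvy : v = y
    · subst hvy
      rw [Function.update_self]
      have := h.depth_fresh v hyA.1 hyA.2.1
      have := h.depth_fresh x hxA.1 hxA.2.1
      omega
    · rw [Function.update_of_ne hvy]
      exact h.depth_le v (Finset.mem_of_mem_erase hv)
  · intro v hv hvM
    obtain ⟨hvy, hvM⟩ := hfresh v hvM
    rw [Function.update_of_ne hvy]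
    exact h.depth_fresh v (Finset.mem_of_mem_erase hv) hvM
  · rw [Finset.card_erase_of_mem hxA.1, Finset.card_insert_of_notMem hyA.2.1]
    have := Finset.card_pos.2 ⟨i, hi⟩
    have := h.card
    omega

/-- Neither of the two siblings is a leaf, so nothing can be raked. In `other` the vertex `i` is
excused by the first alternative: the place is taken by a vertex with children. -/
theorem hold (h : Scan n i ρ m A M up nch pend E) (hi : i ∈ A) (hn : ¬ (nch i = 1 ∧ pend i ≠ 0))
    (hp : pend (up i) ≠ 0) (h1 : nch i ≠ 0) (h2 : nch (pend (up i) - 1) ≠ 0) :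
    Scan n (i + 1) ρ m A M up nch pend E := by
  refine ⟨h.subset, h.lt_up, h.up_mem, h.root_unique, h.nch_eq, ?_, h.made_subset, ?_, ?_, ?_, ?_,
    h.depth_le, h.depth_fresh, h.card⟩
  · intro p hp h0
    obtain ⟨a, b, c, d⟩ := h.pend_mem p hp h0
    exact ⟨a, b, c, by omega⟩
  · intro v hv
    have := h.made_lt v hv
    omega
  · intro v hv hm hvi h0
    by_cases hvi' : v = i
    · subst hvi'
      exact absurd h0 h1
    · exact h.leaf v hv hm (by omega) h0
  · intro v hv hm hvi h0
    by_cases hvi' : v = i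
    · subst hvi'
      exact .inl ⟨hp, h2⟩
    · exact h.other v hv hm (by omega) h0
  · intro v hv hvi h0
    by_cases hvi' : v = i
    · subst hvi'
      by_contra hcon
      exact hn ⟨h0, hcon⟩
    · exact h.unary v hv (by omega) h0

/-- Earlier fresh children of the same parent cannot use the first alternative of `other`, because
the place was free; they have a sibling made in this round, and the newcomer does not change that.
-/
theorem place (h : Scan n i ρ m A M up nch pend E) (hi : i ∈ A) (hn : ¬ (nch i = 1 ∧ pend i ≠ 0))
    (hp : pend (up i) = 0) :
    Scan n (i + 1) ρ m A M up nch (Function.update pend (up i) (i + 1)) E := by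
  have hlt := h.lt_up i hi
  have hiM := h.notMem_made
  refine ⟨h.subset, h.lt_up, h.up_mem, h.root_unique, h.nch_eq, ?_, h.made_subset, ?_, ?_, ?_, ?_,
    h.depth_le, h.depth_fresh, h.card⟩
  · intro q hq h0
    by_cases hqp : q = up i
    · subst hqp
      rw [Function.update_self, Nat.add_sub_cancel]
      exact ⟨hi, hiM, rfl, by omega⟩
    · rw [Function.update_of_ne hqp] at h0 ⊢
      obtain ⟨a, b, c, d⟩ := h.pend_mem q hq h0
      exact ⟨a, b, c, by omega⟩
  · intro v hv
    have := h.made_lt v hv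
    omega
  · intro v hv hm hvi h0
    by_cases hvi' : v = i
    · subst hvi'
      rw [Function.update_self]
    · have h1 := h.leaf v hv hm (by omega) h0
      by_cases hvp : up v = up i
      · rw [hvp, hp] at h1
        omega
      · rw [Function.update_of_ne hvp, h1]
  · intro v hv hm hvi h0
    by_cases hvi' : v = i
    · subst hvi'
      rw [Function.update_self] at h0
      exact absurd rfl h0
    · by_cases hvp : up v = up i
      · rcases h.other v hv hm (by omega) (by rw [hvp, hp]; omega) with h1 | h1
        · rw [hvp] at h1
          exact absurd hp h1.1
        · exact .inr h1
      · rw [Function.update_of_ne hvp] at h0 ⊢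
        exact h.other v hv hm (by omega) h0
  · intro v hv hvi h0
    rw [Function.update_of_ne (by omega)]
    by_cases hvi' : v = i
    · subst hvi'
      by_contra hcon
      exact hn ⟨h0, hcon⟩
    · exact h.unary v hv (by omega) h0

theorem card_pos (h : Scan n i ρ m A M up nch pend E) (hm : 1 ≤ m) : 1 ≤ A.card := by
  have := Finset.card_le_card h.made_subset
  have := h.card
  omega

/-- A round contracts a constant fraction of the vertices. -/
theorem card_le (h : Scan n n ρ m A M up nch pend E) (hm : 2 ≤ m) : 6 * A.card ≤ 5 * m := by
  have hcard := h.card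
  have hMA := Finset.card_le_card h.made_subset
  have hlt : ∀ v ∈ A, v < n := fun v hv => Finset.mem_range.1 (h.subset hv)
  by_cases hA : A.card ≤ 1
  · omega
  -- As `A.card + M.card = m`, the claim means `A.card ≤ 5 * M.card`. Unary vertices and fresh
  -- leaves are charged to `T`, the parents of the clusters made in this round.
  set T := M.image up with hT
  have hTM : T.card ≤ M.card := Finset.card_image_le
  set U := A.filter fun v => nch v = 1 with hU
  set L := A.filter fun v => nch v = 0 with hL
  have hchild : ∀ p ∈ A, nch p ≠ 0 → ∃ v ∈ A, up v = p := by
    intro p hp h0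
    rw [h.nch_eq p (.inl hp)] at h0
    obtain ⟨v, hv⟩ := Finset.card_pos.1 (Nat.pos_of_ne_zero h0)
    exact ⟨v, Finset.mem_filter.1 hv⟩
  -- The waiting place of a unary vertex is free at the end, so by `other` a child of it that is
  -- fresh has a made sibling; in any case some child is made.
  have hUT : U ⊆ T := by
    intro p hp
    obtain ⟨hpA, hp1⟩ := Finset.mem_filter.1 hp
    obtain ⟨v, hv, hvp⟩ := hchild p hpA (by omega)
    have h0 := h.unary p hpA (hlt p hpA) hp1
    rw [hT, Finset.mem_image]
    by_cases hvM : v ∈ M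
    · exact ⟨v, hvM, hvp⟩
    · rcases h.other v hv hvM (hlt v hv) (by rw [hvp, h0]; omega) with h1 | ⟨y, hy, hyv⟩
      · rw [hvp] at h1
        exact absurd h0 h1.1
      · exact ⟨y, hy, hyv.trans hvp⟩
  -- If at least two vertices are present, the root is not a leaf: climbing from any other vertex
  -- ends at a child of the root.
  have hroot : ∀ v ∈ L, up v ∈ A := by
    intro v hv
    obtain ⟨hvA, hv0⟩ := Finset.mem_filter.1 hv
    rcases h.up_mem v hvA with h1 | h1
    · exact h1
    · obtain ⟨w, hw, hwv⟩ := Finset.exists_mem_ne (by omega : 1 < A.card) v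
      have hclimb : ∀ k w, w ∈ A → n - w = k → w ≠ v → up w = v ∨ ∃ z ∈ A, up z = v := by
        intro k
        induction k using Nat.strong_induction_on with
        | _ k ih =>
          rintro w hw rfl hwv
          have h2 := h.lt_up w hw
          have h3 := hlt w hw
          by_cases h4 : up w = v
          · exact .inl h4
          · rcases h.up_mem w hw with h5 | h5
            · rcases ih _ (by omega) (up w) h5 rfl h4 with h6 | h6
              · exact .inr ⟨_, h5, h6⟩
              · exact .inr h6
            · exact absurd (h.root_unique w hw v hvA h5 h1) hwv
      have : ∃ z ∈ A, up z = v := by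
        rcases hclimb _ w hw rfl hwv with h2 | h2
        · exact ⟨w, hw, h2⟩
        · exact h2
      obtain ⟨z, hz, hzv⟩ := this
      rw [h.nch_eq v (.inl hvA), childCount, Finset.card_eq_zero, Finset.filter_eq_empty_iff] at hv0
      exact absurd hzv (hv0 hz)
  -- A fresh leaf occupies the waiting place of its parent, so there is at most one per parent. The
  -- parent is then not unary and has a further child. Since a leaf is waiting, `other` leaves only
  -- that some child of this parent is made.
  have hLM : (L.filter fun v => v ∉ M).card ≤ T.card := by
    refine Finset.card_le_card_of_injOn up ?_ ?_
    · intro v hv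
      rw [Finset.mem_coe, Finset.mem_filter] at hv
      obtain ⟨hvL, hvM⟩ := hv
      have hpA := hroot v hvL
      obtain ⟨hvA, hv0⟩ := Finset.mem_filter.1 hvL
      have hpend := h.leaf v hvA hvM (hlt v hvA) hv0
      have hvf : v ∈ A.filter fun w => up w = up v := Finset.mem_filter.2 ⟨hvA, rfl⟩
      have h1 : 1 < (A.filter fun w => up w = up v).card := by
        have h2 := Finset.card_pos.2 ⟨v, hvf⟩
        have h3 : nch (up v) ≠ 1 := by
          intro h3
          have := h.unary _ hpA (hlt _ hpA) h3
          omega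
        rw [h.nch_eq _ (.inl hpA), childCount] at h3
        omega
      obtain ⟨w, hw, hwv⟩ := Finset.exists_mem_ne h1 v
      obtain ⟨hwA, hwp⟩ := Finset.mem_filter.1 hw
      rw [Finset.mem_coe, hT, Finset.mem_image]
      by_cases hwM : w ∈ M
      · exact ⟨w, hwM, hwp⟩
      · rcases h.other w hwA hwM (hlt w hwA) (by rw [hwp, hpend]; omega) with h2 | ⟨y, hy, hyw⟩
        · rw [hwp, hpend, Nat.add_sub_cancel] at h2
          exact absurd hv0 h2.2
        · exact ⟨y, hy, hyw.trans hwp⟩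
    · intro v hv w hw hvw
      rw [Finset.mem_coe, Finset.mem_filter] at hv hw
      obtain ⟨hvA, hv0⟩ := Finset.mem_filter.1 hv.1
      obtain ⟨hwA, hw0⟩ := Finset.mem_filter.1 hw.1
      have h1 := h.leaf v hvA hv.2 (hlt v hvA) hv0
      have h2 := h.leaf w hwA hw.2 (hlt w hwA) hw0
      rw [hvw] at h1
      omega
  have hLcard : L.card ≤ 2 * M.card := by
    have h1 := Finset.card_filter_add_card_filter_not (s := L) fun v => v ∈ M
    have h2 : (L.filter fun v => v ∈ M).card ≤ M.card :=
      Finset.card_le_card fun v hv => (Finset.mem_filter.1 hv).2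
    omega
  have hUcard : U.card ≤ M.card := (Finset.card_le_card hUT).trans hTM
  have hsum : ∑ p ∈ A, nch p ≤ A.card := by
    have h1 : ∑ p ∈ A, nch p = ∑ p ∈ A, (A.filter fun v => up v = p).card :=
      Finset.sum_congr rfl fun p hp => h.nch_eq p (.inl hp)
    rw [h1, Finset.sum_card_fiberwise_eq_card_filter]
    exact Finset.card_filter_le _ _
  -- Pointwise, `2` is at most the child count, plus one for a unary vertex, plus two for a leaf.
  -- Together with the previous bounds, `A.card ≤ U.card + 2 * L.card ≤ 5 * M.card`.
  have hsum2 : 2 * A.card ≤ ∑ p ∈ A, nch p + U.card + 2 * L.card := by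
    have h1 : U.card = ∑ p ∈ A, if nch p = 1 then 1 else 0 := Finset.card_filter _ _
    have h2 : L.card = ∑ p ∈ A, if nch p = 0 then 1 else 0 := Finset.card_filter _ _
    rw [h1, h2, Finset.mul_sum, ← Finset.sum_add_distrib, ← Finset.sum_add_distrib, mul_comm,
      ← smul_eq_mul, ← Finset.sum_const]
    refine Finset.sum_le_sum fun p _ => ?_
    split_ifs <;> omega
  omega

end Scan

namespace RealRAM

open Cluster

/-! ### The initial nodes -/

def initNode : Prog :=
  .setIMem 11 (.reg 5) (.lit 1) ;;
  .setIMem 12 (.reg 5) (.add (.reg 5) (.reg 5)) ;;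
  .setIMem 13 (.reg 5) (.add (.add (.reg 5) (.reg 5)) (.lit 1)) ;;
  .setIMem 6 (.reg 5) (.reg 5) ;;
  .setIMem 8 (.reg 5) (.mem 5 (.reg 5)) ;;
  .setRReg 10 (.sub (.mem 3 (.reg 5)) (.mem 2 (.reg 5))) ;;
  .ite (.rlt (.mem 3 (.mem 5 (.reg 5))) (.reg 10))
    (.setRReg 10 (.mem 3 (.mem 5 (.reg 5)))) .skip ;;
  .setRReg 11 (.sub (.mem 3 (.mem 5 (.reg 5))) (.mem 2 (.reg 5))) ;;
  .ite (.rlt (.mem 3 (.reg 5)) (.reg 11)) (.setRReg 11 (.mem 3 (.reg 5))) .skip ;;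
  .setRMem 4 (.add (.reg 5) (.reg 5)) (.reg 10) ;;
  .setRMem 4 (.add (.add (.reg 5) (.reg 5)) (.lit 1)) (.mem 3 (.reg 5)) ;;
  .setRMem 5 (.reg 5) (.mem 2 (.reg 5)) ;;
  .setRMem 6 (.reg 5) (.reg 11) ;;
  .setRMem 7 (.reg 5) (.reg 10) ;;
  .setIReg 5 (.add (.reg 5) (.lit 1))

/-- Make a node for every vertex. -/
def initNodes : Prog :=
  .setIReg 5 (.lit 0) ;; .while (.ilt (.reg 5) (.reg 0)) initNode ;;
  .setIReg 11 (.reg 0) ;; .setIReg 12 (.add (.reg 0) (.reg 0)) ;; .setIReg 13 (.reg 0)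

/-- For the root, the radius of the parent is read from the cell of the virtual parent `n`. Its
value is irrelevant, since `n` is a member of no cluster. -/
theorem initNode_runs {n b i : ℕ} (hb : 64 * (n + 1) ^ 2 < 2 ^ b) {s : State} (hi : i < n)
    (h5 : s.ireg 5 = i) (hpar : s.imem 5 i ≤ n) :
    Runs b initNode s fun t s' => t ≤ 19 ∧ s'.ireg 5 = i + 1 ∧
      StoresNode (s.imem 5) (s.rmem 2) (s.rmem 3) (2 * (i + 1)) s' (.base i) i ∧
      s'.imem 6 i = i ∧ s'.imem 8 i = s.imem 5 i ∧
      (∀ j < i, s'.imem 11 j = s.imem 11 j ∧ s'.imem 12 j = s.imem 12 j ∧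
        s'.imem 13 j = s.imem 13 j ∧ s'.imem 6 j = s.imem 6 j ∧ s'.imem 8 j = s.imem 8 j ∧
        s'.rmem 5 j = s.rmem 5 j ∧ s'.rmem 6 j = s.rmem 6 j ∧ s'.rmem 7 j = s.rmem 7 j) ∧
      ∀ j < 2 * i, s'.rmem 4 j = s.rmem 4 j := by
  have hbig : 2 * n + 2 < 2 ^ b := by nlinarith
  generalize hp : s.imem 5 = par at *
  generalize hl : s.rmem 2 = len at *
  generalize hr : s.rmem 3 = r at *
  refine (Runs.of_wp (Q := fun s' => s'.ireg 5 = i + 1 ∧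
    s'.imem 11 = Function.update (s.imem 11) i 1 ∧
    s'.imem 12 = Function.update (s.imem 12) i (i + i) ∧
    s'.imem 13 = Function.update (s.imem 13) i (i + i + 1) ∧
    s'.imem 6 = Function.update (s.imem 6) i i ∧
    s'.imem 8 = Function.update (s.imem 8) i (par i) ∧
    s'.rmem 5 = Function.update (s.rmem 5) i (len i) ∧
    s'.rmem 6 = Function.update (s.rmem 6) i (min (r i) (r (par i) - len i)) ∧
    s'.rmem 7 = Function.update (s.rmem 7) i (min (r (par i)) (r i - len i)) ∧
    s'.rmem 4 = Function.update (Function.update (s.rmem 4) (i + i)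
      (min (r (par i)) (r i - len i))) (i + i + 1) (r i)) ?_).mono ?_
  · simp only [initNode, wp, IExp.eval, RExp.eval, BExp.holds, State.writeIReg_ireg,
      State.writeIMem_ireg, State.writeRMem_ireg, State.writeRReg_ireg, State.writeIReg_rreg,
      State.writeIMem_rreg, State.writeRMem_rreg, State.writeRReg_rreg,
      State.writeIMem_imem, State.writeRMem_imem, State.writeIReg_imem, State.writeRReg_imem,
      State.writeRMem_rmem, State.writeIMem_rmem, State.writeIReg_rmem, State.writeRReg_rmem,
      if_true, if_false, Nat.reduceEqDiff, h5, hp, hl, hr, true_and, and_true]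
    refine ⟨by omega, by omega, by omega, by omega, by omega,
      fun h1 => ⟨fun h2 => ⟨by omega, ?_⟩, fun h2 => ⟨by omega, ?_⟩⟩,
      fun h1 => ⟨fun h2 => ⟨by omega, ?_⟩, fun h2 => ⟨by omega, ?_⟩⟩⟩
    all_goals
      first
        | rw [min_eq_left h1.le]
        | rw [min_eq_right (not_lt.1 h1)]
      first
        | rw [min_eq_left h2.le]
        | rw [min_eq_right (not_lt.1 h2)]
      exact ⟨rfl, rfl, rfl⟩
  · rintro t s' ⟨ht, g5, g11, g12, g13, g6, g8, r5, r6, r7, r4⟩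
    refine ⟨ht, g5, ⟨?_, ?_, ?_, ?_, ?_, ?_, ?_, ?_, ?_, ?_⟩, ?_, ?_, ?_, ?_⟩
    · simp [g11, mem]
    · simp [g12, mem]; omega
    · simp [g13, mem]; omega
    · simp [g12, mem, slice]
    · simp [g12, mem, slice, r4, fromTop]
    · simp [g13, mem, slice]
    · simp [g13, mem, slice, r4, fromBot]
    · simp [r5, Cluster.length]
    · simp [r6, Cluster.capUp]
    · simp [r7, Cluster.capDown]
    · simp [g6]
    · simp [g8]
    · intro j hj
      simp only [g11, g12, g13, g6, g8, r5, r6, r7, Function.update_of_ne hj.ne, and_self]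
    · intro j hj
      rw [r4, Function.update_of_ne (by omega), Function.update_of_ne (by omega)]

theorem initNodes_runs {n b : ℕ} (hb : 64 * (n + 1) ^ 2 < 2 ^ b) {par : ℕ → ℕ} {len r : ℕ → ℝ}
    {s : State} (h0 : s.ireg 0 = n) (hp : s.imem 5 = par) (hl : s.rmem 2 = len) (hr : s.rmem 3 = r)
    (h15 : ∀ i, s.imem 15 i = 0) (hpar : ∀ j < n, par j ≤ n) :
    Runs b initNodes s fun t s' => t ≤ 20 * n + 5 ∧
      IsForest n par len r s' .base (Finset.range n) par .base ∧
      (∀ j < n, s'.imem 8 j = par j) ∧ s'.ireg 13 = n := by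
  have hbig : 2 * n + 2 < 2 ^ b := by nlinarith
  unfold initNodes
  refine Runs.wp_seq ?_
  simp only [wp, IExp.eval]
  refine ⟨by omega, Runs.seq ((Runs.for (fun i s' => s'.ireg 5 = i ∧ s'.ireg 0 = n ∧
    s'.imem 5 = par ∧ s'.rmem 2 = len ∧ s'.rmem 3 = r ∧ (∀ i, s'.imem 15 i = 0) ∧
    ∀ j < i, StoresNode par len r (2 * i) s' (.base j) j ∧ s'.imem 6 j = j ∧
      s'.imem 8 j = par j) 19 n ?_ ?_ ?_).mono ?_)⟩
  · rintro i s' - ⟨h5, h0, -⟩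
    simp only [BExp.holds, IExp.eval, h5, h0]
  · rintro i s' hi ⟨h5, h0, hp, hl, hr, h15, hst⟩
    refine (initNode_runs hb hi h5 (by rw [hp]; exact hpar i hi)).mono_frame ?_
    rintro t s'' ⟨ht, g5, gn, g6, g8, gold, g4⟩ F
    have f5 := F.imem 5 (by decide)
    have f2 := F.rmem 2 (by decide)
    have f3 := F.rmem 3 (by decide)
    have f15 := F.imem 15 (by decide)
    have f0 := F.ireg 0 (by decide)
    refine ⟨ht, g5, f0.trans h0, f5.trans hp, f2.trans hl, f3.trans hr, fun i => by rw [f15, h15], ?_⟩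
    intro j hj
    by_cases hji : j = i
    · subst hji
      rw [hp, hl, hr] at gn
      exact ⟨gn, g6, by rw [g8, hp]⟩
    · obtain ⟨a, b, c, d, e, f, g, h⟩ := gold j (by omega)
      obtain ⟨h1, h2, h3⟩ := hst j (by omega)
      exact ⟨h1.congr (by omega) a b c g4 f g h, by rw [d, h2], by rw [e, h3]⟩
  · exact ⟨by simp, by simpa using h0, hp, hl, hr, h15, by simp⟩
  · rintro t s' ⟨ht, h5, h0, hp, hl, hr, h15, hst⟩
    refine (Runs.of_wp (Q := fun s'' => s'' = ((s'.writeIReg 11 n).writeIReg 12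
      (n + n)).writeIReg 13 n) ?_).mono ?_
    · simp only [wp, IExp.eval, State.writeIReg_ireg, if_false, Nat.reduceEqDiff, h0,
        OfNat.zero_ne_ofNat]
      exact ⟨by omega, by omega, by omega, trivial⟩
    · rintro t' s'' ⟨ht', rfl⟩ t1 ht1
      simp only [Prog.cost] at ht' ht1
      refine ⟨by omega, ?_, fun j hj => (hst j hj).2.2, by simp⟩
      refine ⟨subset_rfl, by simp; omega, by simp [Cluster.total]; omega, ?_, ?_, ?_, ?_, ?_, ?_, ?_,
        by simp [Cluster.bot], by simp [Cluster.top], ?_, ?_, by simp⟩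
      · intro i hi
        simp only [State.writeIReg_ireg, if_true, Nat.reduceEqDiff, if_false] at hi ⊢
        exact (hst i hi).1.congr (by omega) rfl rfl rfl (fun _ _ => rfl) rfl rfl rfl
      · intro i hi
        exact .base (by simpa using hi)
      · intro i _
        exact .inl (h15 i)
      · intro i _
        exact h15 i
      · intro i hi _
        simp only [State.writeIReg_ireg, if_true, Nat.reduceEqDiff, if_false] at hi
        exact ⟨i, Finset.mem_range.2 hi, (hst i hi).2.1⟩
      · intro v hv
        have := (hst v (Finset.mem_range.1 hv)).2.1
        simpa [this] using hv
      · intro v hv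
        have := (hst v (Finset.mem_range.1 hv)).2.1
        simp [this]
      · intro v _ w _ hvw
        simpa [mem] using hvw
      · intro z hz
        exact ⟨z, by simpa using hz, by simp [mem]⟩

/-! ### Scanning a vertex -/

/-- Registers `30`, `31` hold the nodes of the raked and of the receiving cluster, `35`, `32` their
bottom vertices, and `34` the common parent. -/
def rakeTail : Prog :=
  rakeArgs ;; joinCore ;; .setIMem 8 (.reg 35) (.lit 0) ;; .setIMem 10 (.reg 34) (.lit 0) ;;
  .setIMem 9 (.reg 34) (.sub (.mem 9 (.reg 34)) (.lit 1)) ;; .setIReg 13 (.sub (.reg 13) (.lit 1))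

def rakeInto : Prog :=
  .setIReg 30 (.mem 6 (.reg 5)) ;; .setIReg 31 (.mem 6 (.reg 36)) ;; .setIReg 32 (.reg 36) ;;
  .setIReg 35 (.reg 5) ;; rakeTail

def rakeFrom : Prog :=
  .setIReg 30 (.mem 6 (.reg 36)) ;; .setIReg 31 (.mem 6 (.reg 5)) ;; .setIReg 32 (.reg 5) ;;
  .setIReg 35 (.reg 36) ;; rakeTail

def compressChild : Prog :=
  .setIReg 36 (.sub (.mem 10 (.reg 5)) (.lit 1)) ;;
  .setIReg 30 (.mem 6 (.reg 36)) ;; .setIReg 31 (.mem 6 (.reg 5)) ;; .setIReg 32 (.reg 36) ;;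
  compArgs ;; joinCore ;; .setIMem 8 (.reg 36) (.reg 34) ;; .setIMem 8 (.reg 5) (.lit 0) ;;
  .setIReg 13 (.sub (.reg 13) (.lit 1))

/-- Scan the vertex in register `5`. -/
def scanVertex : Prog :=
  .ite (.ilt (.lit 0) (.mem 8 (.reg 5)))
    (.setIReg 34 (.mem 8 (.reg 5)) ;;
      .ite (.and (.ieq (.mem 9 (.reg 5)) (.lit 1)) (.ilt (.lit 0) (.mem 10 (.reg 5))))
        compressChild
        (.ite (.ilt (.lit 0) (.mem 10 (.reg 34)))
          (.setIReg 36 (.sub (.mem 10 (.reg 34)) (.lit 1)) ;;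
            .ite (.ieq (.mem 9 (.reg 5)) (.lit 0)) rakeInto
              (.ite (.ieq (.mem 9 (.reg 36)) (.lit 0)) rakeFrom .skip))
          (.setIMem 10 (.reg 34) (.add (.reg 5) (.lit 1)))))
    .skip

/-- The state during a round. -/
structure ScanState (n : ℕ) (par : ℕ → ℕ) (len r : ℕ → ℝ) (i ρ m : ℕ) (s : State)
    (e : ℕ → Cluster) (A M : Finset ℕ) (up : ℕ → ℕ) (E : ℕ → Cluster) : Prop where
  forest : IsForest n par len r s e A up E
  scan : Scan n i ρ m A M up (s.imem 9) (s.imem 10) E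
  size : s.ireg 0 = n
  alive : s.ireg 13 = A.card
  up_mem : ∀ v ∈ A, s.imem 8 v = up v
  up_notMem : ∀ v < n, v ∉ A → s.imem 8 v = 0
  par_eq : s.imem 5 = par
  len_eq : s.rmem 2 = len
  r_eq : s.rmem 3 = r

/-- The present clusters are disjoint, so their sizes add up to at most `n`, and `total_le` bounds
the lists below each of them. The factor `2` stands for the lists from the top and from the bottom.
-/
theorem IsForest.storage_le {n : ℕ} {par : ℕ → ℕ} {len r : ℕ → ℝ} {s : State} {e : ℕ → Cluster}
    {A : Finset ℕ} {up : ℕ → ℕ} {E : ℕ → Cluster} (h : IsForest n par len r s e A up E) {d : ℕ}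
    (hd : ∀ v ∈ A, (E v).depth ≤ d) : s.ireg 12 ≤ 2 * (n * (d + 1)) := by
  have hwf : ∀ v ∈ A, (E v).WF par n := fun v hv => h.cluster v hv ▸ h.wf _ (h.id_lt v hv)
  rw [h.storage]
  refine Nat.mul_le_mul_left 2 ?_
  have h1 : ∑ v ∈ A, (E v).mem.card ≤ n := by
    rw [← Finset.card_biUnion fun v hv w hw hvw => h.disjoint v hv w hw hvw]
    refine (Finset.card_le_card (t := Finset.range n) ?_).trans (by simp)
    intro z hz
    obtain ⟨v, hv, hzv⟩ := Finset.mem_biUnion.1 hz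
    exact Finset.mem_range.2 ((hwf v hv).lt hzv)
  calc ∑ v ∈ A, (E v).total ≤ ∑ v ∈ A, (E v).mem.card * (d + 1) :=
        Finset.sum_le_sum fun v hv => (Cluster.total_le (hwf v hv)).trans
          (Nat.mul_le_mul_left _ (Nat.succ_le_succ (hd v hv)))
    _ = (∑ v ∈ A, (E v).mem.card) * (d + 1) := (Finset.sum_mul _ _ _).symm
    _ ≤ n * (d + 1) := Nat.mul_le_mul_right _ h1

end RealRAM

/-! ### Carrying out a rake or a composition -/

namespace RealRAM

open Cluster

section

variable {n b : ℕ} {par : ℕ → ℕ} {len r : ℕ → ℝ} {s s' : State} {e : ℕ → Cluster}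
  {A M : Finset ℕ} {up : ℕ → ℕ} {E : ℕ → Cluster}

/-- Arrays `8`, `9`, `10` serve the bookkeeping of a round; the forest does not depend on them. -/
theorem IsForest.congr (h : IsForest n par len r s e A up E) (h11 : s'.ireg 11 = s.ireg 11)
    (h12 : s'.ireg 12 = s.ireg 12) (hI : ∀ a, a ∉ [8, 9, 10] → s'.imem a = s.imem a)
    (hR : s'.rmem = s.rmem) : IsForest n par len r s' e A up E := by
  have e6 := hI 6 (by decide)
  have e11 := hI 11 (by decide)
  have e12 := hI 12 (by decide)
  have e13 := hI 13 (by decide)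
  have e14 := hI 14 (by decide)
  have e15 := hI 15 (by decide)
  have e16 := hI 16 (by decide)
  refine ⟨h.subset, by rw [h11, h.count], by rw [h12, h.storage], ?_, ?_, ?_, ?_, ?_, ?_, ?_,
    h.bot_eq, h.top_eq, h.disjoint, h.cover, h.base⟩
  · rw [h11, h12]
    exact fun i hi => (h.node i hi).congr le_rfl (by rw [e11]) (by rw [e12]) (by rw [e13])
      (fun _ _ => by rw [hR]) (by rw [hR]) (by rw [hR]) (by rw [hR])
  · rw [h11]
    exact h.wf
  · rw [h11]
    intro i hi
    have := h.linked i hi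
    unfold Linked at this ⊢
    rwa [e14, e15, e16]
  · rw [h11, e15]
    exact h.kind_zero
  · rw [h11, e15, e6]
    exact h.root
  · rw [h11, e6]
    exact h.id_lt
  · rw [e6]
    exact h.cluster

theorem IsForest.wf_cluster (h : IsForest n par len r s e A up E) {v : ℕ} (hv : v ∈ A) :
    (E v).WF par n := h.cluster v hv ▸ h.wf _ (h.id_lt v hv)

/-- Amortisation: a join takes at most `60` steps per member and adds two storage cells per member,
so each new cell pays for `30` steps, and all merging is charged to the final storage. -/
theorem IsForest.join_runs {args : Prog} {K : ℕ} (hb : 64 * (n + 1) ^ 2 < 2 ^ b)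
    (h : IsForest n par len r s e A up E) {x y : ℕ} (hx : x ∈ A) (hy : y ∈ A)
    (hxy : x ≠ y) {F : Cluster} {ca cb ka kb : ℕ}
    (hc : ca = s.imem 6 x ∧ cb = s.imem 6 y ∨ ca = s.imem 6 y ∧ cb = s.imem 6 x)
    (hF : F = .rake (e ca) (e cb) ∧ ka = 1 ∧ kb = 2 ∨ F = .comp (e ca) (e cb) ∧ ka = 3 ∧ kb = 4)
    (hwf : F.WF par n) (hbot : F.bot = y)
    (hP : s.ireg 12 + 2 * n ≤ 50 * (n + 1) ^ 2) (hI : args.imems = []) (hR : args.rmems = [])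
    (hA11 : 11 ∉ args.iregs) (hA12 : 12 ∉ args.iregs)
    (hargs : Runs b args s fun t s' => t ≤ K ∧ JoinArgs par len r F ca cb y ka kb s') :
    Runs b args s fun t s1 => Runs b joinCore s1 fun t' s2 =>
      t + t' + 30 * s.ireg 12 ≤ K + 30 * s2.ireg 12 ∧
      IsForest n par len r s2 (Function.update e (s.ireg 11) F) (A.erase x)
        (Function.update up y (F.top par)) (Function.update E y F) ∧
      Frame args s s1 ∧ Frame joinCore s1 s2 := by
  refine hargs.mono_frame ?_
  rintro t s1 ⟨ht, hJ⟩ F1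
  have i1 : s1.imem = s.imem := funext fun a => F1.imem a (by simp [hI])
  have r1 : s1.rmem = s.rmem := funext fun a => F1.rmem a (by simp [hR])
  have e11 := F1.ireg 11 hA11
  have e12 := F1.ireg 12 hA12
  have h1 : IsForest n par len r s1 e A up E := h.congr e11 e12 (fun a _ => by rw [i1]) r1
  have hcard : F.mem.card ≤ n := by
    refine (Finset.card_le_card (t := Finset.range n) ?_).trans (by simp)
    exact fun z hz => Finset.mem_range.2 (hwf.lt hz)
  have hAcard : A.card ≤ n := (Finset.card_le_card h.subset).trans (by simp)
  have hcnt := h.count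
  have hix := h.id_lt x hx
  have hiy := h.id_lt y hy
  have hbd := bounds_of_le (m := F.mem.card) (P := s.ireg 12) (N := s.ireg 11) (ca := ca)
    (cb := cb) (ka := ka) (kb := kb) hb (by omega) (by omega)
    (by rcases hc with ⟨rfl, rfl⟩ | ⟨rfl, rfl⟩ <;> assumption)
    (by rcases hc with ⟨rfl, rfl⟩ | ⟨rfl, rfl⟩ <;> assumption) (by omega) (by omega)
  refine (joinCore_runs hJ (Finset.card_pos.2 ⟨_, bot_mem F⟩) (by rw [e12]; exact hbd.1)
    (by rw [e11]; exact hbd.2)).mono_frame ?_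
  rintro t' s2 ⟨ht', hj⟩ F2
  have := hj.storage
  refine ⟨by omega, ?_, F1, F2⟩
  have := h1.join hx hy hxy (by rw [i1]; exact hc) hF hwf hbot hj
  rwa [e11] at this

variable {i ρ m : ℕ}

/-- Raking the leaf `x` into its sibling `y`, one of which is the scanned vertex. -/
theorem rakeTail_runs (hb : 64 * (n + 1) ^ 2 < 2 ^ b)
    (hP : 2 * (n * (ρ + 2)) + 2 * n ≤ 50 * (n + 1) ^ 2)
    (h : ScanState n par len r i ρ m s e A M up E)
    (hi : i ∈ A) (hn : ¬ (s.imem 9 i = 1 ∧ s.imem 10 i ≠ 0)) (hp : s.imem 10 (up i) ≠ 0) {x y : ℕ}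
    (hxy : x = i ∧ y = s.imem 10 (up i) - 1 ∨ x = s.imem 10 (up i) - 1 ∧ y = i)
    (hx : s.imem 9 x = 0) (h30 : s.ireg 30 = s.imem 6 x) (h31 : s.ireg 31 = s.imem 6 y)
    (h32 : s.ireg 32 = y) (h35 : s.ireg 35 = x) (h34 : s.ireg 34 = up i) :
    Runs b rakeTail s fun t s' => t + 30 * s.ireg 12 ≤ 30 + 30 * s'.ireg 12 ∧
      ∃ e A M E, ScanState n par len r (i + 1) ρ m s' e A M up E := by
  obtain ⟨hf, hsc, h0, h13, hup, hup0, hpar, hlen, hr⟩ := h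
  obtain ⟨hwA, hwM, hwp, hwi⟩ := hsc.pend_mem (up i) (hsc.up_mem i hi) hp
  have hxyA : x ∈ A ∧ y ∈ A ∧ up x = up i ∧ up y = up i ∧ x ≠ y := by
    rcases hxy with ⟨rfl, rfl⟩ | ⟨rfl, rfl⟩
    · exact ⟨hi, hwA, rfl, hwp, by omega⟩
    · exact ⟨hwA, hi, hwp, rfl, by omega⟩
  obtain ⟨hxA, hyA, hxp, hyp, hne⟩ := hxyA
  have hst : s.ireg 12 ≤ 2 * (n * (ρ + 2)) := hf.storage_le hsc.depth_le
  have hcx := hf.cluster x hxA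
  have hcy := hf.cluster y hyA
  have htop : top par (E x) = top par (E y) := by
    rw [hf.top_eq x hxA, hf.top_eq y hyA, hxp, hyp]
  have hwf : (Cluster.rake (e (s.imem 6 x)) (e (s.imem 6 y))).WF par n := by
    rw [hcx, hcy]
    exact .rake (hf.wf_cluster hxA) (hf.wf_cluster hyA) htop (hf.disjoint x hxA y hyA hne)
  have hscan := hsc.rake hi hn hp hxy hx
    (F := .rake (e (s.imem 6 x)) (e (s.imem 6 y))) (by simp only [Cluster.depth, hcx, hcy]; omega)
  have hbig : n * 1 ≤ n * (ρ + 2) := Nat.mul_le_mul_left n (by omega)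
  have hnb : n + 1 < 2 ^ b := by nlinarith
  have hArgs := rakeArgs_runs (y := y) (p := up i) hb (by omega)
    (hf.node _ (hf.id_lt x hxA)) (hf.node _ (hf.id_lt y hyA)) hr h30 h31 h32 h34
    (by rw [hcy, hf.top_eq y hyA, hyp]) hwf
  unfold rakeTail
  refine Runs.seq ((hf.join_runs hb hxA hyA hne (.inl ⟨rfl, rfl⟩) (.inl ⟨rfl, rfl, rfl⟩) hwf
    (by rw [hcx, hcy, Cluster.bot, hf.bot_eq y hyA]) (by omega) rfl rfl (by decide) (by decide)
    hArgs).mono ?_)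
  intro t s1 hj
  refine Runs.seq (hj.mono ?_)
  rintro t' s2 ⟨ht, hf2, F1, F2⟩
  -- A rake keeps the top of the receiving cluster, so `up` does not change.
  have htopF : Function.update up y ((Cluster.rake (e (s.imem 6 x)) (e (s.imem 6 y))).top par) =
      up := by
    rw [hcx, hcy, Cluster.top, hf.top_eq y hyA, Function.update_eq_self]
  rw [htopF] at hf2
  have e35 : s2.ireg 35 = x := ((F2.ireg 35 (by decide)).trans (F1.ireg 35 (by decide))).trans h35
  have e34 : s2.ireg 34 = up i :=
    ((F2.ireg 34 (by decide)).trans (F1.ireg 34 (by decide))).trans h34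
  have e13 : s2.ireg 13 = A.card :=
    ((F2.ireg 13 (by decide)).trans (F1.ireg 13 (by decide))).trans h13
  have e0 : s2.ireg 0 = n := ((F2.ireg 0 (by decide)).trans (F1.ireg 0 (by decide))).trans h0
  have m8 : s2.imem 8 = s.imem 8 := (F2.imem 8 (by decide)).trans (F1.imem 8 (by decide))
  have m9 : s2.imem 9 = s.imem 9 := (F2.imem 9 (by decide)).trans (F1.imem 9 (by decide))
  have m10 : s2.imem 10 = s.imem 10 := (F2.imem 10 (by decide)).trans (F1.imem 10 (by decide))
  have m5 : s2.imem 5 = par := ((F2.imem 5 (by decide)).trans (F1.imem 5 (by decide))).trans hpar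
  have n2 : s2.rmem 2 = len := ((F2.rmem 2 (by decide)).trans (F1.rmem 2 (by decide))).trans hlen
  have n3 : s2.rmem 3 = r := ((F2.rmem 3 (by decide)).trans (F1.rmem 3 (by decide))).trans hr
  have hAcard : A.card ≤ n := (Finset.card_le_card hf.subset).trans (by simp)
  have hnch : s.imem 9 (up i) ≤ n := by
    rw [hsc.nch_eq _ (hsc.up_mem i hi), childCount]
    exact (Finset.card_filter_le _ _).trans hAcard
  refine (Runs.of_wp (Q := fun s' => s'.imem 8 = Function.update (s.imem 8) x 0 ∧
    s'.imem 10 = Function.update (s.imem 10) (up i) 0 ∧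
    s'.imem 9 = Function.update (s.imem 9) (up i) (s.imem 9 (up i) - 1) ∧
    (∀ a, a ∉ [8, 9, 10] → s'.imem a = s2.imem a) ∧ s'.rmem = s2.rmem ∧
    s'.ireg 13 = A.card - 1 ∧ ∀ a, a ≠ 13 → s'.ireg a = s2.ireg a) ?_).mono ?_
  · simp only [wp, IExp.eval, State.writeIReg_ireg, State.writeIMem_ireg, State.writeIMem_imem,
      State.writeIReg_imem, State.writeIReg_rmem, State.writeIMem_rmem, if_true, if_false,
      Nat.reduceEqDiff, e35, e34, e13, m8, m9, m10, true_and, and_true]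
    refine ⟨by omega, by omega, by omega, by omega, ?_, ?_⟩
    · intro a ha
      simp only [List.mem_cons, List.not_mem_nil, not_or, or_false] at ha
      simp [ha]
    · intro a ha
      simp [ha]
  · rintro t'' s' ⟨ht'', g8, g10, g9, gI, gR, g13, gr⟩
    simp only [Prog.cost] at ht''
    have g12 := gr 12 (by decide)
    refine ⟨by omega, _, _, insert y M, _, ⟨hf2.congr (gr 11 (by decide)) g12 gI gR, ?_,
      (gr 0 (by decide)).trans e0, ?_, ?_, ?_, ?_, by rw [gR, n2], by rw [gR, n3]⟩⟩
    · rw [g9, g10]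
      exact hscan
    · rw [g13, Finset.card_erase_of_mem hxA]
    · intro v hv
      rw [g8, Function.update_of_ne (Finset.ne_of_mem_erase hv)]
      exact hup v (Finset.mem_of_mem_erase hv)
    · intro v hv hvA
      rw [g8]
      by_cases hvx : v = x
      · rw [hvx, Function.update_self]
      · rw [Function.update_of_ne hvx]
        exact hup0 v hv fun h' => hvA (Finset.mem_erase.2 ⟨hvx, h'⟩)
    · exact (gI 5 (by decide)).trans m5

theorem compressChild_runs (hb : 64 * (n + 1) ^ 2 < 2 ^ b)
    (hP : 2 * (n * (ρ + 2)) + 2 * n ≤ 50 * (n + 1) ^ 2)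
    (h : ScanState n par len r i ρ m s e A M up E) (h5 : s.ireg 5 = i)
    (hi : i ∈ A) (hn : s.imem 9 i = 1) (hp : s.imem 10 i ≠ 0) (h34 : s.ireg 34 = up i) :
    Runs b compressChild s fun t s' => t + 30 * s.ireg 12 ≤ 40 + 30 * s'.ireg 12 ∧
      ∃ e A M up E, ScanState n par len r (i + 1) ρ m s' e A M up E := by
  obtain ⟨hf, hsc, h0, h13, hup, hup0, hpar, hlen, hr⟩ := h
  obtain ⟨huA, huM, hui, hult⟩ := hsc.pend_mem i (.inl hi) hp
  have hin : i < n := Finset.mem_range.1 (hsc.subset hi)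
  have hscan := fun F => hsc.compress (F := F) hi hn hp
  generalize hu : s.imem 10 i - 1 = u at *
  have hst : s.ireg 12 ≤ 2 * (n * (ρ + 2)) := hf.storage_le hsc.depth_le
  have hcu := hf.cluster u huA
  have hci := hf.cluster i hi
  have hne : i ≠ u := by omega
  have hwf : (Cluster.comp (e (s.imem 6 u)) (e (s.imem 6 i))).WF par n := by
    rw [hcu, hci]
    exact .comp (hf.wf_cluster huA) (hf.wf_cluster hi)
      (by rw [hf.top_eq u huA, hf.bot_eq i hi, hui]) (hf.disjoint u huA i hi hne.symm)
  replace hscan := hscan (.comp (e (s.imem 6 u)) (e (s.imem 6 i)))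
    (by simp only [Cluster.depth, hcu, hci]; omega)
  have hbig : n * 1 ≤ n * (ρ + 2) := Nat.mul_le_mul_left n (by omega)
  have hnb : 2 * n + 1 < 2 ^ b := by nlinarith
  have hAcard : A.card ≤ n := (Finset.card_le_card hf.subset).trans (by simp)
  have hcnt := hf.count
  have hidu := hf.id_lt u huA
  have hidi := hf.id_lt i hi
  have hupi : up i ≤ n := by
    rcases hsc.up_mem i hi with h' | h'
    · exact (Finset.mem_range.1 (hsc.subset h')).le
    · exact h'.le
  unfold compressChild
  refine Runs.wp_seq ?_
  simp only [wp, IExp.eval, h5, hu]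
  refine ⟨by omega, Runs.wp_seq ?_⟩
  simp only [wp, IExp.eval, State.writeIReg_ireg, State.writeIReg_imem, if_true, if_false,
    Nat.reduceEqDiff]
  refine ⟨by omega, Runs.wp_seq ?_⟩
  simp only [wp, IExp.eval, State.writeIReg_ireg, State.writeIReg_imem, if_true, if_false,
    Nat.reduceEqDiff, h5]
  refine ⟨by omega, Runs.wp_seq ?_⟩
  simp only [wp, IExp.eval, State.writeIReg_ireg, State.writeIReg_imem, if_true, if_false,
    Nat.reduceEqDiff]
  refine ⟨by omega, ?_⟩
  obtain ⟨s0, hs0⟩ : ∃ s0, s0 = (((s.writeIReg 36 u).writeIReg 30 (s.imem 6 u)).writeIReg 31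
    (s.imem 6 i)).writeIReg 32 u := ⟨_, rfl⟩
  rw [← hs0]
  have k36 : s0.ireg 36 = u := by simp [hs0]
  have k34 : s0.ireg 34 = up i := by simp [hs0, h34]
  have k13 : s0.ireg 13 = A.card := by simp [hs0, h13]
  have k5 : s0.ireg 5 = i := by simp [hs0, h5]
  have k0 : s0.ireg 0 = n := by simp [hs0, h0]
  have k12 : s0.ireg 12 = s.ireg 12 := by simp [hs0]
  have k11 : s0.ireg 11 = s.ireg 11 := by simp [hs0]
  have kI : s0.imem = s.imem := by simp [hs0]
  have kR : s0.rmem = s.rmem := by simp [hs0]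
  have hf0 : IsForest n par len r s0 e A up E :=
    hf.congr k11 k12 (fun a _ => by rw [kI]) kR
  have hArgs := compArgs_runs (y := u) hb (by rw [k12]; omega)
    (hf0.node _ (hf0.id_lt u huA)) (hf0.node _ (hf0.id_lt i hi)) (by simp [hs0]) (by simp [hs0])
    (by simp [hs0]) (by rw [kI]; exact hwf)
  refine Runs.seq ((hf0.join_runs hb hi huA hne (.inr ⟨rfl, rfl⟩) (.inr ⟨rfl, rfl, rfl⟩)
    (by rw [kI]; exact hwf) (by rw [kI, hcu, hci, Cluster.bot, hf.bot_eq u huA])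
    (by rw [k12]; omega) rfl rfl (by decide) (by decide) hArgs).mono ?_)
  intro t s1 hj
  refine Runs.seq (hj.mono ?_)
  rintro t' s2 ⟨ht, hf2, F1, F2⟩
  -- A composition keeps the bottom `u` of the lower and the top of the upper cluster.
  have htopF : (Cluster.comp (e (s0.imem 6 u)) (e (s0.imem 6 i))).top par = up i := by
    rw [kI, hcu, hci, Cluster.top, hf.top_eq i hi]
  rw [htopF, kI] at hf2
  rw [k12] at ht
  have e36 : s2.ireg 36 = u :=
    ((F2.ireg 36 (by decide)).trans (F1.ireg 36 (by decide))).trans k36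
  have e34 : s2.ireg 34 = up i :=
    ((F2.ireg 34 (by decide)).trans (F1.ireg 34 (by decide))).trans k34
  have e13 : s2.ireg 13 = A.card :=
    ((F2.ireg 13 (by decide)).trans (F1.ireg 13 (by decide))).trans k13
  have e5 : s2.ireg 5 = i := ((F2.ireg 5 (by decide)).trans (F1.ireg 5 (by decide))).trans k5
  have e0 : s2.ireg 0 = n := ((F2.ireg 0 (by decide)).trans (F1.ireg 0 (by decide))).trans k0
  have m8 : s2.imem 8 = s.imem 8 :=
    ((F2.imem 8 (by decide)).trans (F1.imem 8 (by decide))).trans (by rw [kI])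
  have m9 : s2.imem 9 = s.imem 9 :=
    ((F2.imem 9 (by decide)).trans (F1.imem 9 (by decide))).trans (by rw [kI])
  have m10 : s2.imem 10 = s.imem 10 :=
    ((F2.imem 10 (by decide)).trans (F1.imem 10 (by decide))).trans (by rw [kI])
  have m5 : s2.imem 5 = par :=
    ((F2.imem 5 (by decide)).trans (F1.imem 5 (by decide))).trans (by rw [kI, hpar])
  have n2 : s2.rmem 2 = len :=
    ((F2.rmem 2 (by decide)).trans (F1.rmem 2 (by decide))).trans (by rw [kR, hlen])
  have n3 : s2.rmem 3 = r :=
    ((F2.rmem 3 (by decide)).trans (F1.rmem 3 (by decide))).trans (by rw [kR, hr])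
  refine (Runs.of_wp (Q := fun s' => s'.imem 8 =
      Function.update (Function.update (s.imem 8) u (up i)) i 0 ∧
    (∀ a, a ∉ [8, 9, 10] → s'.imem a = s2.imem a) ∧ s'.imem 9 = s.imem 9 ∧
    s'.imem 10 = s.imem 10 ∧ s'.rmem = s2.rmem ∧
    s'.ireg 13 = A.card - 1 ∧ ∀ a, a ≠ 13 → s'.ireg a = s2.ireg a) ?_).mono ?_
  · simp only [wp, IExp.eval, State.writeIReg_ireg, State.writeIMem_ireg, State.writeIMem_imem,
      State.writeIReg_imem, State.writeIReg_rmem, State.writeIMem_rmem, if_true, if_false,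
      Nat.reduceEqDiff, e36, e34, e13, e5, m8, m9, m10, true_and, and_true]
    refine ⟨by omega, by omega, by omega, ?_, ?_⟩
    · intro a ha
      simp only [List.mem_cons, List.not_mem_nil, not_or, or_false] at ha
      simp [ha]
    · intro a ha
      simp [ha]
  · rintro t'' s' ⟨ht'', g8, gI, g9, g10, gR, g13, gr⟩ t1 ht1 t2 ht2 t3 ht3 t4 ht4
    simp only [Prog.cost] at ht'' ht1 ht2 ht3 ht4
    have g12 := gr 12 (by decide)
    refine ⟨by omega, _, _, insert u M, _, _, ⟨hf2.congr (gr 11 (by decide)) g12 gI gR, ?_,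
      (gr 0 (by decide)).trans e0, ?_, ?_, ?_, ?_, by rw [gR, n2], by rw [gR, n3]⟩⟩
    · rw [g9, g10]
      exact hscan
    · rw [g13, Finset.card_erase_of_mem hi]
    · intro v hv
      obtain ⟨hvi, hvA⟩ := Finset.mem_erase.1 hv
      rw [g8, Function.update_of_ne hvi]
      by_cases hvu : v = u
      · rw [hvu, Function.update_self, Function.update_self]
      · rw [Function.update_of_ne hvu, Function.update_of_ne hvu]
        exact hup v hvA
    · intro v hv hvA
      rw [g8]
      by_cases hvi : v = i
      · rw [hvi, Function.update_self]
      · have hvA' : v ∉ A := fun h' => hvA (Finset.mem_erase.2 ⟨hvi, h'⟩)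
        rw [Function.update_of_ne hvi, Function.update_of_ne (fun (h' : v = u) => hvA' (h' ▸ huA))]
        exact hup0 v hv hvA'
    · exact (gI 5 (by decide)).trans m5

end

end RealRAM

/-! ### Correctness of scanning one vertex -/

namespace RealRAM

open Cluster

section

variable {n b : ℕ} {par : ℕ → ℕ} {len r : ℕ → ℝ} {s s' : State} {e : ℕ → Cluster}
  {A M : Finset ℕ} {up : ℕ → ℕ} {E : ℕ → Cluster} {i ρ m : ℕ}

theorem ScanState.congr (h : ScanState n par len r i ρ m s e A M up E)
    (h0 : s'.ireg 0 = s.ireg 0) (h11 : s'.ireg 11 = s.ireg 11) (h12 : s'.ireg 12 = s.ireg 12)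
    (h13 : s'.ireg 13 = s.ireg 13) (hI : s'.imem = s.imem) (hR : s'.rmem = s.rmem) :
    ScanState n par len r i ρ m s' e A M up E :=
  ⟨h.forest.congr h11 h12 (fun _ _ => by rw [hI]) hR, by rw [hI]; exact h.scan, h0.trans h.size,
    h13.trans h.alive, by rw [hI]; exact h.up_mem, by rw [hI]; exact h.up_notMem,
    by rw [hI]; exact h.par_eq, by rw [hR]; exact h.len_eq, by rw [hR]; exact h.r_eq⟩

/-- The tests of the program separate the transitions of `Scan`: `skip`, `compress`, `rake` in
either direction, `hold` and `place`. -/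
theorem scanVertex_runs (hb : 64 * (n + 1) ^ 2 < 2 ^ b)
    (hP : 2 * (n * (ρ + 2)) + 2 * n ≤ 50 * (n + 1) ^ 2)
    (h : ScanState n par len r i ρ m s e A M up E) (hin : i < n) (h5 : s.ireg 5 = i) :
    Runs b scanVertex s fun t s' => t + 30 * s.ireg 12 ≤ 60 + 30 * s'.ireg 12 ∧
      ∃ e A M up E, ScanState n par len r (i + 1) ρ m s' e A M up E := by
  have hnb : 2 * n + 1 < 2 ^ b := by nlinarith
  unfold scanVertex
  refine Runs.ite ?_ ?_
  swap
  · intro h8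
    simp only [BExp.holds, IExp.eval, h5] at h8
    -- A zero in array `8` marks removed vertices unambiguously, because the parent of a present
    -- vertex exceeds it and is positive.
    have hiA : i ∉ A := by
      intro hiA
      have h1 := h.up_mem i hiA
      have h2 := h.scan.lt_up i hiA
      omega
    refine Runs.skip ⟨by omega, e, A, M, up, E, ?_⟩
    exact ⟨h.forest, h.scan.skip hiA, h.size, h.alive, h.up_mem, h.up_notMem, h.par_eq, h.len_eq,
      h.r_eq⟩
  intro h8
  simp only [BExp.holds, IExp.eval, h5] at h8
  have hiA : i ∈ A := by
    by_contra hiA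
    have := h.up_notMem i hin hiA
    omega
  have hup := h.up_mem i hiA
  have hupn : up i ≤ n := by
    rcases h.scan.up_mem i hiA with h' | h'
    · exact (Finset.mem_range.1 (h.scan.subset h')).le
    · exact h'.le
  refine Runs.wp_seq ?_
  simp only [wp, IExp.eval, h5, hup]
  refine ⟨by omega, ?_⟩
  obtain ⟨s1, hs1⟩ : ∃ s1, s1 = s.writeIReg 34 (up i) := ⟨_, rfl⟩
  rw [← hs1]
  have k34 : s1.ireg 34 = up i := by simp [hs1]
  have k5 : s1.ireg 5 = i := by simp [hs1, h5]
  have k12 : s1.ireg 12 = s.ireg 12 := by simp [hs1]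
  have kI : s1.imem = s.imem := by simp [hs1]
  have h1 : ScanState n par len r i ρ m s1 e A M up E :=
    h.congr (by simp [hs1]) (by simp [hs1]) (by simp [hs1]) (by simp [hs1]) kI (by simp [hs1])
  refine Runs.ite ?_ ?_
  · intro hc
    simp only [BExp.holds, IExp.eval, k5] at hc
    refine (compressChild_runs hb hP h1 k5 hiA hc.1 (by omega) k34).mono ?_
    rintro t s' ⟨ht, h'⟩ t1 ht1
    simp only [Prog.cost] at ht1
    exact ⟨by omega, h'⟩
  intro hn
  simp only [BExp.holds, IExp.eval, k5, Nat.pos_iff_ne_zero] at hn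
  refine Runs.ite ?_ ?_
  · intro hp
    simp only [BExp.holds, IExp.eval, k34] at hp
    have hp0 : s1.imem 10 (up i) ≠ 0 := by omega
    obtain ⟨hwA, -, -, hwi⟩ := h1.scan.pend_mem (up i) (h1.scan.up_mem i hiA) hp0
    have hidw := h1.forest.id_lt _ hwA
    have hidi := h1.forest.id_lt i hiA
    have hcnt := h1.forest.count
    generalize hw : s1.imem 10 (up i) - 1 = w at *
    refine Runs.wp_seq ?_
    simp only [wp, IExp.eval, k34, hw]
    refine ⟨by omega, ?_⟩
    refine Runs.ite ?_ ?_
    · intro h0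
      simp only [BExp.holds, IExp.eval, State.writeIReg_ireg, State.writeIReg_imem, if_false,
        Nat.reduceEqDiff, k5] at h0
      unfold rakeInto
      iterate 4
        refine Runs.wp_seq ?_
        simp only [wp, IExp.eval, State.writeIReg_ireg, State.writeIReg_imem, if_true, if_false,
          Nat.reduceEqDiff, k5]
        refine ⟨by omega, ?_⟩
      obtain ⟨s2, hs2⟩ : ∃ s2, s2 = ((((s1.writeIReg 36 w).writeIReg 30 (s1.imem 6 i)).writeIReg 31
        (s1.imem 6 w)).writeIReg 32 w).writeIReg 35 i := ⟨_, rfl⟩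
      rw [← hs2]
      have g12 : s2.ireg 12 = s1.ireg 12 := by simp [hs2]
      have gI : s2.imem = s1.imem := by simp [hs2]
      refine (rakeTail_runs (x := i) (y := w) hb hP (h1.congr (by simp [hs2]) (by simp [hs2]) g12
        (by simp [hs2]) gI (by simp [hs2])) hiA (by rw [gI]; exact hn) (by rw [gI]; exact hp0)
        (.inl ⟨rfl, by rw [gI, hw]⟩) (by rw [gI, h0]) (by simp [hs2]) (by simp [hs2])
        (by simp [hs2]) (by simp [hs2]) (by simp [hs2, k34])).mono ?_
      rintro t s' ⟨ht, e, A, M, E, h'⟩ t1 ht1 t2 ht2 t3 ht3 t4 ht4 t5 ht5 t6 ht6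
      simp only [Prog.cost] at ht1 ht2 ht3 ht4 ht5 ht6
      exact ⟨by omega, e, A, M, up, E, h'⟩
    intro hi0
    simp only [BExp.holds, IExp.eval, State.writeIReg_ireg, State.writeIReg_imem, if_false,
      Nat.reduceEqDiff, k5] at hi0
    refine Runs.ite ?_ ?_
    · intro h0
      simp only [BExp.holds, IExp.eval, State.writeIReg_ireg, State.writeIReg_imem, if_true] at h0
      unfold rakeFrom
      iterate 4
        refine Runs.wp_seq ?_
        simp only [wp, IExp.eval, State.writeIReg_ireg, State.writeIReg_imem, if_true, if_false,
          Nat.reduceEqDiff, k5]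
        refine ⟨by omega, ?_⟩
      obtain ⟨s2, hs2⟩ : ∃ s2, s2 = ((((s1.writeIReg 36 w).writeIReg 30 (s1.imem 6 w)).writeIReg 31
        (s1.imem 6 i)).writeIReg 32 i).writeIReg 35 w := ⟨_, rfl⟩
      rw [← hs2]
      have g12 : s2.ireg 12 = s1.ireg 12 := by simp [hs2]
      have gI : s2.imem = s1.imem := by simp [hs2]
      refine (rakeTail_runs (x := w) (y := i) hb hP (h1.congr (by simp [hs2]) (by simp [hs2]) g12
        (by simp [hs2]) gI (by simp [hs2])) hiA (by rw [gI]; exact hn) (by rw [gI]; exact hp0)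
        (.inr ⟨by rw [gI, hw], rfl⟩) (by rw [gI, h0]) (by simp [hs2]) (by simp [hs2])
        (by simp [hs2]) (by simp [hs2]) (by simp [hs2, k34])).mono ?_
      rintro t s' ⟨ht, e, A, M, E, h'⟩ t1 ht1 t2 ht2 t3 ht3 t4 ht4 t5 ht5 t6 ht6
      simp only [Prog.cost] at ht1 ht2 ht3 ht4 ht5 ht6
      exact ⟨by omega, e, A, M, up, E, h'⟩
    · intro hw0
      simp only [BExp.holds, IExp.eval, State.writeIReg_ireg, State.writeIReg_imem, if_true] at hw0
      refine Runs.skip ?_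
      intro t1 ht1 t2 ht2
      simp only [Prog.cost] at ht1 ht2
      refine ⟨by simp; omega, e, A, M, up, E, ?_⟩
      refine ScanState.congr (s := s1) ?_ (by simp) (by simp) (by simp) (by simp) (by simp)
        (by simp)
      exact ⟨h1.forest, h1.scan.hold hiA hn hp0 hi0 (by rw [hw]; exact hw0), h1.size, h1.alive,
        h1.up_mem, h1.up_notMem, h1.par_eq, h1.len_eq, h1.r_eq⟩
  · intro hp
    simp only [BExp.holds, IExp.eval, k34] at hp
    refine (Runs.of_wp (Q := fun s' => s' = s1.writeIMem 10 (up i) (i + 1)) ?_).mono ?_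
    · simp only [wp, IExp.eval, k34, k5, and_true]
      omega
    · rintro t s' ⟨ht, rfl⟩ t1 ht1
      simp only [Prog.cost] at ht ht1
      refine ⟨by simp; omega, e, A, M, up, E, ?_⟩
      refine ⟨h1.forest.congr rfl rfl ?_ rfl, ?_, h1.size, h1.alive, ?_, ?_, ?_, h1.len_eq, h1.r_eq⟩
      · intro a ha
        simp only [List.mem_cons, List.not_mem_nil, not_or, or_false] at ha
        simp [ha]
      · simpa using h1.scan.place hiA hn (by omega)
      · simpa using h1.up_mem
      · simpa using h1.up_notMem
      · simpa using h1.par_eq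

end

end RealRAM

namespace RealRAM

open Cluster

/-! ### Rounds -/

def resetVertex : Prog :=
  .setIMem 9 (.reg 5) (.lit 0) ;; .setIMem 10 (.reg 5) (.lit 0) ;;
  .setIReg 5 (.add (.reg 5) (.lit 1))

def countVertex : Prog :=
  .ite (.ilt (.lit 0) (.mem 8 (.reg 5)))
    (.setIMem 9 (.mem 8 (.reg 5)) (.add (.mem 9 (.mem 8 (.reg 5))) (.lit 1))) .skip ;;
  .setIReg 5 (.add (.reg 5) (.lit 1))

/-- The reset includes the entry `n`, since the virtual parent, too, has a child count and a waiting
place. -/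
def contractRound : Prog :=
  .setIReg 5 (.lit 0) ;;
  .while (.ilt (.reg 5) (.add (.reg 0) (.lit 1))) resetVertex ;;
  .setIReg 5 (.lit 0) ;;
  .while (.ilt (.reg 5) (.reg 0)) countVertex ;;
  .setIReg 5 (.lit 0) ;;
  .while (.ilt (.reg 5) (.reg 0)) (scanVertex ;; .setIReg 5 (.add (.reg 5) (.lit 1)))

def contractAll : Prog := .while (.ilt (.lit 1) (.reg 13)) contractRound

/-- The state between two rounds. -/
structure Contracted (n : ℕ) (par : ℕ → ℕ) (len r : ℕ → ℝ) (ρ : ℕ) (s : State)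
    (e : ℕ → Cluster) (A : Finset ℕ) (up : ℕ → ℕ) (E : ℕ → Cluster) : Prop where
  forest : IsForest n par len r s e A up E
  lt_up : ∀ v ∈ A, v < up v
  up_mem : ∀ v ∈ A, up v ∈ A ∨ up v = n
  root_unique : ∀ v ∈ A, ∀ w ∈ A, up v = n → up w = n → v = w
  depth_le : ∀ v ∈ A, (E v).depth ≤ ρ
  size : s.ireg 0 = n
  alive : s.ireg 13 = A.card
  imem_up : ∀ v ∈ A, s.imem 8 v = up v
  imem_zero : ∀ v < n, v ∉ A → s.imem 8 v = 0
  par_eq : s.imem 5 = par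
  len_eq : s.rmem 2 = len
  r_eq : s.rmem 3 = r

section

variable {n b : ℕ} {par : ℕ → ℕ} {len r : ℕ → ℝ} {s s' : State} {e : ℕ → Cluster}
  {A M : Finset ℕ} {up : ℕ → ℕ} {E : ℕ → Cluster} {ρ m : ℕ}

theorem Contracted.scanState (h : Contracted n par len r ρ s e A up E)
    (h9 : ∀ p ≤ n, s'.imem 9 p = childCount A up p) (h10 : ∀ p ≤ n, s'.imem 10 p = 0)
    (hreg : ∀ a, a ≠ 5 → s'.ireg a = s.ireg a) (hI : ∀ a, a ∉ [9, 10] → s'.imem a = s.imem a)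
    (hR : s'.rmem = s.rmem) : ScanState n par len r 0 ρ A.card s' e A ∅ up E := by
  have hle : ∀ p, p ∈ A ∨ p = n → p ≤ n := by
    rintro p (hp | rfl)
    · exact (Finset.mem_range.1 (h.forest.subset hp)).le
    · exact le_rfl
  refine ⟨h.forest.congr (hreg 11 (by decide)) (hreg 12 (by decide)) ?_ hR,
    ⟨h.forest.subset, h.lt_up, h.up_mem, h.root_unique, fun p hp => h9 p (hle p hp), ?_, by simp,
      by simp, by simp, by simp, by simp, ?_, fun v hv _ => h.depth_le v hv, by simp⟩,
    (hreg 0 (by decide)).trans h.size, (hreg 13 (by decide)).trans h.alive, ?_, ?_, ?_,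
    by rw [hR, h.len_eq], by rw [hR, h.r_eq]⟩
  · intro a ha
    refine hI a fun h' => ha (List.mem_cons_of_mem _ h')
  · intro p hp h0
    exact absurd (h10 p (hle p hp)) h0
  · exact fun v hv => (h.depth_le v hv).trans (Nat.le_succ _)
  · rw [hI 8 (by decide)]
    exact h.imem_up
  · rw [hI 8 (by decide)]
    exact h.imem_zero
  · rw [hI 5 (by decide), h.par_eq]

theorem ScanState.contracted (h : ScanState n par len r n ρ m s e A M up E) :
    Contracted n par len r (ρ + 1) s e A up E :=
  ⟨h.forest, h.scan.lt_up, h.scan.up_mem, h.scan.root_unique, h.scan.depth_le, h.size, h.alive,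
    h.up_mem, h.up_notMem, h.par_eq, h.len_eq, h.r_eq⟩

theorem resetLoop_runs (hnb : 2 * n + 1 < 2 ^ b) (h0 : s.ireg 0 = n) (h5 : s.ireg 5 = 0) :
    Runs b (.while (.ilt (.reg 5) (.add (.reg 0) (.lit 1))) resetVertex) s fun t s' =>
      t ≤ 4 * (n + 1) + 1 ∧ ∀ p ≤ n, s'.imem 9 p = 0 ∧ s'.imem 10 p = 0 := by
  refine (Runs.for (fun i s' => s'.ireg 5 = i ∧ s'.ireg 0 = n ∧
    ∀ p < i, s'.imem 9 p = 0 ∧ s'.imem 10 p = 0) 3 (n + 1) ?_ ?_ ?_).mono ?_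
  · rintro i s' - ⟨g5, g0, -⟩
    simp only [BExp.holds, IExp.eval, g5, g0]
  · rintro i s' hi ⟨g5, g0, g⟩
    refine (Runs.of_wp ?_).mono fun t s'' h => h
    simp only [resetVertex, wp, IExp.eval, State.writeIReg_ireg, State.writeIMem_ireg,
      State.writeIMem_imem, State.writeIReg_imem, if_true, if_false, Nat.reduceEqDiff, g5, g0,
      true_and, OfNat.zero_ne_ofNat]
    refine ⟨by omega, by omega, by omega, ?_⟩
    intro p hp
    by_cases hpi : p = i
    · subst hpi
      simp
    · rw [Function.update_of_ne hpi, Function.update_of_ne hpi]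
      exact g p (by omega)
  · exact ⟨h5, h0, by simp⟩
  · rintro t s' ⟨ht, -, -, g⟩
    exact ⟨ht, fun p hp => g p (by omega)⟩

theorem countLoop_runs (hnb : 2 * n + 1 < 2 ^ b) (hA : A ⊆ Finset.range n)
    (hup : ∀ v ∈ A, s.imem 8 v = up v ∧ 0 < up v ∧ up v ≤ n)
    (hup0 : ∀ v < n, v ∉ A → s.imem 8 v = 0) (h0 : s.ireg 0 = n) (h5 : s.ireg 5 = 0)
    (h9 : ∀ p ≤ n, s.imem 9 p = 0) :
    Runs b (.while (.ilt (.reg 5) (.reg 0)) countVertex) s fun t s' =>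
      t ≤ 5 * n + 1 ∧ ∀ p ≤ n, s'.imem 9 p = childCount A up p := by
  refine (Runs.for (fun i s' => s'.ireg 5 = i ∧ s'.ireg 0 = n ∧ s'.imem 8 = s.imem 8 ∧
    ∀ p ≤ n, s'.imem 9 p = childCount (A.filter (· < i)) up p) 4 n ?_ ?_ ?_).mono ?_
  · rintro i s' - ⟨g5, g0, -⟩
    simp only [BExp.holds, IExp.eval, g5, g0]
  · rintro i s' hi ⟨g5, g0, g8, g⟩
    refine (Runs.of_wp ?_).mono fun t s'' h => h
    simp only [countVertex, wp, IExp.eval, BExp.holds, State.writeIReg_ireg, State.writeIMem_ireg,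
      State.writeIMem_imem, State.writeIReg_imem, if_true, if_false, Nat.reduceEqDiff, g5, g0, g8,
      true_and, OfNat.zero_ne_ofNat]
    constructor
    · intro h8
      have hiA : i ∈ A := by
        by_contra hiA
        have := hup0 i hi hiA
        omega
      obtain ⟨e8, hpos, hle⟩ := hup i hiA
      have hc : childCount (A.filter (· < i)) up (up i) ≤ n := by
        refine (Finset.card_le_card (t := Finset.range n) ?_).trans (by simp)
        exact (Finset.filter_subset _ _).trans ((Finset.filter_subset _ _).trans hA)
      rw [e8, g _ hle]
      refine ⟨by omega, by omega, ?_⟩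
      intro p hp
      have hins : A.filter (· < i + 1) = insert i (A.filter (· < i)) := by
        ext z
        simp only [Finset.mem_filter, Finset.mem_insert]
        constructor
        · intro hz
          by_cases hzi : z = i
          · exact .inl hzi
          · exact .inr ⟨hz.1, by omega⟩
        · rintro (rfl | hz)
          · exact ⟨hiA, by omega⟩
          · exact ⟨hz.1, by omega⟩
      unfold childCount at g ⊢
      rw [hins, Finset.filter_insert]
      by_cases hpi : up i = p
      · subst hpi
        rw [Function.update_self, if_pos rfl, Finset.card_insert_of_notMem (by simp)]
      · rw [Function.update_of_ne (Ne.symm hpi), if_neg hpi, g p hp]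
    · intro h8
      have hiA : i ∉ A := by
        intro hiA
        have := hup i hiA
        omega
      refine ⟨by omega, ?_⟩
      intro p hp
      rw [g p hp]
      congr 1
      ext z
      simp only [Finset.mem_filter]
      refine and_congr_right fun hz => ?_
      have : z ≠ i := fun h => hiA (h ▸ hz)
      omega
  · exact ⟨h5, h0, rfl, fun p hp => by simp [h9 p hp, childCount]⟩
  · rintro t s' ⟨ht, -, -, -, g⟩
    refine ⟨ht, fun p hp => ?_⟩
    rw [g p hp, Finset.filter_true_of_mem fun z hz => Finset.mem_range.1 (hA hz)]

/-- The potential is `62` for each vertex still to be scanned and `30` for each storage cell still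
available under the bound for this round. -/
theorem scanLoop_runs (hb : 64 * (n + 1) ^ 2 < 2 ^ b)
    (hP : 2 * (n * (ρ + 2)) + 2 * n ≤ 50 * (n + 1) ^ 2)
    (h : ScanState n par len r 0 ρ m s e A M up E) (h5 : s.ireg 5 = 0) :
    Runs b (.while (.ilt (.reg 5) (.reg 0)) (scanVertex ;; .setIReg 5 (.add (.reg 5) (.lit 1)))) s
      fun t s' => t + 30 * s.ireg 12 ≤ 62 * n + 1 + 30 * s'.ireg 12 ∧
        ∃ e A M up E, ScanState n par len r n ρ m s' e A M up E := by
  have hnb : 2 * n + 1 < 2 ^ b := by nlinarith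
  have hst : ∀ {i s e A M up E}, ScanState n par len r i ρ m s e A M up E →
      s.ireg 12 ≤ 2 * (n * (ρ + 2)) := fun h => h.forest.storage_le h.scan.depth_le
  refine (Runs.while (fun f s' => ∃ i ≤ n, s'.ireg 5 = i ∧
    (∃ e A M up E, ScanState n par len r i ρ m s' e A M up E) ∧
    f = 62 * (n - i) + 30 * (2 * (n * (ρ + 2)) - s'.ireg 12)) ?_
    ⟨0, by omega, h5, ⟨e, A, M, up, E, h⟩, rfl⟩).mono ?_
  · rintro f s1 ⟨i, -, h5, ⟨e, A, M, up, E, h⟩, rfl⟩ hlt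
    simp only [BExp.holds, IExp.eval, h5, h.size] at hlt
    refine Runs.seq ((scanVertex_runs hb hP h hlt h5).mono_frame ?_)
    rintro t s2 ⟨ht, e, A, M, up, E, h2⟩ F
    have g5 := (F.ireg 5 (by decide)).trans h5
    refine (Runs.of_wp (Q := fun s' => s' = s2.writeIReg 5 (i + 1)) ?_).mono ?_
    · simp only [wp, IExp.eval, g5, and_true]
      omega
    · rintro t' s3 ⟨ht', rfl⟩
      simp only [Prog.cost] at ht'
      have h3 : ScanState n par len r (i + 1) ρ m (s2.writeIReg 5 (i + 1)) e A M up E :=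
        h2.congr (by simp) (by simp) (by simp) (by simp) (by simp) (by simp)
      refine ⟨_, ?_, i + 1, hlt, by simp, ⟨e, A, M, up, E, h3⟩, rfl⟩
      have h4 := hst h
      have h5 := hst h2
      simp only [State.writeIReg_ireg, Nat.reduceEqDiff, if_false]
      omega
  · rintro t s' ⟨f, hf, ⟨i, hi, h5', ⟨e, A, M, up, E, h'⟩, rfl⟩, hlt⟩
    simp only [BExp.holds, IExp.eval, h5', h'.size] at hlt
    obtain rfl : i = n := by omega
    have h4 := hst h
    have h5 := hst h'
    exact ⟨by omega, e, A, M, up, E, h'⟩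

theorem contractRound_runs (hb : 64 * (n + 1) ^ 2 < 2 ^ b)
    (hP : 2 * (n * (ρ + 2)) + 2 * n ≤ 50 * (n + 1) ^ 2)
    (h : Contracted n par len r ρ s e A up E) (hA : 2 ≤ A.card) :
    Runs b contractRound s fun t s' => t + 30 * s.ireg 12 ≤ 80 * n + 30 * s'.ireg 12 ∧
      ∃ e A' up E, Contracted n par len r (ρ + 1) s' e A' up E ∧ 1 ≤ A'.card ∧
        6 * A'.card ≤ 5 * A.card := by
  have hnb : 2 * n + 1 < 2 ^ b := by nlinarith
  have hAn : A.card ≤ n := (Finset.card_le_card h.forest.subset).trans (by simp)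
  have hup : ∀ v ∈ A, s.imem 8 v = up v ∧ 0 < up v ∧ up v ≤ n := by
    intro v hv
    have h1 := h.lt_up v hv
    refine ⟨h.imem_up v hv, by omega, ?_⟩
    rcases h.up_mem v hv with h' | h'
    · exact (Finset.mem_range.1 (h.forest.subset h')).le
    · exact h'.le
  unfold contractRound
  refine Runs.wp_seq ?_
  simp only [wp, IExp.eval]
  refine ⟨by omega, Runs.seq ((resetLoop_runs hnb (by simp [h.size]) (by simp)).mono_frame ?_)⟩
  rintro t1 s1 ⟨ht1, g9⟩ F1
  refine Runs.wp_seq ?_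
  simp only [wp, IExp.eval]
  have e0 : s1.ireg 0 = n := by rw [F1.ireg 0 (by decide)]; simp [h.size]
  have e8 : s1.imem 8 = s.imem 8 := by rw [F1.imem 8 (by decide)]; simp
  refine ⟨by omega, Runs.seq ((countLoop_runs (A := A) (up := up) hnb h.forest.subset
    (by simpa [e8] using hup) (by simpa [e8] using h.imem_zero) (by simp [e0]) (by simp)
    (fun p hp => by simpa using (g9 p hp).1)).mono_frame ?_)⟩
  rintro t2 s2 ⟨ht2, g9'⟩ F2
  refine Runs.wp_seq ?_
  simp only [wp, IExp.eval]
  refine ⟨by omega, ?_⟩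
  obtain ⟨s3, hs3⟩ : ∃ s3, s3 = s2.writeIReg 5 0 := ⟨_, rfl⟩
  rw [← hs3]
  have hreg : ∀ a, a ≠ 5 → s3.ireg a = s.ireg a := by
    intro a ha
    rw [hs3, State.writeIReg_ireg, if_neg ha,
      F2.ireg a (by simpa [countVertex, Prog.iregs] using ha), State.writeIReg_ireg, if_neg ha,
      F1.ireg a (by simpa [resetVertex, Prog.iregs] using ha), State.writeIReg_ireg, if_neg ha]
  have hI : ∀ a, a ∉ [9, 10] → s3.imem a = s.imem a := by
    intro a ha
    simp only [List.mem_cons, List.not_mem_nil, not_or, or_false] at ha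
    rw [hs3, State.writeIReg_imem, F2.imem a (by simpa [countVertex, Prog.imems] using ha.1),
      State.writeIReg_imem, F1.imem a (by simpa [resetVertex, Prog.imems] using ha),
      State.writeIReg_imem]
  have hR : s3.rmem = s.rmem := by
    funext a
    rw [hs3, State.writeIReg_rmem, F2.rmem a (by simp [countVertex, Prog.rmems]),
      State.writeIReg_rmem, F1.rmem a (by simp [resetVertex, Prog.rmems]), State.writeIReg_rmem]
  have g10 : ∀ p ≤ n, s3.imem 10 p = 0 := by
    intro p hp
    rw [hs3, State.writeIReg_imem, F2.imem 10 (by decide), State.writeIReg_imem, (g9 p hp).2]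
  have hscan := h.scanState (s' := s3) (fun p hp => by rw [hs3]; exact g9' p hp) g10 hreg hI hR
  refine (scanLoop_runs hb hP hscan (by simp [hs3])).mono ?_
  rintro t3 s4 ⟨ht3, e, A', M, up, E, h'⟩ t4 ht4 t5 ht5 t6 ht6
  simp only [Prog.cost] at ht4 ht5 ht6
  rw [hreg 12 (by decide)] at ht3
  exact ⟨by omega, e, A', up, E, h'.contracted, h'.scan.card_pos (by omega), h'.scan.card_le hA⟩

/-- Four rounds at least halve the number of clusters, because `2 * 5 ^ 4 = 1250 ≤ 1296 = 6 ^ 4`; so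
`4 * L` rounds would bring a number below `2 ^ L` under `1`. -/
theorem pow_lt_of_contracted {L ρ a : ℕ} (hn : n < 2 ^ L) (ha : 1 ≤ a)
    (h : a * 6 ^ ρ ≤ n * 5 ^ ρ) : ρ < 4 * L := by
  by_contra! hρ
  obtain ⟨d, rfl⟩ := Nat.exists_eq_add_of_le hρ
  have h1 : 2 ^ L * 5 ^ (4 * L + d) ≤ 6 ^ (4 * L + d) := by
    rw [pow_add, pow_add, pow_mul, pow_mul, ← mul_assoc, ← mul_pow]
    exact Nat.mul_le_mul (Nat.pow_le_pow_left (by norm_num) L) (Nat.pow_le_pow_left (by norm_num) d)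
  have h2 : n * 5 ^ (4 * L + d) < 2 ^ L * 5 ^ (4 * L + d) :=
    Nat.mul_lt_mul_of_pos_right hn (by positivity)
  have h3 := Nat.mul_le_mul_right (6 ^ (4 * L + d)) ha
  omega

/-- Besides the joins, each of at most `4 * L` rounds costs `80 * n`; the joins are charged to at
most `10 * (n * L)` storage cells. The depth grows by at most one per round. -/
theorem contractAll_runs (hb : 64 * (n + 1) ^ 2 < 2 ^ b) {L : ℕ} (hn : n < 2 ^ L) (hL : L ≤ n)
    (h : Contracted n par len r 0 s e A up E) (hA : 1 ≤ A.card) :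
    Runs b contractAll s fun t s' => t ≤ 700 * (n * L) + 1 ∧
      ∃ e A up E, Contracted n par len r (4 * L) s' e A up E ∧ A.card = 1 := by
  have hn1 : 1 ≤ n := hA.trans ((Finset.card_le_card h.forest.subset).trans (by simp))
  have hL1 : 1 ≤ L := by
    by_contra! h0
    obtain rfl : L = 0 := by omega
    omega
  have hnL : n * 1 ≤ n * L := Nat.mul_le_mul_left n hL1
  have hst : ∀ {ρ s e A up E}, Contracted n par len r ρ s e A up E → ρ ≤ 4 * L →
      s.ireg 12 ≤ 10 * (n * L) := by
    intro ρ s e A up E h hρ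
    have h1 := h.forest.storage_le h.depth_le
    have h2 : n * (ρ + 1) ≤ n * (4 * L + 1) := Nat.mul_le_mul_left n (by omega)
    have h3 : n * (4 * L + 1) = 4 * (n * L) + n := by ring
    omega
  unfold contractAll
  refine (Runs.while (fun f s' => ∃ ρ e A up E, Contracted n par len r ρ s' e A up E ∧
    1 ≤ A.card ∧ ρ ≤ 4 * L ∧ A.card * 6 ^ ρ ≤ n * 5 ^ ρ ∧
    f = (80 * n + 1) * (4 * L - ρ) + 30 * (10 * (n * L) - s'.ireg 12)) ?_
    ⟨0, e, A, up, E, h, hA, by omega, by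
      simpa using (Finset.card_le_card h.forest.subset).trans (by simp), rfl⟩).mono ?_
  · rintro f s1 ⟨ρ, e, A, up, E, h1, hA1, hρ, hc, rfl⟩ h2
    simp only [BExp.holds, IExp.eval, h1.alive] at h2
    have hρ' : ρ < 4 * L := pow_lt_of_contracted hn hA1 hc
    -- From `ρ < 4 * L` and `L ≤ n` the storage stays quadratic in `n`, so all addresses fit into
    -- words.
    have hP : 2 * (n * (ρ + 2)) + 2 * n ≤ 50 * (n + 1) ^ 2 := by
      have : n * (ρ + 2) ≤ n * (4 * n + 1) := Nat.mul_le_mul_left n (by omega)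
      nlinarith
    refine (contractRound_runs hb hP h1 h2).mono ?_
    rintro t s2 ⟨ht, e', A', up', E', h3, hA', hcard⟩
    refine ⟨_, ?_, ρ + 1, e', A', up', E', h3, hA', hρ', ?_, rfl⟩
    · have h4 := hst h1 hρ
      have h5 := hst h3 hρ'
      obtain ⟨d, hd⟩ : ∃ d, 4 * L - ρ = d + 1 := ⟨4 * L - ρ - 1, by omega⟩
      rw [show 4 * L - (ρ + 1) = d by omega, hd, Nat.mul_add_one (80 * n + 1)]
      omega
    · calc A'.card * 6 ^ (ρ + 1) = 6 * A'.card * 6 ^ ρ := by ring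
        _ ≤ 5 * A.card * 6 ^ ρ := Nat.mul_le_mul_right _ hcard
        _ = 5 * (A.card * 6 ^ ρ) := by ring
        _ ≤ 5 * (n * 5 ^ ρ) := Nat.mul_le_mul_left _ hc
        _ = n * 5 ^ (ρ + 1) := by ring
  · rintro t s' ⟨f, hf, ⟨ρ, e, A, up, E, h1, hA1, hρ, -, rfl⟩, h2⟩
    simp only [BExp.holds, IExp.eval, h1.alive] at h2
    refine ⟨?_, e, A, up, E, ⟨h1.forest, h1.lt_up, h1.up_mem, h1.root_unique,
      fun v hv => (h1.depth_le v hv).trans hρ, h1.size, h1.alive, h1.imem_up, h1.imem_zero,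
      h1.par_eq, h1.len_eq, h1.r_eq⟩, by omega⟩
    have h3 : (80 * n + 1) * (4 * L - 0) = 320 * (n * L) + 4 * L := by
      rw [Nat.sub_zero]
      ring
    have h4 : 1 * L ≤ n * L := Nat.mul_le_mul_right L hn1
    omega

theorem Contracted.of_initial (h : IsForest n par len r s .base (Finset.range n) par .base)
    (h8 : ∀ j < n, s.imem 8 j = par j) (h13 : s.ireg 13 = n) (h0 : s.ireg 0 = n)
    (h5 : s.imem 5 = par) (h2 : s.rmem 2 = len) (h3 : s.rmem 3 = r)
    (hlt : ∀ j < n, j < par j) (hle : ∀ j < n, par j ≤ n)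
    (hroot : ∀ j < n, par j = n → j = n - 1) :
    Contracted n par len r 0 s .base (Finset.range n) par .base := by
  refine ⟨h, fun v hv => hlt v (Finset.mem_range.1 hv), ?_, ?_, fun v _ => le_rfl, h0,
    by rw [h13, Finset.card_range], fun v hv => h8 v (Finset.mem_range.1 hv), ?_, h5, h2, h3⟩
  · intro v hv
    have := hle v (Finset.mem_range.1 hv)
    rw [Finset.mem_range]
    omega
  · intro v hv w hw h1 h2
    rw [hroot v (Finset.mem_range.1 hv) h1, hroot w (Finset.mem_range.1 hw) h2]
  · exact fun v hv hv' => absurd (Finset.mem_range.2 hv) hv'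

end

end RealRAM

/-! ## Queries -/

namespace Cluster

theorem atLeast_perm {d : ℝ} {L M : List ℝ} (h : L.Perm M) : atLeast d L = atLeast d M :=
  h.countP_eq _

theorem atLeast_le (d : ℝ) (L : List ℝ) : atLeast d L ≤ L.length := List.countP_le_length

/-- In a descending list, a binary search position below `h` determines the number of entries that
are at least `d`. -/
theorem atLeast_slice {f : ℕ → ℝ} {o m x h : ℕ} {d : ℝ} (hs : (slice f o m).Pairwise (· ≥ ·))
    (hm : h ≤ m) (hx : x ≤ h) (h1 : ∀ i < x, d ≤ f (o + i)) (h2 : x = h ∨ f (o + x) < d) :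
    x = min h (atLeast d (slice f o m)) := by
  classical
  have hsplit : slice f o m = slice f o x ++ slice f (o + x) (m - x) := by
    refine List.ext_getElem (by simp; omega) fun i h1 h2 => ?_
    rw [slice_getElem, List.getElem_append]
    split_ifs with h3
    · rw [slice_getElem]
    · rw [slice_getElem]
      rw [slice_length] at h3 ⊢
      congr 1
      omega
  have hfst : atLeast d (slice f o x) = x := by
    have : atLeast d (slice f o x) = (slice f o x).length := by
      refine List.countP_eq_length.2 fun a ha => ?_
      obtain ⟨i, hi, rfl⟩ := List.mem_map.1 ha
      simpa using h1 i (List.mem_range.1 hi)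
    rw [this, slice_length]
  have hsum : atLeast d (slice f o m) = x + atLeast d (slice f (o + x) (m - x)) := by
    rw [hsplit, atLeast_append, hfst]
  rcases h2 with rfl | h2
  · omega
  · by_cases hxm : x = m
    · omega
    · have hsnd : atLeast d (slice f (o + x) (m - x)) = 0 := by
        refine List.countP_eq_zero.2 fun a ha => ?_
        obtain ⟨i, hi, rfl⟩ := List.mem_map.1 ha
        rw [List.mem_range] at hi
        have hle : f (o + x + i) ≤ f (o + x) := by
          rcases Nat.eq_zero_or_pos i with rfl | hi0
          · simp
          · have := List.pairwise_iff_getElem.1 hs x (x + i) (by simp; omega) (by simp; omega)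
              (by omega)
            rw [slice_getElem, slice_getElem, ← Nat.add_assoc] at this
            exact this
        simpa using hle.trans_lt h2
      omega

end Cluster

/-! ### Binary search and the climb through the hierarchy -/

namespace RealRAM

open Cluster

/-- Binary search for the real register `12` in the list at register `14`, between the positions in
registers `15, 16`. -/
def search : Prog :=
  .while (.ilt (.reg 15) (.reg 16))
    (.setIReg 17 (.div (.add (.reg 15) (.reg 16)) (.lit 2)) ;;
      .ite (.rle (.reg 12) (.mem 4 (.add (.reg 14) (.reg 17))))
        (.setIReg 15 (.add (.reg 17) (.lit 1))) (.setIReg 16 (.reg 17)))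

/-- Only the first `h` entries are searched, so the number of halvings depends on `h` and not on the
length `m` of the list, and the result is the count truncated at `h`. This is the source of `log k`
in the query time. -/
theorem search_runs {b o m h F : ℕ} {d : ℝ} {s : State} (h14 : s.ireg 14 = o) (h15 : s.ireg 15 = 0)
    (h16 : s.ireg 16 = h) (hd : s.rreg 12 = d) (hm : h ≤ m) (hF : h < 2 ^ F) (hb : m + 1 < 2 ^ b)
    (hs : (slice (s.rmem 4) o m).Pairwise (· ≥ ·)) :
    Runs b search s fun t s' => t ≤ 5 * F + 1 ∧
      s'.ireg 15 = min h (atLeast d (slice (s.rmem 4) o m)) := by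
  generalize hf : s.rmem 4 = f at *
  refine (Runs.while (fun g s' => ∃ φ, g = 5 * φ ∧ s'.ireg 16 - s'.ireg 15 < 2 ^ φ ∧
    s'.ireg 15 ≤ s'.ireg 16 ∧ s'.ireg 16 ≤ h ∧ s'.ireg 14 = o ∧ s'.rreg 12 = d ∧
    s'.rmem 4 = f ∧ (∀ i < s'.ireg 15, d ≤ f (o + i)) ∧
    (s'.ireg 16 = h ∨ f (o + s'.ireg 16) < d)) ?_ (f := 5 * F)
    ⟨F, rfl, by omega, by omega, by omega, h14, hd, hf, by simp [h15], .inl h16⟩).mono ?_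
  · rintro g s' ⟨φ, rfl, hφ, hle, hle', h14, hd, hf, hlo, hhi⟩ hlt
    simp only [BExp.holds, IExp.eval] at hlt
    obtain ⟨ψ, rfl⟩ : ∃ ψ, φ = ψ + 1 := by
      cases φ with
      | zero => simp at hφ; omega
      | succ ψ => exact ⟨ψ, rfl⟩
    generalize hx : s'.ireg 15 = x at *
    generalize hy : s'.ireg 16 = y at *
    have hmid : (x + y) / 2 < y := by omega
    have hmid' : x ≤ (x + y) / 2 := by omega
    have hup : ∀ i < m, ∀ j < i, f (o + i) ≤ f (o + j) := by
      intro i hi j hj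
      have := List.pairwise_iff_getElem.1 hs j i (by simp; omega) (by simpa using hi) hj
      rwa [slice_getElem, slice_getElem] at this
    rw [pow_succ] at hφ
    refine (Runs.of_wp (Q := fun s'' => s''.ireg 16 - s''.ireg 15 < 2 ^ ψ ∧
      s''.ireg 15 ≤ s''.ireg 16 ∧ s''.ireg 16 ≤ h ∧ s''.ireg 14 = o ∧ s''.rreg 12 = d ∧
      s''.rmem 4 = f ∧ (∀ i < s''.ireg 15, d ≤ f (o + i)) ∧
      (s''.ireg 16 = h ∨ f (o + s''.ireg 16) < d)) ?_).mono ?_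
    · simp only [wp, IExp.eval, RExp.eval, BExp.holds, State.writeIReg_ireg, State.writeIReg_rreg,
        State.writeIReg_rmem, if_true, if_false, Nat.reduceEqDiff, hx, hy, h14, hd, hf, true_and]
      refine ⟨by omega, fun h1 => ⟨by omega, by omega, by omega, by omega, ?_, hhi⟩,
        fun h1 => ⟨by omega, by omega, by omega, by omega, hlo, .inr (not_le.1 h1)⟩⟩
      intro i hi
      by_cases him : i = (x + y) / 2
      · rwa [him]
      · exact h1.trans (hup _ (by omega) i (by omega))
    · rintro t s'' ⟨ht, h'⟩
      simp only [Prog.cost] at ht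
      exact ⟨5 * ψ, by omega, ψ, rfl, h'⟩
  · rintro t s' ⟨g, hg, ⟨φ, rfl, -, hle, hle', -, -, -, hlo, hhi⟩, hlt⟩
    simp only [BExp.holds, IExp.eval] at hlt
    have he : s'.ireg 16 = s'.ireg 15 := by omega
    rw [he] at hle' hhi
    exact ⟨by omega, atLeast_slice hs hm hle' hlo hhi⟩

/-- Fetch the sibling of the node in register `10`, and what the search in its lists needs. -/
def climbPrep : Prog :=
  .setIReg 11 (.mem 16 (.reg 10)) ;; .setIReg 12 (.mem 15 (.reg 10)) ;;
  .ite (.ieq (.reg 12) (.lit 4)) (.setIReg 13 (.reg 19) ;; .setRReg 12 (.reg 10))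
    (.setIReg 13 (.reg 20) ;; .setRReg 12 (.reg 11)) ;;
  .ite (.ieq (.reg 12) (.lit 3)) (.setIReg 14 (.mem 13 (.reg 11)) ;; .setRReg 13 (.mem 6 (.reg 11)))
    (.setIReg 14 (.mem 12 (.reg 11)) ;; .setRReg 13 (.mem 7 (.reg 11))) ;;
  .setIReg 15 (.lit 0) ;;
  .ite (.ieq (.reg 13) (.lit 1))
    (.ite (.ilt (.mem 11 (.reg 11)) (.reg 1)) (.setIReg 16 (.mem 11 (.reg 11)))
      (.setIReg 16 (.reg 1)))
    (.setIReg 16 (.lit 0))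

/-- Add the count for the sibling and pass to the parent. -/
def climbUpdate : Prog :=
  .setIReg 18 (.add (.reg 18) (.reg 15)) ;;
  .ite (.and (.ieq (.reg 13) (.lit 1)) (.rle (.reg 12) (.reg 13)))
    (.setIReg 13 (.lit 1)) (.setIReg 13 (.lit 0)) ;;
  .setRReg 12 (.add (.reg 12) (.mem 5 (.reg 11))) ;;
  .ite (.ieq (.reg 12) (.lit 2)) .skip
    (.ite (.ieq (.reg 12) (.lit 3)) (.setIReg 20 (.reg 13) ;; .setRReg 11 (.reg 12))
      (.setIReg 19 (.reg 13) ;; .setRReg 10 (.reg 12))) ;;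
  .setIReg 10 (.mem 14 (.reg 10))

def climbStep : Prog := climbPrep ;; search ;; climbUpdate

def climb : Prog := .while (.ilt (.lit 0) (.mem 15 (.reg 10))) climbStep

def locate : Prog :=
  .setIReg 5 (.mem 4 (.reg 2)) ;; .setIReg 6 (.mem 4 (.reg 3)) ;;
  .ite (.ilt (.reg 6) (.reg 5))
    (.setIReg 10 (.reg 6) ;; .setRReg 10 (.sub (.mem 2 (.reg 6)) (.reg 1)) ;; .setRReg 11 (.reg 1))
    (.setIReg 10 (.reg 5) ;; .setRReg 10 (.reg 1) ;; .setRReg 11 (.sub (.mem 2 (.reg 5)) (.reg 1)))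

def queryInit : Prog :=
  .ite (.rle (.reg 10) (.mem 3 (.reg 10))) (.setIReg 19 (.lit 1)) (.setIReg 19 (.lit 0)) ;;
  .ite (.rle (.reg 11) (.mem 3 (.mem 5 (.reg 10)))) (.setIReg 20 (.lit 1))
    (.setIReg 20 (.lit 0)) ;;
  .setIReg 18 (.reg 19)

def answer : Prog :=
  .ite (.rlt (.reg 0) (.lit 0)) (.setIReg 4 (.lit 0))
    (locate ;; queryInit ;; climb ;;
      .ite (.ilt (.reg 18) (.reg 1)) (.setIReg 4 (.lit 0)) (.setIReg 4 (.lit 1)))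

/-- The hierarchy of clusters in memory, of depth at most `H`, with the cluster `e i` at node
`i < N`. -/
structure Hierarchy (n : ℕ) (par : ℕ → ℕ) (len r : ℕ → ℝ) (N P H : ℕ) (s : State)
    (e : ℕ → Cluster) : Prop where
  node : ∀ i < N, StoresNode par len r P s (e i) i
  wf : ∀ i < N, (e i).WF par n
  linked : ∀ i < N, Linked N s e i
  root : ∀ i < N, s.imem 15 i = 0 → (e i).mem = Finset.range n
  depth_le : ∀ i < N, (e i).depth ≤ H
  base : ∀ j < n, e j = .base j

section

variable {n b N P H : ℕ} {par : ℕ → ℕ} {len r : ℕ → ℝ} {s s' : State} {e : ℕ → Cluster}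

theorem Hierarchy.congr (h : Hierarchy n par len r N P H s e) (hI : s'.imem = s.imem)
    (hR : s'.rmem = s.rmem) : Hierarchy n par len r N P H s' e := by
  refine ⟨fun i hi => (h.node i hi).congr le_rfl (by rw [hI]) (by rw [hI]) (by rw [hI])
    (fun _ _ => by rw [hR]) (by rw [hR]) (by rw [hR]) (by rw [hR]), h.wf, ?_, ?_, h.depth_le,
    h.base⟩
  · intro i hi
    have := h.linked i hi
    unfold Linked at this ⊢
    rwa [hI]
  · rw [hI]
    exact h.root

theorem Contracted.hierarchy {ρ : ℕ} {A : Finset ℕ} {up : ℕ → ℕ} {E : ℕ → Cluster}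
    (h : Contracted n par len r ρ s e A up E) (hA : A.card = 1) :
    Hierarchy n par len r (s.ireg 11) (s.ireg 12) ρ s e := by
  obtain ⟨v, rfl⟩ := Finset.card_eq_one.1 hA
  have hf := h.forest
  have hroot : ∀ i < s.ireg 11, s.imem 15 i = 0 → e i = E v := by
    intro i hi h0
    obtain ⟨w, hw, rfl⟩ := hf.root i hi h0
    rw [hf.cluster w hw, Finset.mem_singleton.1 hw]
  refine ⟨hf.node, hf.wf, hf.linked, ?_, ?_, hf.base⟩
  · intro i hi h0
    ext z
    rw [Finset.mem_range]
    refine ⟨fun hz => (hf.wf i hi).lt hz, fun hz => ?_⟩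
    obtain ⟨w, hw, hz⟩ := hf.cover z hz
    rwa [hroot i hi h0, ← Finset.mem_singleton.1 hw]
  · intro i hi
    -- A node of maximal depth has no parent, which would be deeper still. So its cluster is the one
    -- remaining cluster, whose depth is known.
    obtain ⟨c, hc, hmax⟩ := Finset.exists_max_image (Finset.range (s.ireg 11))
      (fun i => (e i).depth) ⟨i, Finset.mem_range.2 hi⟩
    rw [Finset.mem_range] at hc
    refine (hmax i (Finset.mem_range.2 hi)).trans ?_
    rcases hf.linked c hc with h0 | ⟨hp, -, hk⟩
    · rw [hroot c hc h0]
      exact h.depth_le v (Finset.mem_singleton_self v)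
    · have := hmax _ (Finset.mem_range.2 hp)
      rcases hk with ⟨-, hk⟩ | ⟨-, hk⟩ | ⟨-, hk⟩ | ⟨-, hk⟩ <;>
      · rw [hk] at this
        simp only [Cluster.depth] at this
        omega

/-- The state of the climb at a node whose cluster is `C`. -/
structure ClimbState (n k : ℕ) (par : ℕ → ℕ) (j : ℕ) (D : ℕ → ℝ) (G : ℕ → Prop) (C : Cluster)
    (s : State) : Prop where
  mem : j ∈ C.mem
  count : min k (s.ireg 18) = min k (C.reached G)
  count_le : s.ireg 18 ≤ C.mem.card
  bot_flag : s.ireg 19 = 1 ↔ G C.bot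
  bot_flag_le : s.ireg 19 ≤ 1
  top_flag : s.ireg 20 = 1 ↔ G (C.top par)
  top_flag_le : s.ireg 20 ≤ 1
  bot_dist : s.rreg 10 = D C.bot
  top_dist : s.rreg 11 = D (C.top par)

/-- For kind `4` the sibling hangs below and is entered at the bottom of the present cluster,
otherwise at its top. Only for kind `3` is this entry the bottom of the sibling, which calls for its
other list. If the entry is not reached, the search interval is empty. -/
theorem climbPrep_runs {k : ℕ} (h1 : s.ireg 1 = k) {c d κ : ℕ} (hc : s.ireg 10 = c)
    (hd : s.imem 16 c = d) (hκ : s.imem 15 c = κ) (b1 : d < 2 ^ b) (b2 : κ < 2 ^ b)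
    (b3 : s.ireg 19 < 2 ^ b) (b4 : s.ireg 20 < 2 ^ b) (b5 : s.imem 12 d < 2 ^ b)
    (b6 : s.imem 13 d < 2 ^ b) (b7 : k < 2 ^ b) :
    Runs b climbPrep s fun t s' => t ≤ 18 ∧ s'.ireg 11 = d ∧ s'.ireg 12 = κ ∧
      s'.ireg 13 = (if κ = 4 then s.ireg 19 else s.ireg 20) ∧
      s'.rreg 12 = (if κ = 4 then s.rreg 10 else s.rreg 11) ∧
      s'.ireg 14 = (if κ = 3 then s.imem 13 d else s.imem 12 d) ∧
      s'.rreg 13 = (if κ = 3 then s.rmem 6 d else s.rmem 7 d) ∧ s'.ireg 15 = 0 ∧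
      s'.ireg 16 = if (if κ = 4 then s.ireg 19 else s.ireg 20) = 1 then min (s.imem 11 d) k
        else 0 := by
  refine (Runs.of_wp ?_).mono fun t s' h => h
  have b0 : (0 : ℕ) < 2 ^ b := by positivity
  simp only [climbPrep, wp, IExp.eval, RExp.eval, BExp.holds, State.writeIReg_ireg,
    State.writeRReg_ireg, State.writeIReg_rreg, State.writeRReg_rreg, State.writeIReg_imem,
    State.writeRReg_imem, State.writeIReg_rmem, State.writeRReg_rmem, if_true, if_false,
    Nat.reduceEqDiff, true_and, and_true, h1, hc, hd, hκ, b1, b2, b3, b4, b5, b6, b7, b0,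
    OfNat.one_ne_ofNat]
  by_cases h4 : κ = 4
  · subst h4
    by_cases h5 : s.ireg 19 = 1
    · simp only [h5, if_true, if_false, Nat.reduceEqDiff, true_and, and_true, not_true_eq_false,
        false_imp_iff, forall_const, not_false_eq_true]
      exact ⟨fun h => ⟨h.trans b7, by omega⟩, fun h => by omega⟩
    · simp [h5, b0]
  · by_cases h3 : κ = 3
    · subst h3
      by_cases h5 : s.ireg 20 = 1
      · simp only [h5, if_true, if_false, Nat.reduceEqDiff, true_and, and_true, not_true_eq_false,
          false_imp_iff, forall_const, not_false_eq_true]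
        exact ⟨fun h => ⟨h.trans b7, by omega⟩, fun h => by omega⟩
      · simp [h5, b0]
    · by_cases h5 : s.ireg 20 = 1
      · simp only [h3, h4, h5, if_true, if_false, Nat.reduceEqDiff, true_and, and_true,
          not_true_eq_false, false_imp_iff, forall_const, not_false_eq_true]
        exact ⟨fun h => ⟨h.trans b7, by omega⟩, fun h => by omega⟩
      · simp [h3, h4, h5, b0]

open Classical in
-- Kind `2` changes neither boundary vertex, kind `3` moves the top, and kinds `1` and `4` move the
-- bottom to that of the sibling.
theorem climbUpdate_runs {c d κ : ℕ} (hc : s.ireg 10 = c) (hd : s.ireg 11 = d)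
    (hκ : s.ireg 12 = κ) (b1 : s.ireg 18 + s.ireg 15 < 2 ^ b) (b2 : s.imem 14 c < 2 ^ b)
    (b3 : 1 < 2 ^ b) :
    Runs b climbUpdate s fun t s' => t ≤ 13 ∧ s'.ireg 18 = s.ireg 18 + s.ireg 15 ∧
      s'.ireg 10 = s.imem 14 c ∧
      (s'.ireg 20 = if κ = 3 then (if s.ireg 13 = 1 ∧ s.rreg 12 ≤ s.rreg 13 then 1 else 0)
        else s.ireg 20) ∧
      (s'.rreg 11 = if κ = 3 then s.rreg 12 + s.rmem 5 d else s.rreg 11) ∧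
      (s'.ireg 19 = if κ = 2 ∨ κ = 3 then s.ireg 19
        else (if s.ireg 13 = 1 ∧ s.rreg 12 ≤ s.rreg 13 then 1 else 0)) ∧
      s'.rreg 10 = if κ = 2 ∨ κ = 3 then s.rreg 10 else s.rreg 12 + s.rmem 5 d := by
  refine (Runs.of_wp ?_).mono fun t s' h => h
  have b0 : (0 : ℕ) < 2 ^ b := by positivity
  simp only [climbUpdate, wp, IExp.eval, RExp.eval, BExp.holds, State.writeIReg_ireg,
    State.writeRReg_ireg, State.writeIReg_rreg, State.writeRReg_rreg, State.writeIReg_imem,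
    State.writeRReg_imem, State.writeIReg_rmem, State.writeRReg_rmem, if_true, if_false,
    Nat.reduceEqDiff, true_and, and_true, hc, hd, hκ, b1, b2, b3, b0]
  by_cases hf : s.ireg 13 = 1 ∧ s.rreg 12 ≤ s.rreg 13 <;> by_cases h2 : κ = 2 <;>
    by_cases h3 : κ = 3 <;>
    simp [hf, h2, h3, b0, b3]

end

end RealRAM

/-! ### Correctness of the climb -/

namespace RealRAM

open Cluster

section

variable {n b N P H : ℕ} {par : ℕ → ℕ} {len r : ℕ → ℝ} {s s' : State} {e : ℕ → Cluster}

/-- Only the total truncated at `k` matters, so the count for the sibling may be truncated at `k` as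
well before it is added. -/
theorem min_add_search {k R x cnt lo f m a : ℕ} {p : Prop} [Decidable p] (hf : f = 1 ↔ p)
    (hlo : lo = min (if f = 1 then min m k else 0) a) (hx : x = if p then a else 0) (ha : a ≤ m)
    (hc : min k cnt = min k R) : min k (cnt + lo) = min k (R + x) := by
  split_ifs at hlo hx <;> first | tauto | omega

/-- The sibling does not contain `j` and is entered at the vertex that it shares with the present
cluster, where the state is known. Its count and the state at its far end come from
`reached_of_top`, or from `reached_of_bot` if it lies above. -/
theorem climbStep_runs {j k F : ℕ} {dn up : ℝ} {D : ℕ → ℝ} {G : ℕ → Prop}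
    (hpar : ∀ y < n, y < par y) (S : Spread n par len r j dn up D G)
    (h : Hierarchy n par len r N P H s e) (hb : P + N + 2 * n + 5 < 2 ^ b) (h1 : s.ireg 1 = k)
    (hkn : k ≤ n) (hF : k < 2 ^ F) {c : ℕ} (hcN : c < N) (hc : s.ireg 10 = c)
    (h0 : s.imem 15 c ≠ 0) (hs : ClimbState n k par j D G (e c) s) :
    Runs b climbStep s fun t s' => t ≤ 5 * F + 32 ∧ s'.ireg 10 = s.imem 14 c ∧
      ClimbState n k par j D G (e (s.imem 14 c)) s' := by
  classical
  obtain ⟨hpN, hdN, hk⟩ := (h.linked c hcN).resolve_left h0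
  have hκ4 : s.imem 15 c ≤ 4 := by omega
  have hwfp := h.wf _ hpN
  generalize hd : s.imem 16 c = d at *
  generalize hκ : s.imem 15 c = κ at *
  generalize hp : s.imem 14 c = p at *
  have hnode := h.node d hdN
  have hcard : ∀ i < N, (e i).mem.card ≤ n := by
    intro i hi
    refine (Finset.card_le_card (t := Finset.range n) ?_).trans (by simp)
    exact fun z hz => Finset.mem_range.2 ((h.wf i hi).lt hz)
  have hcd := hcard d hdN
  have hcc := hcard c hcN
  have hsz := hnode.size
  have htl := hnode.top_le
  have hbl := hnode.bot_le
  have hcl := hs.count_le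
  have hbf := hs.bot_flag_le
  have htf := hs.top_flag_le
  generalize hm : (e d).mem.card = m at *
  unfold climbStep
  refine Runs.seq ((climbPrep_runs h1 hc hd hκ (by omega) (by omega) (by omega) (by omega)
    (by omega) (by omega) (by omega)).mono_frame ?_)
  rintro t1 s1 ⟨ht1, g11, g12, g13, g12', g14, g13', g15, g16⟩ F1
  have r4 := F1.rmem 4 (by decide)
  have hsorted : (slice (s1.rmem 4) (s1.ireg 14) m).Pairwise (· ≥ ·) := by
    rw [r4, g14, ← hm]
    split_ifs
    · exact hm ▸ hnode.bot_sorted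
    · exact hm ▸ hnode.top_sorted
  rw [hsz] at g16
  refine Runs.seq ((search_runs rfl g15 g16 rfl (m := m) (F := F) (by split_ifs <;> omega)
    (by split_ifs <;> omega) (by omega) hsorted).mono_frame ?_)
  rintro t2 s2 ⟨ht2, glo⟩ F2
  have hlo : s2.ireg 15 ≤ m := by
    rw [glo]
    refine (min_le_right _ _).trans ((atLeast_le _ _).trans (by simp))
  have e18 : s2.ireg 18 = s.ireg 18 := (F2.ireg 18 (by decide)).trans (F1.ireg 18 (by decide))
  have e19 : s2.ireg 19 = s.ireg 19 := (F2.ireg 19 (by decide)).trans (F1.ireg 19 (by decide))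
  have e20 : s2.ireg 20 = s.ireg 20 := (F2.ireg 20 (by decide)).trans (F1.ireg 20 (by decide))
  have e10 : s2.ireg 10 = c :=
    ((F2.ireg 10 (by decide)).trans (F1.ireg 10 (by decide))).trans hc
  have e11 : s2.ireg 11 = d := (F2.ireg 11 (by decide)).trans g11
  have e12 : s2.ireg 12 = κ := (F2.ireg 12 (by decide)).trans g12
  have e13 := F2.ireg 13 (by decide)
  have r10 : s2.rreg 10 = s.rreg 10 := (F2.rreg 10 (by decide)).trans (F1.rreg 10 (by decide))
  have r11 : s2.rreg 11 = s.rreg 11 := (F2.rreg 11 (by decide)).trans (F1.rreg 11 (by decide))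
  have r12 := F2.rreg 12 (by decide)
  have r13 := F2.rreg 13 (by decide)
  have e14 : s2.imem 14 c = p := by
    rw [F2.imem 14 (by decide), F1.imem 14 (by decide), hp]
  have m5 : s2.rmem 5 d = (e d).length len := by
    rw [F2.rmem 5 (by decide), F1.rmem 5 (by decide), hnode.length]
  refine (climbUpdate_runs e10 e11 e12 (by omega) (by omega) (by omega)).mono ?_
  rintro t3 s3 ⟨ht3, u18, u10, u20, u11', u19, u10'⟩
  refine ⟨by omega, by rw [u10, e14], ?_⟩
  have hmc := hs.count
  have hbd := hs.bot_dist
  have htd := hs.top_dist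
  have hbG := hs.bot_flag
  have htG := hs.top_flag
  have hj := hs.mem
  have hdj : ∀ {A B : Cluster}, Disjoint A.mem B.mem → (A.mem ∪ B.mem).card =
    A.mem.card + B.mem.card := fun h => Finset.card_union_of_disjoint h
  have hat : atLeast (s1.rreg 12) (slice (s1.rmem 4) (s1.ireg 14) m) ≤ m :=
    (atLeast_le _ _).trans (by simp)
  rw [e18] at u18
  rw [r12, m5] at u11' u10'
  rw [e13, r12, r13] at u20 u19
  rw [e20] at u20
  rw [e19] at u19
  rw [r11] at u11'
  rw [r10] at u10'
  rw [r4] at glo hat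
  have htopL : κ ≠ 3 → ∀ x, atLeast x (slice (s.rmem 4) (s1.ireg 14) m) =
      atLeast x ((e d).fromTop par len r) := by
    intro h3 x
    rw [g14, if_neg h3, ← hm]
    exact atLeast_perm hnode.top_perm
  have hflag : ∀ {q : Prop} [Decidable q], ((if q then 1 else 0 : ℕ) = 1 ↔ q) := by
    intro q _
    split_ifs with hq <;> simp [hq]
  have hflag_le : ∀ {q : Prop} [Decidable q], (if q then 1 else 0 : ℕ) ≤ 1 := by
    intro q _
    split_ifs <;> simp
  rcases hk with ⟨hk, hep⟩ | ⟨hk, hep⟩ | ⟨hk, hep⟩ | ⟨hk, hep⟩ <;> subst hk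
  · rw [hep] at hwfp ⊢
    simp only [Nat.reduceEqDiff, if_false, or_self] at *
    have hU := not_anc_of_rake_left hpar hwfp hj
    obtain ⟨q1, q2, q3⟩ := reached_of_top S (h.wf d hdN) hU
    cases hwfp with
    | rake hA hB htop hdis =>
    rw [← htop] at q1 q2 q3
    have hcu := hdj hdis
    rw [htopL (by decide), g12', htd] at glo
    rw [htopL (by decide), g12', htd] at hat
    refine ⟨Finset.mem_union_left _ hj, ?_, ?_, ?_, ?_, ?_, ?_, ?_, ?_⟩
    · rw [u18, reached_union rfl hdis]
      exact min_add_search htG glo q1 hat hmc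
    · rw [u18, Cluster.mem, hcu]; omega
    · rw [u19, hflag, Cluster.bot, q2, g13, g12', g13', htd, htG, hnode.capDown]
    · rw [u19]; exact hflag_le
    · rw [u20, Cluster.top, ← htop, htG]
    · rw [u20]; exact htf
    · rw [u10', g12', htd, Cluster.bot, q3]
    · rw [u11', htd, Cluster.top, ← htop]
  · rw [hep] at hwfp ⊢
    simp only [Nat.reduceEqDiff, if_false, if_true, true_or] at *
    have hU := not_anc_of_rake_right hpar hwfp hj
    obtain ⟨q1, q2, q3⟩ := reached_of_top S (h.wf d hdN) hU
    cases hwfp with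
    | rake hA hB htop hdis =>
    rw [htop] at q1 q2 q3
    have hcu := hdj hdis
    rw [htopL (by decide), g12', htd] at glo
    rw [htopL (by decide), g12', htd] at hat
    refine ⟨Finset.mem_union_right _ hj, ?_, ?_, ?_, ?_, ?_, ?_, ?_, ?_⟩
    · rw [u18, reached_union rfl hdis, Nat.add_comm (reached G (e d))]
      exact min_add_search htG glo q1 hat hmc
    · rw [u18, Cluster.mem, hcu]; omega
    · rw [u19, Cluster.bot, hbG]
    · rw [u19]; exact hbf
    · rw [u20, Cluster.top, htG]
    · rw [u20]; exact htf
    · rw [u10', Cluster.bot, hbd]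
    · rw [u11', htd, Cluster.top]
  -- The sibling lies above: the only case in which it is entered at its bottom, so `fromBot` and
  -- `capUp` take over.
  · rw [hep] at hwfp ⊢
    simp only [Nat.reduceEqDiff, if_false, if_true, or_true] at *
    have hanc := anc_of_comp_left hpar hwfp hj
    cases hwfp with
    | comp hA hB htop hdis =>
    obtain ⟨q1, q2, q3⟩ := reached_of_bot hpar S (h.wf d hdN)
      (Finset.disjoint_left.1 hdis hj) hanc
    rw [← htop] at q1 q2 q3
    have hcu := hdj hdis
    have hL : ∀ x, atLeast x (slice (s.rmem 4) (s1.ireg 14) m) =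
        atLeast x ((e d).fromBot par len r) := by
      intro x
      rw [g14, ← hm]
      exact atLeast_perm hnode.bot_perm
    rw [hL, g12', htd] at glo
    rw [hL, g12', htd] at hat
    refine ⟨Finset.mem_union_left _ hj, ?_, ?_, ?_, ?_, ?_, ?_, ?_, ?_⟩
    · rw [u18, reached_union rfl hdis]
      exact min_add_search htG glo q1 hat hmc
    · rw [u18, Cluster.mem, hcu]; omega
    · rw [u19, Cluster.bot, hbG]
    · rw [u19]; exact hbf
    · rw [u20, hflag, Cluster.top, q2, g13, g12', g13', htd, htG, hnode.capUp]
    · rw [u20]; exact hflag_le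
    · rw [u10', Cluster.bot, hbd]
    · rw [u11', g12', htd, Cluster.top, q3]
  · rw [hep] at hwfp ⊢
    simp only [Nat.reduceEqDiff, if_false, if_true, or_self] at *
    have hU := not_anc_of_comp_right hpar hwfp hj
    obtain ⟨q1, q2, q3⟩ := reached_of_top S (h.wf d hdN) hU
    cases hwfp with
    | comp hA hB htop hdis =>
    rw [htop] at q1 q2 q3
    have hcu := hdj hdis
    rw [htopL (by decide), g12', hbd] at glo
    rw [htopL (by decide), g12', hbd] at hat
    refine ⟨Finset.mem_union_right _ hj, ?_, ?_, ?_, ?_, ?_, ?_, ?_, ?_⟩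
    · rw [u18, reached_union rfl hdis, Nat.add_comm (reached G (e d))]
      exact min_add_search hbG glo q1 hat hmc
    · rw [u18, Cluster.mem, hcu]; omega
    · rw [u19, hflag, Cluster.bot, q2, g13, g12', g13', hbd, hbG, hnode.capDown]
    · rw [u19]; exact hflag_le
    · rw [u20, Cluster.top, htG]
    · rw [u20]; exact htf
    · rw [u10', g12', hbd, Cluster.bot, q3]
    · rw [u11', htd, Cluster.top]

/-- Depth strictly increases towards the parent, so there are at most `H` steps, and the climb ends
at a root, whose cluster consists of all vertices. -/
theorem climb_runs {j k F : ℕ} {dn up : ℝ} {D : ℕ → ℝ} {G : ℕ → Prop}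
    (hpar : ∀ y < n, y < par y) (S : Spread n par len r j dn up D G)
    (h : Hierarchy n par len r N P H s e) (hb : P + N + 2 * n + 5 < 2 ^ b) (h1 : s.ireg 1 = k)
    (hkn : k ≤ n) (hF : k < 2 ^ F) {c : ℕ} (hcN : c < N) (hc : s.ireg 10 = c)
    (hs : ClimbState n k par j D G (e c) s) :
    Runs b climb s fun t s' => t ≤ (5 * F + 33) * H + 1 ∧
      ∃ C, C.mem = Finset.range n ∧ ClimbState n k par j D G C s' := by
  unfold climb
  refine (Runs.while (fun f s' => ∃ c < N, s'.ireg 10 = c ∧ s'.imem = s.imem ∧ s'.rmem = s.rmem ∧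
    s'.ireg 1 = k ∧ ClimbState n k par j D G (e c) s' ∧ f = (5 * F + 33) * (H - (e c).depth)) ?_
    ⟨c, hcN, hc, rfl, rfl, h1, hs, rfl⟩).mono ?_
  · rintro f s1 ⟨c, hcN, hc, hI, hR, h1, hs, rfl⟩ h0
    simp only [BExp.holds, IExp.eval, hc] at h0
    have hH := h.congr hI hR
    refine (climbStep_runs hpar S hH hb h1 hkn hF hcN hc (by omega) hs).mono_frame ?_
    rintro t s2 ⟨ht, g10, h2⟩ F2
    obtain ⟨hpN, -, hk⟩ := (hH.linked c hcN).resolve_left (by omega)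
    have hdp := h.depth_le _ hpN
    have hdep : (e c).depth + 1 ≤ (e (s1.imem 14 c)).depth := by
      rcases hk with ⟨-, hk⟩ | ⟨-, hk⟩ | ⟨-, hk⟩ | ⟨-, hk⟩ <;>
      · rw [hk]
        simp only [Cluster.depth]
        omega
    refine ⟨_, ?_, _, hpN, g10, ?_, ?_, ?_, h2, rfl⟩
    · obtain ⟨x, hx⟩ : ∃ x, H - (e c).depth = H - (e (s1.imem 14 c)).depth + 1 + x :=
        ⟨H - (e c).depth - (H - (e (s1.imem 14 c)).depth + 1), by omega⟩
      rw [hx, Nat.mul_add, Nat.mul_add_one]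
      omega
    · exact (funext fun a => F2.imem a (by simp [climbStep, climbPrep, search, climbUpdate,
        Prog.imems])).trans hI
    · exact (funext fun a => F2.rmem a (by simp [climbStep, climbPrep, search, climbUpdate,
        Prog.rmems])).trans hR
    · exact (F2.ireg 1 (by decide)).trans h1
  · rintro t s' ⟨f, hf, ⟨z, hz, hsz, hI, -, -, hs, rfl⟩, h0⟩
    simp only [BExp.holds, IExp.eval, hsz, hI] at h0
    refine ⟨?_, e z, h.root z hz (by omega), hs⟩
    have := Nat.mul_le_mul_left (5 * F + 33) (Nat.sub_le H (e c).depth)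
    omega

/-- Bottom and top of the base cluster of `j` are the two ends of the edge of the point, so their
states are the base clauses of `S`. -/
theorem queryInit_runs {j k : ℕ} {dn up : ℝ} {D : ℕ → ℝ} {G : ℕ → Prop}
    (S : Spread n par len r j dn up D G) (hb : 1 < 2 ^ b) (h10 : s.ireg 10 = j)
    (hdn : s.rreg 10 = dn) (hup : s.rreg 11 = up) (h5 : s.imem 5 = par) (h3 : s.rmem 3 = r) :
    Runs b queryInit s fun t s' => t ≤ 7 ∧ ClimbState n k par j D G (.base j) s' := by
  classical
  refine (Runs.of_wp (Q := fun s' => s'.ireg 19 = (if dn ≤ r j then 1 else 0) ∧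
    s'.ireg 20 = (if up ≤ r (par j) then 1 else 0) ∧ s'.ireg 18 = s'.ireg 19 ∧
    s'.rreg 10 = dn ∧ s'.rreg 11 = up) ?_).mono ?_
  · have b0 : (0 : ℕ) < 2 ^ b := by omega
    by_cases h1 : dn ≤ r j <;> by_cases h2 : up ≤ r (par j) <;>
      simp [queryInit, wp, IExp.eval, RExp.eval, BExp.holds, h10, hdn, hup, h5, h3, h1, h2, hb]
  · rintro t s' ⟨ht, g19, g20, g18, r10, r11⟩
    have hR : reached G (.base j) = if dn ≤ r j then 1 else 0 := by
      simp only [reached, Cluster.mem, Finset.filter_singleton, S.base_iff]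
      split_ifs <;> simp
    refine ⟨ht, by simp [Cluster.mem], by rw [g18, g19, hR], ?_, ?_, ?_, ?_, ?_, ?_, ?_⟩
    · rw [g18, g19]
      split_ifs <;> simp [Cluster.mem]
    · rw [g19, Cluster.bot, S.base_iff]
      split_ifs with h <;> simp [h]
    · rw [g19]
      split_ifs <;> simp
    · rw [g20, Cluster.top, S.base_par_iff]
      split_ifs with h <;> simp [h]
    · rw [g20]
      split_ifs <;> simp
    · rw [r10, Cluster.bot, S.base_dist]
    · rw [r11, Cluster.top, S.base_par_dist]

end

end RealRAM

/-! ### Assembly of preprocessing and queries -/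

namespace RealRAM

open Cluster

/-- All that queries read, apart from the point. -/
structure Prepared {n : ℕ} (T : WeightedTree n) (lam : ℝ) (k : ℕ) (pos par : ℕ → ℕ) (len r : ℕ → ℝ)
    (N P H : ℕ) (e : ℕ → Cluster) (s : State) : Prop where
  rooted : T.Rooted lam pos par len r
  hierarchy : Hierarchy n par len r N P H s e
  pos_eq : s.imem 4 = pos
  par_eq : s.imem 5 = par
  len_eq : s.rmem 2 = len
  r_eq : s.rmem 3 = r
  bound : s.ireg 1 = k
  radius : s.rreg 0 = lam

section

variable {n b N P H k : ℕ} {T : WeightedTree n} {lam : ℝ} {pos par : ℕ → ℕ} {len r : ℕ → ℝ}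
  {s s' : State} {e : ℕ → Cluster}

theorem Prepared.congr (h : Prepared T lam k pos par len r N P H e s) (hI : s'.imem = s.imem)
    (hR : s'.rmem = s.rmem) (h1 : s'.ireg 1 = s.ireg 1) (h0 : s'.rreg 0 = s.rreg 0) :
    Prepared T lam k pos par len r N P H e s' :=
  ⟨h.rooted, h.hierarchy.congr hI hR, by rw [hI, h.pos_eq], by rw [hI, h.par_eq],
    by rw [hR, h.len_eq], by rw [hR, h.r_eq], by rw [h1, h.bound], by rw [h0, h.radius]⟩

theorem Prepared.pose (h : Prepared T lam k pos par len r N P H e s) (x : T.Point) :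
    Prepared T lam k pos par len r N P H e (T.pose s x) := by
  cases x <;> exact h.congr rfl rfl (by simp [WeightedTree.pose]) (by simp [WeightedTree.pose])

/-- A query writes no array and leaves the registers of `k` and `lam` alone; so the prepared state
outlives any sequence of queries. -/
theorem Prepared.answer (h : Prepared T lam k pos par len r N P H e s) {t : ℕ}
    (hx : Exec b answer s t s') : Prepared T lam k pos par len r N P H e s' := by
  have F := hx.frame
  have hI : RealRAM.answer.imems = [] := by decide
  have hR : RealRAM.answer.rmems = [] := by decide
  exact h.congr (funext fun a => F.imem a (by simp [hI])) (funext fun a => F.rmem a (by simp [hR]))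
    (F.ireg 1 (by decide)) (F.rreg 0 (by decide))

theorem Prepared.afterQueries (h : Prepared T lam k pos par len r N P H e s)
    (hs : T.AfterQueries b RealRAM.answer s s') : Prepared T lam k pos par len r N P H e s' := by
  induction hs with
  | none => exact h
  | more x _ hx ih => exact (ih.pose x).answer hx

/-- Parents have larger numbers, so the end with the smaller number is the lower one. A vertex is
posed with equal ends and becomes the point at distance `0` from it on the edge to its parent. -/
theorem locate_runs (h : Prepared T lam k pos par len r N P H e s) (hb : n < 2 ^ b) (x : T.Point) :
    Runs b locate (T.pose s x) fun t s' => t ≤ 9 ∧ ∃ j dn up,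
      WeightedTree.Rooted.Located pos par len T x j dn up ∧ s'.ireg 10 = j ∧ s'.rreg 10 = dn ∧
      s'.rreg 11 = up := by
  have R := h.rooted
  refine (Runs.of_wp ?_).mono fun t s' h => h
  cases x with
  | vertex v =>
    have hv := R.pos_lt v v.2
    simp only [locate, wp, WeightedTree.pose, IExp.eval, RExp.eval, BExp.holds,
      State.writeIReg_ireg, State.writeRReg_ireg, State.writeIReg_rreg, State.writeRReg_rreg,
      State.writeIReg_imem, State.writeRReg_imem, State.writeIReg_rmem, State.writeRReg_rmem,
      if_true, if_false, Nat.reduceEqDiff, h.pos_eq, h.len_eq, lt_irrefl, false_imp_iff,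
      not_false_eq_true, forall_const, true_and, OfNat.ofNat_ne_one, OfNat.one_ne_ofNat]
    refine ⟨by omega, by omega, by omega, _, _, _, .vertex v, rfl, rfl, by rw [sub_zero]⟩
  | onEdge u v huv x h0 h1 =>
    have hu := R.pos_lt u u.2
    have hv := R.pos_lt v v.2
    simp only [locate, wp, WeightedTree.pose, IExp.eval, RExp.eval, BExp.holds,
      State.writeIReg_ireg, State.writeRReg_ireg, State.writeIReg_rreg, State.writeRReg_rreg,
      State.writeIReg_imem, State.writeRReg_imem, State.writeIReg_rmem, State.writeRReg_rmem,
      if_true, if_false, Nat.reduceEqDiff, h.pos_eq, h.len_eq, not_false_eq_true, true_and,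
      OfNat.ofNat_ne_one, OfNat.one_ne_ofNat]
    refine ⟨by omega, by omega, fun hlt => ⟨by omega, ?_⟩, fun hlt => ⟨by omega, ?_⟩⟩
    · have hp : par (pos v) = pos u := by
        rcases (R.adj_iff u v).1 huv with hp | hp
        · have := R.lt_par _ hu
          omega
        · exact hp
      refine ⟨_, _, _, .upper u v huv x h0 h1 hp, rfl, ?_, rfl⟩
      rw [R.len_eq v u hp, Sym2.eq_swap]
    · have hp : par (pos u) = pos v := by
        rcases (R.adj_iff u v).1 huv with hp | hp
        · exact hp
        · have := R.lt_par _ hv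
          omega
      refine ⟨_, _, _, .lower u v huv x h0 h1 hp, rfl, rfl, ?_⟩
      rw [R.len_eq u v hp]

theorem answer_runs (h : Prepared T lam k pos par len r N P H e s) (hb : P + N + 2 * n + 5 < 2 ^ b)
    (hnN : n ≤ N) (hk1 : 1 ≤ k) (hkn : k ≤ n) {F : ℕ} (hF : k < 2 ^ F) (x : T.Point) :
    Runs b RealRAM.answer (T.pose s x) fun t s' => t ≤ (5 * F + 33) * H + 22 ∧
      s'.ireg 4 = if k ≤ T.largestSize lam x then 1 else 0 := by
  have hpose := h.pose x
  have R := h.rooted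
  unfold RealRAM.answer
  refine Runs.ite ?_ ?_
  · intro hlam
    simp only [BExp.holds, RExp.eval, hpose.radius, Rat.cast_zero] at hlam
    refine (Runs.of_wp (Q := fun s' => s'.ireg 4 = 0) ?_).mono ?_
    · simp only [wp, IExp.eval, State.writeIReg_ireg, if_true, and_true]
      omega
    · rintro t s' ⟨ht, h4⟩
      simp only [Prog.cost] at ht
      rw [h4, T.largestSize_of_neg hlam, if_neg (by omega)]
      exact ⟨by omega, rfl⟩
  intro hlam
  simp only [BExp.holds, RExp.eval, hpose.radius, Rat.cast_zero, not_lt] at hlam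
  refine Runs.seq ((locate_runs h (by omega) x).mono_frame ?_)
  rintro t1 s1 ⟨ht1, j, dn, up, hloc, g10, gdn, gup⟩ F1
  have hj := WeightedTree.Rooted.Located.lt R hloc
  have S : Spread n par len r j dn up _ _ := spread R.lt_par hj
  have h1 : Prepared T lam k pos par len r N P H e s1 := hpose.congr
    (funext fun a => F1.imem a (by simp [locate, Prog.imems]))
    (funext fun a => F1.rmem a (by simp [locate, Prog.rmems])) (F1.ireg 1 (by decide))
    (F1.rreg 0 (by decide))
  refine Runs.seq ((queryInit_runs (k := k) S (by omega) g10 gdn gup h1.par_eq h1.r_eq).mono_frame ?_)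
  rintro t2 s2 ⟨ht2, hc⟩ F2
  have h2 : Prepared T lam k pos par len r N P H e s2 := h1.congr
    (funext fun a => F2.imem a (by simp [queryInit, Prog.imems]))
    (funext fun a => F2.rmem a (by simp [queryInit, Prog.rmems])) (F2.ireg 1 (by decide))
    (F2.rreg 0 (by decide))
  -- The nodes below `n` are the base clusters, so the climb starts at node `j`.
  rw [← h.hierarchy.base j hj] at hc
  refine Runs.seq ((climb_runs R.lt_par S h2.hierarchy hb h2.bound hkn hF (c := j) (by omega)
    ((F2.ireg 10 (by decide)).trans g10) hc).mono_frame ?_)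
  rintro t3 s3 ⟨ht3, C, hC, hs⟩ F3
  have e1 : s3.ireg 1 = k := (F3.ireg 1 (by decide)).trans h2.bound
  have hR : T.largestSize lam x = C.reached (Reach n par len r j dn up) := by
    rw [R.largestSize_eq hloc S hlam, reached, hC]
  have hcount := hs.count
  refine (Runs.of_wp (Q := fun s' => s'.ireg 4 =
    if k ≤ T.largestSize lam x then 1 else 0) ?_).mono ?_
  · simp only [wp, IExp.eval, BExp.holds, State.writeIReg_ireg, if_true, e1, hR]
    refine ⟨fun hlt => ⟨by omega, ?_⟩, fun hlt => ⟨by omega, ?_⟩⟩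
    · rw [if_neg (by omega)]
    · rw [if_pos (by omega)]
  · rintro t4 s4 ⟨ht4, h4⟩
    simp only [Prog.cost] at ht4
    exact ⟨by omega, h4⟩

def preprocess : Prog := rootTree ;; initNodes ;; contractAll

theorem preprocess_runs (T : WeightedTree n) (E : T.EdgeList) (hb : 64 * (n + 1) ^ 2 < 2 ^ b)
    {L : ℕ} (hn : 1 ≤ n) (hL : n < 2 ^ L) (hLn : L ≤ n) :
    Runs b preprocess (T.initState E lam k) fun t s' => t ≤ 760 * (n * L) ∧
      ∃ pos par len r N P e, Prepared T lam k pos par len r N P (4 * L) e s' ∧ n ≤ N ∧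
        P + N + 2 * n + 5 < 2 ^ b := by
  have hL1 : 1 ≤ L := by
    by_contra! h0
    obtain rfl : L = 0 := by omega
    omega
  have hnL : n * 1 ≤ n * L := Nat.mul_le_mul_left n hL1
  unfold preprocess
  refine Runs.seq ((WeightedTree.rootTree_runs T E lam k hb hn).mono_frame ?_)
  rintro t1 s1 ⟨ht1, R, hle⟩ F1
  have h15 : ∀ i, s1.imem 15 i = 0 := by
    intro i
    rw [F1.imem 15 (by decide)]
    simp [WeightedTree.initState]
  have e0 : s1.ireg 0 = n := (F1.ireg 0 (by decide)).trans rfl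
  have e1 : s1.ireg 1 = k := (F1.ireg 1 (by decide)).trans rfl
  have er : s1.rreg 0 = lam := (F1.rreg 0 (by decide)).trans rfl
  obtain ⟨pos, hpos⟩ : ∃ pos, s1.imem 4 = pos := ⟨_, rfl⟩
  obtain ⟨par, hpar⟩ : ∃ par, s1.imem 5 = par := ⟨_, rfl⟩
  obtain ⟨len, hlen⟩ : ∃ len, s1.rmem 2 = len := ⟨_, rfl⟩
  obtain ⟨r, hr⟩ : ∃ r, s1.rmem 3 = r := ⟨_, rfl⟩
  rw [hpos, hpar, hlen, hr] at R
  rw [hpar] at hle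
  refine Runs.seq ((initNodes_runs hb e0 hpar hlen hr h15 hle).mono_frame ?_)
  rintro t2 s2 ⟨ht2, hf, h8, h13⟩ F2
  have hC := Contracted.of_initial hf h8 h13 ((F2.ireg 0 (by decide)).trans e0)
    ((F2.imem 5 (by decide)).trans hpar) ((F2.rmem 2 (by decide)).trans hlen)
    ((F2.rmem 3 (by decide)).trans hr) R.lt_par hle R.par_eq
  refine (contractAll_runs hb hL hLn hC (by simpa using hn)).mono_frame ?_
  rintro t3 s3 ⟨ht3, e, A, up, E', hC3, hA⟩ F3
  refine ⟨by omega, pos, par, len, r, s3.ireg 11, s3.ireg 12, e, ⟨R, hC3.hierarchy hA, ?_,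
    hC3.par_eq, hC3.len_eq, hC3.r_eq, ?_, ?_⟩, ?_, ?_⟩
  · rw [F3.imem 4 (by decide), F2.imem 4 (by decide), hpos]
  · rw [F3.ireg 1 (by decide), F2.ireg 1 (by decide), e1]
  · rw [F3.rreg 0 (by decide), F2.rreg 0 (by decide), er]
  · have := hC3.forest.count
    omega
  · have h1 := hC3.forest.storage_le hC3.depth_le
    have h2 := hC3.forest.count
    have h3 : n * (4 * L + 1) ≤ n * (4 * n + 1) := Nat.mul_le_mul_left n (by omega)
    nlinarith

end

end RealRAM

open RealRAM in
theorem WeightedTree.exists_preprocess_query :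
    ∃ C : ℕ, ∀ (n : ℕ) (T : WeightedTree n) (E : T.EdgeList) (lam : ℝ) (k : ℕ), 1 ≤ k → k ≤ n →
      Runs (C * (Nat.log 2 n + 1)) preprocess (T.initState E lam k) fun t₀ s₀ =>
        t₀ ≤ C * (n * (Nat.log 2 n + 1)) ∧
        ∀ s, T.AfterQueries (C * (Nat.log 2 n + 1)) answer s₀ s → ∀ x : T.Point,
          Runs (C * (Nat.log 2 n + 1)) answer (T.pose s x) fun t s' =>
            t ≤ C * ((Nat.log 2 n + 1) * (Nat.log 2 k + 1)) ∧
            s'.ireg 4 = if k ≤ T.largestSize lam x then 1 else 0 := by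
  -- The constant is dictated by the preprocessing time; as a factor for the word length and for the
  -- query time it is more than enough.
  refine ⟨760, fun n T E lam k hk1 hkn => ?_⟩
  have hL : n < 2 ^ (Nat.log 2 n + 1) := Nat.lt_pow_succ_log_self (by norm_num) n
  have hF : k < 2 ^ (Nat.log 2 k + 1) := Nat.lt_pow_succ_log_self (by norm_num) k
  have hLn : Nat.log 2 n + 1 ≤ n := Nat.log_lt_self 2 (by omega)
  generalize hLL : Nat.log 2 n + 1 = L at *
  generalize hFF : Nat.log 2 k + 1 = F at *
  have hb : 64 * (n + 1) ^ 2 < 2 ^ (760 * L) := by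
    calc 64 * (n + 1) ^ 2 ≤ 2 ^ 6 * (2 ^ L) ^ 2 :=
          Nat.mul_le_mul_left _ (Nat.pow_le_pow_left hL 2)
      _ = 2 ^ (6 + L * 2) := by rw [pow_add, pow_mul]
      _ < 2 ^ (760 * L) := Nat.pow_lt_pow_right (by norm_num) (by omega)
  have hLF : L ≤ L * F := Nat.le_mul_of_pos_right L (by omega)
  have hLF1 : 1 ≤ L * F := by omega
  refine (preprocess_runs T E hb (by omega) hL hLn).mono ?_
  rintro t₀ s₀ ⟨ht₀, pos, par, len, r, N, P, e, hP, hnN, hbound⟩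
  refine ⟨ht₀, fun s hs x => (answer_runs (hP.afterQueries hs) hbound hnN hk1 hkn hF x).mono ?_⟩
  rintro t s' ⟨ht, h4⟩
  refine ⟨?_, h4⟩
  -- There are at most `4 * L` steps of the climb, each with a search of about `5 * F` steps; the
  -- other terms are absorbed because `F` is at least `1`.
  have h1 : (5 * F + 33) * (4 * L) = 20 * (L * F) + 132 * L := by ring
  omega

theorem mainTheorem7 :
    ∃ (preprocess query : RealRAM.Prog) (C : ℕ),
      ∀ (n : ℕ) (T : WeightedTree n) (E : T.EdgeList) (lam : ℝ) (k : ℕ), 1 ≤ k → k ≤ n →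
        ∃ (t₀ : ℕ) (s₀ : RealRAM.State),
          RealRAM.Exec (C * (Nat.log 2 n + 1)) preprocess (T.initState E lam k) t₀ s₀ ∧
          t₀ ≤ C * (n * (Nat.log 2 n + 1)) ∧
          ∀ s : RealRAM.State, T.AfterQueries (C * (Nat.log 2 n + 1)) query s₀ s →
            ∀ x : T.Point,
              ∃ (t : ℕ) (s' : RealRAM.State),
                RealRAM.Exec (C * (Nat.log 2 n + 1)) query (T.pose s x) t s' ∧
                t ≤ C * ((Nat.log 2 n + 1) * (Nat.log 2 k + 1)) ∧
                s'.ireg 4 = if k ≤ T.largestSize lam x then 1 else 0 := by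
  obtain ⟨C, hC⟩ := WeightedTree.exists_preprocess_query
  exact ⟨RealRAM.preprocess, RealRAM.answer, C, hC⟩
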